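/- Let $F$ be the law on $\mathbb{R}_+^2\times\mathbb{R}^2$ of a generic type vector $(W^+,W^-,Q,\zeta)$ such that, for some $\delta\in(0,1]$ and $c\in(0,1)$, $$E\big[(W^+)^{1+\delta}+(W^-)^2+|Q|\big]<\infty,\qquad |\zeta|\le c \text{ a.s.},\qquad (W^+,Q)\text{ is independent of }(W^-,\zeta),$$ and $E[W^-]>0$. Put $\theta=E[W^++W^-]$. Let $\mathbf W_i=(W_i^+,W_i^-,Q_i,\zeta_i)$, $i\ge1$, be i.i.d. with law $F$, let $\mathscr F=\sigma(\mathbf W_i:i\ge1)$, write $\mathbb{E}_{\mathbf W}[\cdot]=E[\cdot\mid\mathscr F]$, and $L_n^+=\sum_{i=1}^nW_i^+$. For $n\ge1$ the *Poisson branching tree* is the marked multi-type branching tree whose nodes have types in $\{1,\dots,n\}$ and which, given $\mathscr F$, is as follows: the type of the root $\emptyset$ is uniform on $\{1,\dots,n\}$; nodes behave independently of each other; a node of type $s$ has independent Poisson numbers of offspring of the types $j=1,\dots,n$, with means $W_s^+W_j^- /(\theta n)$, its offspring being labelled in uniformly random order; and independently a node $\mathbf i$ of type $s$ carries a mark $\mathcal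 D_{\mathbf i}$ such that $\mathcal D_{\mathbf i}-1$ is Poisson with mean $W_s^-L_n^+/(\theta n)$. For a node $\mathbf i$ of type $s$ let $\hat C_{\mathbf i}=\zeta_s/\mathcal D_{\mathbf i}$, $\hat Q_{\mathbf i}=Q_s$, let $\hat N_{\mathbf i}$ be its number of offspring $(\mathbf i,1),\dots,(\mathbf i,\hat N_{\mathbf i})$, and define its rank computed up to generation $k$ by $$\hat R_{\mathbf i}^{(n,0)}=0,\qquad \hat R_{\mathbf i}^{(n,k)}=\sum_{j=1}^{\hat N_{\mathbf i}}\hat C_{(\mathbf i,j)}\hat R_{(\mathbf i,j)}^{(n,k-1)}+\hat Q_{\mathbf i},\quad k\ge1 .$$ Let $(\mathcal N,\mathcal Q)$ and $\mathcal C$ be independent with $$P(\mathcal N=m,\mathcal Q\in dq)=E\Big[1(Q\in dq)\,e^{-E[W^-]W^+/\theta}\frac{(E[W^-]W^+/\theta)^m}{m!}\Big],\qquad P(\mathcal C\in dt)=\frac{E\big[1(\zeta/(Z^-+1)\in dt)\,W^-\big]}{E[W^-]},$$ where, given the type vector, $Z^-$ is Poisson with mean $E[W^+]W^- /\theta$.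 Let $\mathcal R$ be the attracting endogenous solution of $\mathcal R\stackrel{\mathcal D}{=}\sum_{j=1}^{\mathcal N}\mathcal C_j\mathcal R_j+\mathcal Q$, i.e. $\mathcal R=\sum_{\mathbf i}\Pi_{\mathbf i}\mathcal Q_{\mathbf i}$, where $(\mathcal N_{\mathbf i},\mathcal Q_{\mathbf i},\mathcal C_{\mathbf i})$ are i.i.d. copies of $(\mathcal N,\mathcal Q,\mathcal C)$ indexed by finite words $\mathbf i$ over $\{1,2,\dots\}$, the sum is over all nodes of the tree in which $\mathbf i$ has offspring $(\mathbf i,1),\dots,(\mathbf i,\mathcal N_{\mathbf i})$, and $\Pi_\emptyset=1$, $\Pi_{(\mathbf i,j)}=\mathcal C_{(\mathbf i,j)}\Pi_{\mathbf i}$. Then the series defining $\mathcal R$ converges absolutely a.s., $\mathcal R$ is integrable, and for any $k_n\to\infty$ the variables $\hat R_\emptyset^{(n,k_n)}$ are integrable and, as $n\to\infty$, $$\hat R_\emptyset^{(n,k_n)}\Rightarrow\mathcal R\qquad\text{and}\qquad \mathbb{E}_{\mathbf W}\big[|\hat R_\emptyset^{(n,k_n)}|\big]\to E[|\mathcal R|]\quad\text{a.s.}$$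 -/

import Mathlib

open MeasureTheory ProbabilityTheory Filter Topology
open scoped NNReal ENNReal

noncomputable section

/-! ### Vertex types -/

/-- A vertex type `(W⁺, W⁻, Q, ζ)`, an element of `ℝ₊² × ℝ²`. -/
abbrev VType : Type := ℝ≥0 × ℝ≥0 × ℝ × ℝ

namespace VType

/-- The in-attribute `W⁺`. -/
def wIn (x : VType) : ℝ := x.1

/-- The out-attribute `W⁻`. -/
def wOut (x : VType) : ℝ := x.2.1

/-- The personalization value `Q`. -/
def pers (x : VType) : ℝ := x.2.2.1

/-- The weight `ζ`. -/
def wt (x : VType) : ℝ := x.2.2.2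

end VType

/-- `E[W⁺]` for a type vector with law `F`. -/
def meanIn (F : Measure VType) : ℝ := ∫ x, x.wIn ∂F

/-- `E[W⁻]` for a type vector with law `F`. -/
def meanOut (F : Measure VType) : ℝ := ∫ x, x.wOut ∂F

/-- `θ = E[W⁺ + W⁻]` for a type vector with law `F`. -/
def theta (F : Measure VType) : ℝ := ∫ x, (x.wIn + x.wOut) ∂F

/-- The assumptions on the law `F` of the generic type vector: for some `δ ∈ (0, 1]` and
`c ∈ (0, 1)`, `E[(W⁺)^(1+δ) + (W⁻)² + |Q|] < ∞`, `|ζ| ≤ c` a.s., and `(W⁺, Q)` is independent of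
`(W⁻, ζ)`. -/
structure TypeAssumption (F : Measure VType) : Prop where
  exists_bounds : ∃ δ c : ℝ, 0 < δ ∧ δ ≤ 1 ∧ 0 < c ∧ c < 1 ∧
    Integrable (fun x : VType => x.wIn ^ (1 + δ) + x.wOut ^ (2 : ℕ) + |x.pers|) F ∧
    ∀ᵐ x ∂F, |x.wt| ≤ c
  indep : IndepFun (fun x : VType => (x.wIn, x.pers)) (fun x : VType => (x.wOut, x.wt)) F

/-! ### The Poisson branching tree

Nodes are labelled by finite words of natural numbers. The word `(i₁, …, i_k)` is stored in
reverse order, as the list `[i_k, …, i₁]`, so that the root is `[]` and the `j`-th offspring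
(`j = 0, 1, …`) of the node `u` is `j :: u`. -/

/-- Lists of vertices carry the discrete σ-algebra. -/
instance instMeasurableSpaceListFin (n : ℕ) : MeasurableSpace (List (Fin n)) := ⊤

/-- Node data carry the discrete σ-algebra. -/
instance instMeasurableSpaceNodeData (n : ℕ) : MeasurableSpace (Option (Fin n × ℕ)) := ⊤

/-- A marked tree with types among `n` vertices: `T u = none` if the node `u` is not in the tree,
and `T u = some (s, d)` if it is in the tree, its type is that of vertex `s` and its mark is `d`. -/
abbrev MarkedTree (n : ℕ) : Type := List ℕ → Option (Fin n × ℕ)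

/-- `q_{js} = W_s⁺ W_j⁻ / (θ n)`: the mean number of offspring of type `j` of a node of type `s`. -/
def offspringRate (θ : ℝ) (n : ℕ) (w : ℕ → VType) (j s : Fin n) : ℝ≥0 :=
  Real.toNNReal ((w s).wIn * (w j).wOut / (θ * n))

/-- The law of the types of the offspring of a node of type `s`, listed by label: the numbers
`z j` of offspring of the various types `j` are independent Poisson variables with means `q_{js}`,
and given these numbers the offspring are put in uniformly random order. -/
def offspringLaw (θ : ℝ) (n : ℕ) (w : ℕ → VType) (s : Fin n) : Measure (List (Fin n)) :=
  (Measure.pi (fun j : Fin n => poissonMeasure (offspringRate θ n w j s))).bind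
    (fun z => uniformOn {l : List (Fin n) | ∀ j, l.count j = z j})

/-- The law of the mark of a node of type `s`: one plus a Poisson variable with mean
`W_s⁻ L_n⁺ / (θ n)`, where `L_n⁺` is the sum of all `W_i⁺`. -/
def markLaw (θ : ℝ) (n : ℕ) (w : ℕ → VType) (s : Fin n) : Measure ℕ :=
  (poissonMeasure (Real.toNNReal ((w s).wOut * (∑ i : Fin n, (w i).wIn) / (θ * n)))).map
    (fun m => m + 1)

/-- Given the type of the root and, for each potential node `u` and type `s`, the list of types of
the offspring that `u` has in case its type is `s`: the type of the node `u`, or `none` if `u` is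
not in the tree. -/
def nodeType {n : ℕ} (root : Fin n) (off : List ℕ × Fin n → List (Fin n)) :
    List ℕ → Option (Fin n)
  | [] => some root
  | j :: u => (nodeType root off u).bind (fun s => (off (u, s))[j]?)

/-- The marked tree grown from a root type and a choice, for each potential node and type, of a
list of offspring types and of a mark. -/
def growTree {n : ℕ} (x : Fin n × (List ℕ × Fin n → List (Fin n) × ℕ)) : MarkedTree n :=
  fun u => (nodeType x.1 (fun p => (x.2 p).1) u).map (fun s => (s, (x.2 (u, s)).2))

/-- The law of the Poisson branching tree given the types `w 0, …, w (n - 1)`: the type of the root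
is uniform, all nodes behave independently, and given its type, the offspring and the mark of a
node are independent with laws `offspringLaw` and `markLaw`. -/
def pbtLaw (θ : ℝ) (n : ℕ) (w : ℕ → VType) : Measure (MarkedTree n) :=
  ((uniformOn (Set.univ : Set (Fin n))).prod
    (Measure.infinitePi (fun p : List ℕ × Fin n =>
      (offspringLaw θ n w p.2).prod (markLaw θ n w p.2)))).map growTree

/-! ### Ranks on a marked tree -/

/-- The number `N_u` of offspring of the node `u`. -/
def numOffspring {n : ℕ} (T : MarkedTree n) (u : List ℕ) : ℕ :=
  Set.ncard {j : ℕ | T (j :: u) ≠ none}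

/-- The weight `C_u = ζ_s / D_u` of a node `u` with type `s` and mark `D_u`. -/
def nodeWeight {n : ℕ} (w : ℕ → VType) (T : MarkedTree n) (u : List ℕ) : ℝ :=
  match T u with
  | none => 0
  | some (s, d) => (w s).wt / d

/-- The personalization value `Q_u = Q_s` of a node `u` with type `s`. -/
def nodePers {n : ℕ} (w : ℕ → VType) (T : MarkedTree n) (u : List ℕ) : ℝ :=
  match T u with
  | none => 0
  | some (s, _) => (w s).pers

/-- The rank of a node: `R_u^{(k)} = ∑_{j} C_{(u,j)} R_{(u,j)}^{(k-1)} + Q_u` for `k ≥ 1`, the sum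
being over the offspring of `u`, and `R_u^{(0)} = 0`. -/
def treeRank {n : ℕ} (w : ℕ → VType) (T : MarkedTree n) : ℕ → List ℕ → ℝ
  | 0, _ => 0
  | k + 1, u => (∑ j ∈ Finset.range (numOffspring T u),
      nodeWeight w T (j :: u) * treeRank w T k (j :: u)) + nodePers w T u

/-- The σ-algebra generated by the type sequence. -/
@[reducible] def typeSigma {Ω : Type*} (W : ℕ → Ω → VType) : MeasurableSpace Ω :=
  ⨆ i, MeasurableSpace.comap (W i) inferInstance

/-! ### The attracting endogenous solution -/

/-- The law of `(𝓝, 𝓠)`: given the type vector, `𝓠 = Q` and `𝓝` is Poisson with mean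
`E[W⁻] W⁺ / θ`. -/
def branchLaw (F : Measure VType) : Measure (ℕ × ℝ) :=
  F.bind (fun x => (poissonMeasure (Real.toNNReal (meanOut F * x.wIn / theta F))).map
    (fun m => (m, x.pers)))

/-- The law of `𝓒`: the law of `ζ / (Z⁻ + 1)` under the probability with density `W⁻ / E[W⁻]`,
where given the type vector `Z⁻` is Poisson with mean `E[W⁺] W⁻ / θ`. -/
def weightLaw (F : Measure VType) : Measure ℝ :=
  (F.withDensity (fun x => ENNReal.ofReal (x.wOut / meanOut F))).bind
    (fun x => (poissonMeasure (Real.toNNReal (meanIn F * x.wOut / theta F))).map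
      (fun m : ℕ => x.wt / ((m : ℝ) + 1)))

/-- `(N_u, Q_u, C_u)`, `u` ranging over all nodes, are i.i.d. random vectors (defining a weighted
branching process); `(N_u, Q_u)` and `C_u` are independent, with laws `branchLaw F` and
`weightLaw F`. -/
structure IsBranchingFamily {Ω : Type*} [MeasurableSpace Ω] (F : Measure VType) (P : Measure Ω)
    (N : List ℕ → Ω → ℕ) (Q C : List ℕ → Ω → ℝ) : Prop where
  measurable_N : ∀ u, Measurable (N u)
  measurable_Q : ∀ u, Measurable (Q u)
  measurable_C : ∀ u, Measurable (C u)
  indep : iIndepFun (fun u ω => ((N u ω, Q u ω), C u ω)) P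
  law : ∀ u, P.map (fun ω => ((N u ω, Q u ω), C u ω)) = (branchLaw F).prod (weightLaw F)

/-- The path weight `Π_u`: the product of the weights along the path from the root (excluded) to
`u`, and zero if `u` is not in the tree, i.e. if some entry of the label `u` exceeds the number of
offspring available. -/
def pathWeight (N : List ℕ → ℕ) (C : List ℕ → ℝ) : List ℕ → ℝ
  | [] => 1
  | j :: u => if j < N u then C (j :: u) * pathWeight N C u else 0

/-- The attracting endogenous solution `𝓡 = ∑_u Π_u Q_u`, the sum being over all nodes of the
tree. -/
def endogenousSolution (N : List ℕ → ℕ) (Q C : List ℕ → ℝ) : ℝ :=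
  ∑' u : List ℕ, pathWeight N C u * Q u

end

open MeasureTheory ProbabilityTheory Filter Topology
open scoped NNReal ENNReal

noncomputable section

/-! Fix the type sequence. Given its type `s`, a node has independent Poisson numbers of offspring
of the various types, with means `W_s⁺ W_j⁻ / (θ n)`. This kernel has rank one. By the Poisson
generating functional, the rank of a node of type `s` computed up to generation `k + 1` therefore
has characteristic function `exp (i t Q_s) * exp (W_s⁺ B_k(t))`, where the single function `B_k`
(`treeLogChar`) does not depend on `s`. Moreover `B_{k+1}` is an explicit empirical mean, over the
first `n` types, of a functional of `B_k` (`treeLogChar_succ`). The order of the offspring plays no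
role.

A law of large numbers in a space of continuous functions (`uniform_strong_law`) then gives, almost
surely and for every `k`, convergence of `B_k` to a deterministic `limLogChar`, uniformly on compact
sets (`tendstoUniformlyOn_treeLogChar`). The frequencies met in the recursion stay in `[-T, T]`
because the weights are at most one in absolute value. The limiting recursion is that of the
weighted branching process: since `(W⁺, Q)` is independent of `(W⁻, ζ)`, the law `F` is unchanged
when these halves come from two independent copies (`map_recombine`). This separates `𝓒` from `(𝓝,
𝓠)` (`mul_limChildChar_sub_one`).

To let the number of generations grow with `n`, truncation errors must be controlled uniformly in
`n`. They are dominated by the increments of the rank built from absolute weights and values. Its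
means satisfy an affine recursion with factor at most `c < 1` for each `n`, because `λ E[1 / (Z +
1)] ≤ 1` for `Z` Poisson of mean `λ` (`contractCoeff_le`, `rootMean_sub_le`). The limiting process
obeys the same bound, which gives absolute convergence and integrability of the series.

The absolute rank converges in law together with its mean, so it makes the signed ranks uniformly
integrable and their absolute first moments converge (`tendsto_integral_abs`). For this reason the
recursions carry a map `a` applied to weights and values, taken to be `id` or `abs`. Finally, the
conditional law of the tree given the types is identified with `pbtLaw` (`condDistrib_eq_pbtLaw`),
so that conditional expectations are integrals with frozen types. Weak convergence under `P` follows
by integrating the conditional characteristic functions. -/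

/-! ### Unimodular exponentials -/

/-- The point `exp (i r)` of the unit circle. -/
def cis (r : ℝ) : ℂ := Complex.exp (r * Complex.I)

lemma norm_cis (r : ℝ) : ‖cis r‖ = 1 := Complex.norm_exp_ofReal_mul_I r

lemma cis_zero : cis 0 = 1 := by simp [cis]

lemma cis_add (r s : ℝ) : cis (r + s) = cis r * cis s := by
  simp [cis, add_mul, Complex.exp_add]

lemma cis_sum {ι : Type*} (s : Finset ι) (f : ι → ℝ) :
    cis (∑ i ∈ s, f i) = ∏ i ∈ s, cis (f i) := by
  simp [cis, Finset.sum_mul, Complex.exp_sum]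

lemma continuous_cis : Continuous cis := by unfold cis; fun_prop

@[fun_prop]
lemma Measurable.cis {α : Type*} [MeasurableSpace α] {f : α → ℝ} (hf : Measurable f) :
    Measurable (fun x => cis (f x)) := continuous_cis.measurable.comp hf

@[fun_prop]
lemma Continuous.cis {α : Type*} [TopologicalSpace α] {f : α → ℝ} (hf : Continuous f) :
    Continuous (fun x => cis (f x)) := continuous_cis.comp hf

lemma charFun_map_eq_integral_cis {α : Type*} [MeasurableSpace α] {μ : Measure α} {X : α → ℝ}
    (hX : AEMeasurable X μ) (t : ℝ) : charFun (μ.map X) t = ∫ x, cis (t * X x) ∂μ := by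
  rw [charFun_apply_real, integral_map hX (by fun_prop)]
  simp [_root_.cis]

/-! ### Products of independent variables -/

section Product

variable {ι : Type*} {E : ι → Type*} [∀ i, MeasurableSpace (E i)]

/-- A finite cylinder over `Option ι` is a constraint at `none` times a cylinder over `ι`, and such
cylinders determine a product measure. This will detach the root from the rest of the node data. -/
lemma infinitePi_option {E : Type*} [MeasurableSpace E] (ν : Option ι → Measure E)
    [∀ o, IsProbabilityMeasure (ν o)] :
    (Measure.infinitePi ν).map (fun x => (x none, fun i => x (some i))) =
      (ν none).prod (Measure.infinitePi fun i => ν (some i)) := by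
  classical
  let Ψ : E × (ι → E) → Option ι → E := fun q o => o.elim q.1 q.2
  have hΨ : Measurable Ψ := by
    refine measurable_pi_lambda _ fun o => ?_
    cases o with
    | none => exact measurable_fst
    | some i => exact (measurable_pi_apply i).comp measurable_snd
  have key : ((ν none).prod (Measure.infinitePi fun i => ν (some i))).map Ψ =
      Measure.infinitePi ν := by
    refine Measure.eq_infinitePi ν fun s t ht => ?_
    rw [Measure.map_apply hΨ (.pi s.countable_toSet fun _ _ => ht _)]
    have : Ψ ⁻¹' ((s : Set (Option ι)).pi t) =
        (if none ∈ s then t none else Set.univ) ×ˢ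
          ((s.eraseNone : Finset ι) : Set ι).pi (fun i => t (some i)) := by
      ext ⟨a, y⟩
      simp only [Set.mem_preimage, Set.mem_pi, Set.mem_prod, Finset.mem_coe,
        Finset.mem_eraseNone, Option.forall, Ψ]
      by_cases h : none ∈ s <;> simp [h]
    rw [this, Measure.prod_prod, Measure.infinitePi_pi _ (fun i _ => ht _)]
    by_cases h : none ∈ s
    · have hs : s = Finset.insertNone s.eraseNone := by
        rw [Finset.insertNone_eraseNone, Finset.insert_eq_of_mem h]
      conv_rhs => rw [hs]
      rw [Finset.prod_insertNone]
      simp [h]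
    · have hs : s = s.eraseNone.map Function.Embedding.some := by
        rw [Finset.map_some_eraseNone, Finset.erase_eq_of_notMem h]
      conv_rhs => rw [hs]
      rw [Finset.prod_map]
      simp [h]
  rw [← key, Measure.map_map (by fun_prop) hΨ]
  exact Measure.map_id

lemma integral_infinitePi_prod_fin {X : Type*} [MeasurableSpace X] (μ : Measure X)
    [IsProbabilityMeasure μ] (m : ℕ) (φ : Fin m → X → ℂ) (hφ : ∀ i, Measurable (φ i)) :
    ∫ y, ∏ i, φ i (y i) ∂(Measure.infinitePi fun _ : ℕ => μ) = ∏ i, ∫ x, φ i x ∂μ := by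
  have h := Measure.map_infinitePi_infinitePi_of_inj (P := fun _ : ℕ => μ)
      (f := (Fin.val : Fin m → ℕ))
    Fin.val_injective
  rw [← integral_fintype_prod_eq_prod (μ := fun _ => μ), ← Measure.infinitePi_eq_pi, ← h,
    integral_map (measurable_pi_lambda _ fun i => measurable_pi_apply _).aemeasurable
      (Finset.measurable_fun_prod _ fun i _ =>
        (hφ i).comp (measurable_pi_apply i)).aestronglyMeasurable]

end Product

/-! ### Multi-type weighted branching recursions -/

section Branching

variable {n : ℕ} {E : Type*}

/-- The node data of the subtree rooted at the `i`-th offspring of the root. -/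
def subtree (i : ℕ) (x : List ℕ × Fin n → E) : List ℕ × Fin n → E := fun p => x (p.1 ++ [i], p.2)

/-- The rank of a root of type `s` computed up to generation `k`, for node data `x`: a node of type
`s` with data `e` has offspring of types `ch s e`, weight `wt s e` and value `pers s e`. -/
def branchRank (ch : Fin n → E → List (Fin n)) (wt pers : Fin n → E → ℝ) :
    ℕ → Fin n → (List ℕ × Fin n → E) → ℝ
  | 0, _, _ => 0
  | k + 1, s, x => pers s (x ([], s)) + ∑ i : Fin (ch s (x ([], s))).length,
      wt (ch s (x ([], s)))[i] (subtree i x ([], (ch s (x ([], s)))[i])) *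
        branchRank ch wt pers k (ch s (x ([], s)))[i] (subtree i x)

/-- The rank up to generation `k + 1` as a function of the data of the root and of the subtrees
of its offspring. -/
def rankStep (ch : Fin n → E → List (Fin n)) (wt pers : Fin n → E → ℝ) (k : ℕ) (s : Fin n)
    (p : E × (ℕ → List ℕ × Fin n → E)) : ℝ :=
  pers s p.1 + ∑ i : Fin (ch s p.1).length,
    wt (ch s p.1)[i] (p.2 i ([], (ch s p.1)[i])) *
      branchRank ch wt pers k (ch s p.1)[i] (p.2 i)

/-- The difference consists of the contributions of generations `k` to `m - 1`, to which the
triangle inequality applies path by path. Every truncation error is thereby reduced to a difference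
of means of nonnegative ranks, which are computable. -/
lemma abs_branchRank_sub_le (ch : Fin n → E → List (Fin n)) (wt pers : Fin n → E → ℝ)
    {k m : ℕ} (hkm : k ≤ m) (s : Fin n) (x : List ℕ × Fin n → E) :
    |branchRank ch wt pers m s x - branchRank ch wt pers k s x| ≤
      branchRank ch (fun j e => |wt j e|) (fun j e => |pers j e|) m s x -
        branchRank ch (fun j e => |wt j e|) (fun j e => |pers j e|) k s x := by
  induction m generalizing k s x with
  | zero => obtain rfl : k = 0 := by omega
            simp
  | succ m ih =>
    cases k with
    | zero =>
      have h0 : ∀ s x, |branchRank ch wt pers m s x| ≤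
          branchRank ch (fun j e => |wt j e|) (fun j e => |pers j e|) m s x := fun s x => by
        simpa [branchRank] using ih (Nat.zero_le m) s x
      simp only [branchRank, sub_zero]
      refine (abs_add_le _ _).trans (add_le_add le_rfl ((Finset.abs_sum_le_sum_abs _ _).trans ?_))
      refine Finset.sum_le_sum fun i _ => ?_
      rw [abs_mul]
      exact mul_le_mul_of_nonneg_left (h0 _ _) (abs_nonneg _)
    | succ k =>
      simp only [branchRank, add_sub_add_left_eq_sub, ← Finset.sum_sub_distrib, ← mul_sub]
      refine (Finset.abs_sum_le_sum_abs _ _).trans (Finset.sum_le_sum fun i _ => ?_)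
      rw [abs_mul]
      exact mul_le_mul_of_nonneg_left (ih (by omega) _ _) (abs_nonneg _)

lemma branchRank_abs_mono (ch : Fin n → E → List (Fin n)) (wt pers : Fin n → E → ℝ)
    {k m : ℕ} (hkm : k ≤ m) (s : Fin n) (x : List ℕ × Fin n → E) :
    branchRank ch (fun j e => |wt j e|) (fun j e => |pers j e|) k s x ≤
      branchRank ch (fun j e => |wt j e|) (fun j e => |pers j e|) m s x :=
  sub_nonneg.1 ((abs_nonneg _).trans (abs_branchRank_sub_le ch wt pers hkm s x))

lemma abs_branchRank_le (ch : Fin n → E → List (Fin n)) (wt pers : Fin n → E → ℝ)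
    (k : ℕ) (s : Fin n) (x : List ℕ × Fin n → E) :
    |branchRank ch wt pers k s x| ≤
      branchRank ch (fun j e => |wt j e|) (fun j e => |pers j e|) k s x := by
  simpa [branchRank] using abs_branchRank_sub_le ch wt pers (Nat.zero_le k) s x

lemma branchRank_abs_nonneg (ch : Fin n → E → List (Fin n)) (wt pers : Fin n → E → ℝ)
    (k : ℕ) (s : Fin n) (x : List ℕ × Fin n → E) :
    0 ≤ branchRank ch (fun j e => |wt j e|) (fun j e => |pers j e|) k s x :=
  (abs_nonneg _).trans (abs_branchRank_le ch wt pers k s x)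

variable [MeasurableSpace E]

@[fun_prop]
lemma measurable_subtree (i : ℕ) : Measurable (subtree i : (List ℕ × Fin n → E) → _) :=
  measurable_pi_lambda _ fun _ => measurable_pi_apply _

lemma measurable_rankStep_of {ch : Fin n → E → List (Fin n)} {wt pers : Fin n → E → ℝ} {k : ℕ}
    (hch : ∀ s, Measurable (ch s)) (hwt : ∀ s, Measurable (wt s)) (hpers : ∀ s, Measurable (pers s))
    (hk : ∀ s, Measurable (branchRank ch wt pers k s)) (s : Fin n) :
    Measurable (rankStep ch wt pers k s) := by
  -- The range of the sum depends on the data. Treating the list of children as a separate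
  -- coordinate in a countable space lets it be frozen.
  have h : Measurable (fun q : List (Fin n) × (E × (ℕ → List ℕ × Fin n → E)) =>
      pers s q.2.1 + ∑ i : Fin q.1.length, wt q.1[i] (q.2.2 i ([], q.1[i])) *
        branchRank ch wt pers k q.1[i] (q.2.2 i)) := by
    refine measurable_from_prod_countable_right fun l => ?_
    change Measurable fun y : E × (ℕ → List ℕ × Fin n → E) => pers s y.1 + ∑ i : Fin l.length,
      wt l[i] (y.2 i ([], l[i])) * branchRank ch wt pers k l[i] (y.2 i)
    refine ((hpers s).comp measurable_fst).add (Finset.measurable_fun_sum _ fun i _ => ?_)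
    refine Measurable.mul ?_ ?_
    · exact (hwt _).comp (by fun_prop)
    · exact (hk _).comp (by fun_prop)
  exact h.comp (((hch s).comp measurable_fst).prodMk measurable_id)

@[fun_prop]
lemma measurable_branchRank {ch : Fin n → E → List (Fin n)} {wt pers : Fin n → E → ℝ}
    (hch : ∀ s, Measurable (ch s)) (hwt : ∀ s, Measurable (wt s)) (hpers : ∀ s, Measurable (pers s))
    (k : ℕ) (s : Fin n) : Measurable (branchRank ch wt pers k s) := by
  induction k generalizing s with
  | zero => exact measurable_const
  | succ k ih =>
    exact (measurable_rankStep_of hch hwt hpers ih s).comp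
      ((measurable_pi_apply ([], s)).prodMk (measurable_pi_lambda _ fun i => measurable_subtree i))

lemma measurable_rankStep {ch : Fin n → E → List (Fin n)} {wt pers : Fin n → E → ℝ}
    (hch : ∀ s, Measurable (ch s)) (hwt : ∀ s, Measurable (wt s)) (hpers : ∀ s, Measurable (pers s))
    (k : ℕ) (s : Fin n) : Measurable (rankStep ch wt pers k s) :=
  measurable_rankStep_of hch hwt hpers (measurable_branchRank hch hwt hpers k) s

/-- The law of independent node data, with law `ν s` for nodes of type `s`. -/
abbrev nodeLaw (ν : Fin n → Measure E) : Measure (List ℕ × Fin n → E) :=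
  Measure.infinitePi fun p : List ℕ × Fin n => ν p.2

variable (ν : Fin n → Measure E) [∀ s, IsProbabilityMeasure (ν s)]

instance : IsProbabilityMeasure (nodeLaw ν) := by unfold nodeLaw; infer_instance

/-- The branching property. The data of the root and of its offspring's subtrees live on disjoint
sets of coordinates, so they are independent, and each subtree is a copy of the whole family. -/
lemma map_root_subtrees (s : Fin n) :
    (nodeLaw ν).map (fun x => (x ([], s), fun i => subtree i x)) =
      (ν s).prod (Measure.infinitePi fun _ : ℕ => nodeLaw ν) := by
  -- Words are stored in reverse, so the subtree of child `i` consists of the words ending in `i`.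
  -- This last entry makes `f` injective.
  let f : Option (ℕ × (List ℕ × Fin n)) → List ℕ × Fin n :=
    fun o => o.elim ([], s) (fun q => (q.2.1 ++ [q.1], q.2.2))
  have hf : Function.Injective f := by
    rintro (_ | ⟨i, v, j⟩) (_ | ⟨i', v', j'⟩) h
    · rfl
    · simp [f] at h
    · simp [f] at h
    · simp only [f, Option.elim, Prod.mk.injEq] at h
      have := List.append_inj' h.1 rfl
      simp_all
  have h1 := Measure.map_infinitePi_infinitePi_of_inj
    (P := fun p : List ℕ × Fin n => ν p.2) hf
  have h2 := infinitePi_option (fun o => ν (f o).2)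
  rw [← h1, Measure.map_map (by fun_prop) (by fun_prop)] at h2
  have h3 := Measure.infinitePi_map_curry (fun (_ : ℕ) (p : List ℕ × Fin n) => ν p.2)
  have h4 := congrArg (fun m => m.map (Prod.map id (MeasurableEquiv.curry ℕ (List ℕ × Fin n) E))) h2
  rw [Measure.map_map (by fun_prop) (by fun_prop), ← Measure.map_prod_map _ _ (by fun_prop)
    (by fun_prop), Measure.map_id] at h4
  exact h4.trans (congrArg _ h3)

/-- Conditionally on the root data the subtrees are independent, so the exponential factors over the
children. The frequency may depend on the root data because the weight of a node is read from the
same data as its offspring: `τ` equal to `t` times the weight handles weighted ranks, and a constant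
`τ` handles the root. -/
lemma integral_cis_branchRank_succ {ch : Fin n → E → List (Fin n)} {wt pers : Fin n → E → ℝ}
    (hch : ∀ s, Measurable (ch s)) (hwt : ∀ s, Measurable (wt s)) (hpers : ∀ s, Measurable (pers s))
    {τ : E → ℝ} (hτ : Measurable τ) (k : ℕ) (s : Fin n) :
    ∫ x, cis (τ (x ([], s)) * branchRank ch wt pers (k + 1) s x) ∂(nodeLaw ν) =
      ∫ e, cis (τ e * pers s e) * ((ch s e).map fun j =>
        ∫ x, cis (τ e * (wt j (x ([], j)) * branchRank ch wt pers k j x)) ∂(nodeLaw ν)).prod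
        ∂(ν s) := by
  have hm := measurable_rankStep hch hwt hpers k s
  have hR := measurable_branchRank hch hwt hpers k
  have h1 : ∫ x, cis (τ (x ([], s)) * branchRank ch wt pers (k + 1) s x) ∂(nodeLaw ν) =
      ∫ p, cis (τ p.1 * rankStep ch wt pers k s p)
        ∂((nodeLaw ν).map (fun x => (x ([], s), fun i => subtree i x))) := by
    rw [integral_map (Measurable.aemeasurable (by fun_prop))
      (Measurable.aestronglyMeasurable (by fun_prop))]
    rfl
  rw [h1, map_root_subtrees, integral_prod]
  · refine integral_congr_ae (ae_of_all _ fun e => ?_)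
    simp only [rankStep, mul_add, cis_add, Finset.mul_sum, cis_sum]
    rw [integral_const_mul, integral_infinitePi_prod_fin (nodeLaw ν) (ch s e).length
      (fun i x => cis (τ e * (wt (ch s e)[i] (x ([], (ch s e)[i])) *
        branchRank ch wt pers k (ch s e)[i] x))), ← Fin.prod_univ_fun_getElem]
    · rfl
    · intro i
      have := hR (ch s e)[i]
      have := hwt (ch s e)[i]
      fun_prop
  · refine Integrable.of_bound (Measurable.aestronglyMeasurable (by fun_prop)) 1 (ae_of_all _ ?_)
    simp [norm_cis]

/-- First-moment counterpart of the characteristic function recursion, with `g` in the role of the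
absolute weight of the root. Lower integrals make it available before integrability is known. -/
lemma lintegral_branchRank_succ {ch : Fin n → E → List (Fin n)} {wt pers : Fin n → E → ℝ}
    (hch : ∀ s, Measurable (ch s)) (hwt : ∀ s, Measurable (wt s)) (hpers : ∀ s, Measurable (pers s))
    {g : E → ℝ≥0∞} (hg : Measurable g) (k : ℕ) (s : Fin n) :
    ∫⁻ x, g (x ([], s)) * ENNReal.ofReal
        (branchRank ch (fun j e => |wt j e|) (fun j e => |pers j e|) (k + 1) s x) ∂(nodeLaw ν) =
      ∫⁻ e, g e * (ENNReal.ofReal |pers s e| + ((ch s e).map fun j =>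
        ∫⁻ x, ENNReal.ofReal |wt j (x ([], j))| * ENNReal.ofReal
          (branchRank ch (fun j e => |wt j e|) (fun j e => |pers j e|) k j x) ∂(nodeLaw ν)).sum)
        ∂(ν s) := by
  have hwt' : ∀ j, Measurable (fun e => |wt j e|) := fun j => measurable_abs.comp (hwt j)
  have hpers' : ∀ j, Measurable (fun e => |pers j e|) := fun j => measurable_abs.comp (hpers j)
  have hm := measurable_rankStep hch hwt' hpers' k s
  have hR := measurable_branchRank hch hwt' hpers' k
  have h1 : ∫⁻ x, g (x ([], s)) * ENNReal.ofReal
        (branchRank ch (fun j e => |wt j e|) (fun j e => |pers j e|) (k + 1) s x) ∂(nodeLaw ν) =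
      ∫⁻ p, g p.1 * ENNReal.ofReal
        (rankStep ch (fun j e => |wt j e|) (fun j e => |pers j e|) k s p)
        ∂((nodeLaw ν).map (fun x => (x ([], s), fun i => subtree i x))) := by
    rw [lintegral_map (by fun_prop) (by fun_prop)]
    rfl
  rw [h1, map_root_subtrees, lintegral_prod _ (Measurable.aemeasurable (by fun_prop))]
  refine lintegral_congr fun e => ?_
  have hne : ∀ (i : Fin (ch s e).length) (x : List ℕ × Fin n → E), 0 ≤ |wt (ch s e)[i]
      (x ([], (ch s e)[i]))| *
        branchRank ch (fun j e => |wt j e|) (fun j e => |pers j e|) k (ch s e)[i] x :=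
    fun i x => mul_nonneg (abs_nonneg _) (branchRank_abs_nonneg _ _ _ _ _ _)
  have hmeas : ∀ i : Fin (ch s e).length, Measurable fun x : List ℕ × Fin n → E =>
      ENNReal.ofReal (|wt (ch s e)[i] (x ([], (ch s e)[i]))| *
        branchRank ch (fun j e => |wt j e|) (fun j e => |pers j e|) k (ch s e)[i] x) := fun i => by
    have := hR (ch s e)[i]
    have := hwt (ch s e)[i]
    fun_prop
  have hme : Measurable fun y : ℕ → List ℕ × Fin n → E => ENNReal.ofReal
      (rankStep ch (fun j e => |wt j e|) (fun j e => |pers j e|) k s (e, y)) :=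
    (hm.comp measurable_prodMk_left).ennreal_ofReal
  refine (lintegral_const_mul (g e) hme).trans ?_
  congr 1
  have h2 : ∀ y : ℕ → List ℕ × Fin n → E, ENNReal.ofReal
      (rankStep ch (fun j e => |wt j e|) (fun j e => |pers j e|) k s (e, y)) =
      ENNReal.ofReal |pers s e| + ∑ i : Fin (ch s e).length,
        ENNReal.ofReal (|wt (ch s e)[i] (y i ([], (ch s e)[i]))| *
        branchRank ch (fun j e => |wt j e|) (fun j e => |pers j e|) k (ch s e)[i] (y i)) := by
    intro y
    rw [rankStep, ENNReal.ofReal_add (abs_nonneg _) (Finset.sum_nonneg fun i _ => hne i (y i)),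
      ENNReal.ofReal_sum_of_nonneg fun i _ => hne i (y i)]
  simp_rw [h2]
  rw [lintegral_add_left measurable_const, lintegral_const, measure_univ, mul_one,
      lintegral_finsetSum,
    ← Fin.sum_univ_fun_getElem]
  · congr 1
    refine Finset.sum_congr rfl fun i _ => ?_
    have h3 := lintegral_map (μ := Measure.infinitePi fun _ : ℕ => nodeLaw ν) (hmeas i)
      (measurable_pi_apply (i : ℕ))
    rw [Measure.infinitePi_map_eval] at h3
    rw [← h3]
    exact lintegral_congr fun x => ENNReal.ofReal_mul (abs_nonneg _)
  · intro i _
    exact (hmeas i).comp (measurable_pi_apply (i : ℕ))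

end Branching

/-! ### Poisson integrals -/

section Poisson

lemma integral_pow_poissonMeasure (r : ℝ≥0) (z : ℂ) :
    ∫ m, z ^ m ∂(poissonMeasure r) = Complex.exp (r * (z - 1)) := by
  rw [integral_poissonMeasure]
  calc ∑' a : ℕ, (Real.exp (-r) * r ^ a / (a.factorial : ℝ) : ℝ) • z ^ a
      = ∑' a : ℕ, (Real.exp (-r) : ℂ) * ((r * z) ^ a / (a.factorial : ℂ)) := by
        congr with a
        rw [Complex.real_smul]
        push_cast
        rw [mul_pow]
        ring
    _ = (Real.exp (-r) : ℂ) * Complex.exp (r * z) := by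
        rw [tsum_mul_left, (NormedSpace.expSeries_div_hasSum_exp (r * z : ℂ)).tsum_eq,
          Complex.exp_eq_exp_ℂ]
    _ = Complex.exp (r * (z - 1)) := by
        rw [Complex.ofReal_exp, ← Complex.exp_add]
        push_cast
        ring_nf

lemma lintegral_poissonMeasure (r : ℝ≥0) (f : ℕ → ℝ≥0∞) :
    ∫⁻ m, f m ∂(poissonMeasure r) =
      ∑' m : ℕ, ENNReal.ofReal (Real.exp (-r) * r ^ m / (m.factorial : ℝ)) * f m := by
  rw [poissonMeasure, lintegral_sum_measure]
  simp [lintegral_smul_measure, lintegral_dirac]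

/-- The size-biasing identity of the Poisson law. Read in the two directions, it gives the mean and
the bound on `r E[1 / (Z + 1)]`. -/
lemma poisson_weight_succ (r : ℝ) (m : ℕ) :
    Real.exp (-r) * r ^ (m + 1) / ((m + 1).factorial : ℝ) * (m + 1 : ℝ) =
      r * (Real.exp (-r) * r ^ m / (m.factorial : ℝ)) := by
  have : (m.factorial : ℝ) ≠ 0 := by positivity
  have : (m + 1 : ℝ) ≠ 0 := by positivity
  rw [Nat.factorial_succ]
  push_cast
  field_simp
  ring

lemma tsum_poisson_weight (r : ℝ≥0) :
    ∑' m : ℕ, ENNReal.ofReal (Real.exp (-r) * r ^ m / (m.factorial : ℝ)) = 1 := by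
  simpa using (lintegral_poissonMeasure r 1).symm

lemma lintegral_natCast_poissonMeasure (r : ℝ≥0) :
    ∫⁻ m : ℕ, (m : ℝ≥0∞) ∂(poissonMeasure r) = r := by
  rw [lintegral_poissonMeasure, tsum_eq_zero_add' ENNReal.summable]
  have h : ∀ m : ℕ, ENNReal.ofReal (Real.exp (-r) * r ^ (m + 1) / ((m + 1).factorial : ℝ)) *
      ((m + 1 : ℕ) : ℝ≥0∞) =
      r * ENNReal.ofReal (Real.exp (-r) * r ^ m / (m.factorial : ℝ)) := fun m => by
    rw [← ENNReal.ofReal_natCast, ← ENNReal.ofReal_mul (by positivity), Nat.cast_succ,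
      poisson_weight_succ, ENNReal.ofReal_mul (by positivity), ENNReal.ofReal_coe_nnreal]
  simp only [h, ENNReal.tsum_mul_left, tsum_poisson_weight]
  simp

/-- `λ E[1 / (Z + 1)] ≤ 1` for `Z` Poisson with mean `λ`. -/
lemma mul_lintegral_inv_succ_poissonMeasure_le (r : ℝ≥0) :
    r * ∫⁻ m : ℕ, ENNReal.ofReal (1 / ((m : ℝ) + 1)) ∂(poissonMeasure r) ≤ 1 := by
  rw [lintegral_poissonMeasure, ← ENNReal.tsum_mul_left, ← tsum_poisson_weight r]
  have h : ∀ m : ℕ, (r : ℝ≥0∞) * (ENNReal.ofReal (Real.exp (-r) * r ^ m / (m.factorial : ℝ)) *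
      ENNReal.ofReal (1 / ((m : ℝ) + 1))) =
      ENNReal.ofReal (Real.exp (-r) * r ^ (m + 1) / ((m + 1).factorial : ℝ)) := fun m => by
    rw [← ENNReal.ofReal_coe_nnreal, ← ENNReal.ofReal_mul (by positivity),
      ← ENNReal.ofReal_mul (by positivity), ← mul_assoc, ← poisson_weight_succ]
    congr 1
    field_simp
  simp only [h]
  -- What remains on the left is the total mass without its atom at zero, that is `P(Z ≥ 1)`.
  rw [tsum_eq_zero_add' (f := fun m : ℕ =>
    ENNReal.ofReal (Real.exp (-r) * r ^ m / (m.factorial : ℝ))) ENNReal.summable]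
  exact le_add_self

/-- Near `x₀` the rate stays below `r x₀ + 1`, so the series is dominated by an exponential series
and converges uniformly there. -/
lemma continuous_integral_poissonMeasure {X : Type*} [TopologicalSpace X] {r : X → ℝ≥0}
    (hr : Continuous r) {f : ℕ → X → ℂ} (hf : ∀ m, Continuous (f m)) {C : ℝ}
    (hC : ∀ m x, ‖f m x‖ ≤ C) : Continuous fun x => ∫ m, f m x ∂(poissonMeasure (r x)) := by
  simp only [integral_poissonMeasure]
  refine continuous_iff_continuousAt.2 fun x₀ => ?_
  have hopen : IsOpen {x | r x < r x₀ + 1} := isOpen_lt hr continuous_const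
  refine ContinuousOn.continuousAt (s := {x | r x < r x₀ + 1}) ?_
    (hopen.mem_nhds (show r x₀ < r x₀ + 1 from lt_add_one _))
  refine continuousOn_tsum (u := fun m : ℕ => ((r x₀ + 1 : ℝ≥0) : ℝ) ^ m / (m.factorial : ℝ) * C)
    (fun m => Continuous.continuousOn ?_) ?_ fun m x hx => ?_
  · exact ((((Real.continuous_exp.comp (by fun_prop)).mul (by fun_prop)).div_const _)).smul (hf m)
  · exact (Real.summable_pow_div_factorial _).mul_right C
  · have h0 : 0 ≤ C := (norm_nonneg _).trans (hC m x)
    rw [norm_smul]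
    refine mul_le_mul ?_ (hC m x) (norm_nonneg _) (by positivity)
    rw [Real.norm_of_nonneg (by positivity)]
    gcongr
    have h1 : Real.exp (-(r x : ℝ)) ≤ 1 := Real.exp_le_one_iff.2 (by simp)
    have h2 : (r x : ℝ) ^ m ≤ ((r x₀ + 1 : ℝ≥0) : ℝ) ^ m :=
      pow_le_pow_left₀ (by positivity) (by exact_mod_cast le_of_lt hx) m
    calc Real.exp (-(r x : ℝ)) * (r x : ℝ) ^ m ≤ 1 * ((r x₀ + 1 : ℝ≥0) : ℝ) ^ m :=
          mul_le_mul h1 h2 (by positivity) zero_le_one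
      _ = _ := one_mul _

/-- The Poisson measures as a kernel from the rates. -/
def poissonRateKernel : Kernel ℝ≥0 ℕ where
  toFun := poissonMeasure
  measurable' := by
    refine Measure.measurable_of_measurable_coe _ fun s _ => ?_
    have h : ∀ r, poissonMeasure r s =
        ∑' m : ℕ, ENNReal.ofReal (Real.exp (-r) * r ^ m / (m.factorial : ℝ)) *
          s.indicator 1 m := fun r => by
      rw [← lintegral_poissonMeasure, lintegral_indicator_one .of_discrete]
    simp only [h]
    fun_prop

lemma poissonRateKernel_apply (r : ℝ≥0) : poissonRateKernel r = poissonMeasure r := rfl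

instance : IsMarkovKernel poissonRateKernel :=
  ⟨fun r => by rw [poissonRateKernel_apply]; infer_instance⟩

variable {X Y : Type*} [MeasurableSpace X] [MeasurableSpace Y]

/-- Rewrites a mixed Poisson law as the image of a composition product with a kernel, to which the
Fubini theorems for kernels apply. -/
lemma bind_poissonMeasure_map (μ : Measure X) [SFinite μ] {r : X → ℝ≥0} (hr : Measurable r)
    {h : X → ℕ → Y} (hh : ∀ m, Measurable fun x => h x m) :
    μ.bind (fun x => (poissonMeasure (r x)).map (h x)) =
      (μ ⊗ₘ poissonRateKernel.comap r hr).map (fun p => h p.1 p.2) := by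
  have hh' : Measurable fun p : X × ℕ => h p.1 p.2 := measurable_from_prod_countable_left hh
  have hmap : ∀ (x : X) (s : Set Y), MeasurableSet s → (poissonMeasure (r x)).map (h x) s =
      poissonRateKernel.comap r hr x (Prod.mk x ⁻¹' ((fun p : X × ℕ => h p.1 p.2) ⁻¹' s)) := by
    intro x s hs
    rw [Measure.map_apply .of_discrete hs]
    rfl
  have hm : Measurable fun x => (poissonMeasure (r x)).map (h x) := by
    refine Measure.measurable_of_measurable_coe _ fun s hs => ?_
    simp only [hmap _ s hs]
    exact Kernel.measurable_kernel_prodMk_left (hh' hs)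
  ext s hs
  rw [Measure.bind_apply hs hm.aemeasurable, Measure.map_apply hh' hs,
    Measure.compProd_apply (hh' hs)]
  exact lintegral_congr fun x => hmap x s hs

lemma lintegral_bind_poissonMeasure_map (μ : Measure X) [SFinite μ] {r : X → ℝ≥0}
    (hr : Measurable r) {h : X → ℕ → Y} (hh : ∀ m, Measurable fun x => h x m) {g : Y → ℝ≥0∞}
    (hg : Measurable g) :
    ∫⁻ y, g y ∂(μ.bind (fun x => (poissonMeasure (r x)).map (h x))) =
      ∫⁻ x, ∫⁻ m, g (h x m) ∂(poissonMeasure (r x)) ∂μ := by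
  have hh' : Measurable fun p : X × ℕ => h p.1 p.2 := measurable_from_prod_countable_left hh
  rw [bind_poissonMeasure_map μ hr hh, lintegral_map hg hh']
  exact Measure.lintegral_compProd (hg.comp hh')

lemma integral_bind_poissonMeasure_map (μ : Measure X) [IsFiniteMeasure μ] {r : X → ℝ≥0}
    (hr : Measurable r) {h : X → ℕ → Y} (hh : ∀ m, Measurable fun x => h x m) {g : Y → ℂ}
    (hg : Measurable g) {C : ℝ} (hC : ∀ y, ‖g y‖ ≤ C) :
    ∫ y, g y ∂(μ.bind (fun x => (poissonMeasure (r x)).map (h x))) =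
      ∫ x, ∫ m, g (h x m) ∂(poissonMeasure (r x)) ∂μ := by
  have hh' : Measurable fun p : X × ℕ => h p.1 p.2 := measurable_from_prod_countable_left hh
  rw [bind_poissonMeasure_map μ hr hh, integral_map hh'.aemeasurable hg.aestronglyMeasurable]
  exact Measure.integral_compProd
    (Integrable.of_bound (hg.comp hh').aestronglyMeasurable C (ae_of_all _ fun _ => hC _))

lemma isProbabilityMeasure_bind_poissonMeasure_map (μ : Measure X) [IsProbabilityMeasure μ]
    {r : X → ℝ≥0} (hr : Measurable r) {h : X → ℕ → Y} (hh : ∀ m, Measurable fun x => h x m) :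
    IsProbabilityMeasure (μ.bind (fun x => (poissonMeasure (r x)).map (h x))) := by
  rw [bind_poissonMeasure_map μ hr hh]
  exact Measure.isProbabilityMeasure_map
    (measurable_from_prod_countable_left hh : Measurable fun p : X × ℕ => h p.1 p.2).aemeasurable

end Poisson

/-! ### The offspring and mark laws -/

section Offspring

variable {n : ℕ}

lemma finite_setOf_count_eq (z : Fin n → ℕ) : {l : List (Fin n) | ∀ j, l.count j = z j}.Finite := by
  refine (List.finite_length_eq (Fin n) (∑ j, z j)).subset fun l hl => ?_
  simp only [Set.mem_ofPred_eq] at hl ⊢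
  rw [← Finset.sum_congr rfl fun j _ => hl j]
  simpa using (Multiset.sum_count_eq_card (s := Finset.univ) (m := (l : Multiset (Fin n)))
    (by simp)).symm

lemma nonempty_setOf_count_eq (z : Fin n → ℕ) :
    {l : List (Fin n) | ∀ j, l.count j = z j}.Nonempty := by
  refine ⟨(∑ j, Multiset.replicate (z j) j).toList, fun j => ?_⟩
  rw [← Multiset.coe_count, Multiset.coe_toList, Multiset.count_sum']
  simp [Multiset.count_replicate]

variable (θ : ℝ) (w : ℕ → VType) (s : Fin n)

/-- Given `z`, the uniform order is concentrated on lists with counts exactly `z`, so forgetting the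
order leaves the Poisson counts. -/
lemma map_count_offspringLaw :
    (offspringLaw θ n w s).map (fun l j => l.count j) =
      Measure.pi (fun j : Fin n => poissonMeasure (offspringRate θ n w j s)) := by
  ext A hA
  rw [Measure.map_apply .of_discrete hA, offspringLaw,
    Measure.bind_apply .of_discrete (Measurable.of_discrete).aemeasurable]
  rw [← lintegral_indicator_one hA]
  refine lintegral_congr fun z => ?_
  by_cases hz : z ∈ A
  · rw [Set.indicator_of_mem hz, Pi.one_apply]
    refine uniformOn_eq_one_of (finite_setOf_count_eq z) (nonempty_setOf_count_eq z) fun l hl => ?_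
    have : (fun j => l.count j) = z := funext hl
    simpa [this] using hz
  · rw [Set.indicator_of_notMem hz, uniformOn_eq_zero_iff (finite_setOf_count_eq z)]
    refine Set.eq_empty_of_forall_notMem fun l hl => hz ?_
    have : (fun j => l.count j) = z := funext hl.1
    simpa [this] using hl.2

instance : IsProbabilityMeasure (offspringLaw θ n w s) := by
  have h : IsProbabilityMeasure ((offspringLaw θ n w s).map (fun l j => l.count j)) := by
    rw [map_count_offspringLaw]; infer_instance
  exact (Measure.isProbabilityMeasure_map_iff
    (f := fun (l : List (Fin n)) j => l.count j) Measurable.of_discrete.aemeasurable).1 h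

instance : IsProbabilityMeasure (markLaw θ n w s) :=
  Measure.isProbabilityMeasure_map Measurable.of_discrete.aemeasurable

/-- The product depends on the list only through its counts, which are independent Poisson. This is
their joint generating function. -/
lemma integral_prod_offspringLaw (f : Fin n → ℂ) :
    ∫ l, (l.map f).prod ∂(offspringLaw θ n w s) =
      Complex.exp (∑ j, (offspringRate θ n w j s : ℂ) * (f j - 1)) := by
  have h : ∀ l : List (Fin n), (l.map f).prod = ∏ j, f j ^ (l.count j) := fun l => by
    rw [Finset.prod_list_map_count]
    refine Finset.prod_subset (Finset.subset_univ _) fun j _ hj => ?_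
    rw [List.count_eq_zero_of_not_mem (by simpa using hj), pow_zero]
  simp only [h]
  have := integral_map (μ := offspringLaw θ n w s) (φ := fun l j => l.count j)
    Measurable.of_discrete.aemeasurable (f := fun z : Fin n → ℕ => ∏ j, f j ^ z j)
    (Measurable.of_discrete.aestronglyMeasurable)
  rw [← this, map_count_offspringLaw, integral_fintype_prod_eq_prod (fun j (m : ℕ) => f j ^ m),
    Complex.exp_sum]
  exact Finset.prod_congr rfl fun j _ => integral_pow_poissonMeasure _ _

lemma lintegral_sum_offspringLaw (f : Fin n → ℝ≥0∞) :
    ∫⁻ l, (l.map f).sum ∂(offspringLaw θ n w s) = ∑ j, (offspringRate θ n w j s : ℝ≥0∞) * f j := by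
  have h : ∀ l : List (Fin n), (l.map f).sum = ∑ j, (l.count j : ℝ≥0∞) * f j := fun l => by
    rw [Finset.sum_list_map_count]
    simp only [nsmul_eq_mul]
    refine Finset.sum_subset (Finset.subset_univ _) fun j _ hj => ?_
    rw [List.count_eq_zero_of_not_mem (by simpa using hj), Nat.cast_zero, zero_mul]
  simp only [h]
  have := lintegral_map (μ := offspringLaw θ n w s) (g := fun l j => l.count j)
    (f := fun z : Fin n → ℕ => ∑ j, (z j : ℝ≥0∞) * f j) Measurable.of_discrete
    Measurable.of_discrete
  rw [← this, map_count_offspringLaw, lintegral_finsetSum _ fun _ _ => Measurable.of_discrete]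
  refine Finset.sum_congr rfl fun j _ => ?_
  rw [lintegral_mul_const _ Measurable.of_discrete]
  congr 1
  have h2 := (measurePreserving_eval (fun j => poissonMeasure (offspringRate θ n w j s)) j)
  rw [← lintegral_natCast_poissonMeasure, ← h2.map_eq,
    lintegral_map Measurable.of_discrete (measurable_pi_apply j)]

end Offspring

/-! ### The Poisson branching tree as a branching recursion -/

section Tree

variable {n : ℕ}

/-- Types are defined by adding a generation at the far end, while the branching recursion peels off
the first one. This lemma passes from one description to the other. -/
lemma nodeType_append (root : Fin n) (off : List ℕ × Fin n → List (Fin n)) (v : List ℕ) (i : ℕ) :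
    nodeType root off (v ++ [i]) =
      ((off ([], root))[i]?).bind fun s => nodeType s (subtree i off) v := by
  induction v with
  | nil => simp [nodeType]
  | cons j v ih =>
    simp only [List.cons_append, nodeType, ih, Option.bind_assoc]
    rfl

lemma growTree_append (s : Fin n) (x : List ℕ × Fin n → List (Fin n) × ℕ) (v : List ℕ) (i : ℕ) :
    growTree (s, x) (v ++ [i]) =
      ((x ([], s)).1[i]?).bind fun s' => growTree (s', subtree i x) v := by
  simp only [growTree, nodeType_append]
  cases (x ([], s)).1[i]? <;> rfl

lemma treeRank_append (w : ℕ → VType) (T : MarkedTree n) (k : ℕ) (v u : List ℕ) :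
    treeRank w T k (v ++ u) = treeRank w (fun v => T (v ++ u)) k v := by
  induction k generalizing v with
  | zero => rfl
  | succ k ih =>
    simp only [treeRank]
    congr 1
    exact Finset.sum_congr rfl fun j _ => congrArg₂ _ rfl (ih (j :: v))

lemma numOffspring_growTree (s : Fin n) (x : List ℕ × Fin n → List (Fin n) × ℕ) :
    numOffspring (growTree (s, x)) [] = (x ([], s)).1.length := by
  have h : {j : ℕ | growTree (s, x) [j] ≠ none} = (Finset.range (x ([], s)).1.length : Set ℕ) := by
    ext j
    have := growTree_append s x [] j
    simp only [List.nil_append] at this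
    rw [Set.mem_ofPred_eq, this, Finset.coe_range, Set.mem_Iio]
    by_cases hj : j < (x ([], s)).1.length
    · simp [hj, growTree, nodeType]
    · simp [hj]
  rw [numOffspring, h, Set.ncard_coe_finset, Finset.card_range]

/-- Seen from an offspring of the root, the tree is again grown from a root type and shifted node
data, so the two recursions agree generation by generation. -/
lemma treeRank_growTree (w : ℕ → VType) (k : ℕ) (s : Fin n)
    (x : List ℕ × Fin n → List (Fin n) × ℕ) :
    treeRank w (growTree (s, x)) k [] =
      branchRank (fun _ e => e.1) (fun j e => (w j).wt / e.2) (fun j _ => (w j).pers) k s x := by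
  induction k generalizing s x with
  | zero => rfl
  | succ k ih =>
    rw [treeRank, numOffspring_growTree, branchRank, add_comm, Finset.sum_range]
    congr 1
    refine Finset.sum_congr rfl fun i _ => ?_
    have hT : ∀ v, growTree (s, x) (v ++ [(i : ℕ)]) =
        growTree ((x ([], s)).1[i], subtree i x) v := fun v => by
      rw [growTree_append]; simp
    congr 1
    · have := hT []
      rw [List.nil_append] at this
      rw [nodeWeight, this]
      rfl
    · have := treeRank_append w (growTree (s, x)) k [] [(i : ℕ)]
      rw [List.nil_append] at this
      rw [this, ← ih]
      exact congrArg (fun T => treeRank w T k []) (funext hT)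

lemma measurableSet_nodeType (s : Fin n) (u : List ℕ) (t : Fin n) :
    MeasurableSet {x : List ℕ × Fin n → List (Fin n) × ℕ |
      nodeType s (fun p => (x p).1) u = some t} := by
  induction u generalizing t with
  | nil => exact MeasurableSet.const (some s = some t)
  | cons j u ih =>
    have : {x : List ℕ × Fin n → List (Fin n) × ℕ |
        nodeType s (fun p => (x p).1) (j :: u) = some t} =
        ⋃ s' : Fin n, {x | nodeType s (fun p => (x p).1) u = some s'} ∩
          (fun x : List ℕ × Fin n → List (Fin n) × ℕ => x (u, s')) ⁻¹' {e | e.1[j]? = some t} := by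
      ext x
      simp [nodeType, Option.bind_eq_some_iff]
    rw [this]
    exact MeasurableSet.iUnion fun s' => (ih s').inter (measurable_pi_apply _ .of_discrete)

/-- The value at a node lies in a countable discrete space, so preimages of points suffice. That a
node has a given type is a finite union over the possible types of its parent. -/
lemma measurable_growTree :
    Measurable (growTree : Fin n × (List ℕ × Fin n → List (Fin n) × ℕ) → MarkedTree n) := by
  refine measurable_from_prod_countable_right fun s => ?_
  refine measurable_pi_lambda _ fun u => measurable_to_countable' fun o => ?_
  have hsome : ∀ p : Fin n × ℕ, MeasurableSet
      ((fun x : List ℕ × Fin n → List (Fin n) × ℕ => growTree (s, x) u) ⁻¹' {some p}) := by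
    rintro ⟨t, d⟩
    have : ((fun x : List ℕ × Fin n → List (Fin n) × ℕ => growTree (s, x) u) ⁻¹' {some (t, d)}) =
        {x | nodeType s (fun p => (x p).1) u = some t} ∩
          (fun x : List ℕ × Fin n → List (Fin n) × ℕ => x (u, t)) ⁻¹' {e | e.2 = d} := by
      ext x
      simp only [growTree, Set.mem_preimage, Set.mem_singleton_iff, Option.map_eq_some_iff,
        Prod.mk.injEq, Set.mem_inter_iff, Set.mem_ofPred_eq]
      constructor
      · rintro ⟨a, h1, rfl, h2⟩; exact ⟨h1, h2⟩
      · rintro ⟨h1, h2⟩; exact ⟨t, h1, rfl, h2⟩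
    rw [this]
    exact (measurableSet_nodeType s u t).inter (measurable_pi_apply _ .of_discrete)
  cases o with
  | some p => exact hsome p
  | none =>
    have : ((fun x : List ℕ × Fin n → List (Fin n) × ℕ => growTree (s, x) u) ⁻¹' {none}) =
        (⋃ p : Fin n × ℕ,
          ((fun x : List ℕ × Fin n → List (Fin n) × ℕ => growTree (s, x) u) ⁻¹' {some p}))ᶜ := by
      ext x
      simp only [Set.mem_preimage, Set.mem_singleton_iff, Set.mem_compl_iff, Set.mem_iUnion,
        not_exists]
      exact Option.eq_none_iff_forall_ne_some
    rw [this]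
    exact (MeasurableSet.iUnion hsome).compl

lemma measurable_numOffspring (u : List ℕ) :
    Measurable (fun T : MarkedTree n => numOffspring T u) := by
  have h : Measurable fun T : MarkedTree n => {j : ℕ | T (j :: u) ≠ none} :=
    measurable_set_iff.2 fun j =>
      (Measurable.of_discrete (f := fun o : Option (Fin n × ℕ) => o ≠ none)).comp
        (measurable_pi_apply (j :: u))
  exact measurable_ncard.comp h

lemma measurable_treeRank (k : ℕ) (u : List ℕ) :
    Measurable (fun p : (ℕ → VType) × MarkedTree n => treeRank p.1 p.2 k u) := by
  have hnode : ∀ (f : (ℕ → VType) → Option (Fin n × ℕ) → ℝ), (∀ o, Measurable fun w => f w o) →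
      ∀ u, Measurable (fun p : (ℕ → VType) × MarkedTree n => f p.1 (p.2 u)) := by
    intro f hf u
    have : Measurable fun p : (ℕ → VType) × Option (Fin n × ℕ) => f p.1 p.2 :=
      measurable_from_prod_countable_left hf
    exact this.comp (measurable_fst.prodMk ((measurable_pi_apply u).comp measurable_snd))
  have hw : ∀ u, Measurable (fun p : (ℕ → VType) × MarkedTree n => nodeWeight p.1 p.2 u) := by
    refine hnode (fun w o => match o with | none => 0 | some (s, d) => (w s).wt / d) fun o => ?_
    rcases o with _ | ⟨s, d⟩
    · exact measurable_const
    · simp only [VType.wt]; fun_prop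
  have hp : ∀ u, Measurable (fun p : (ℕ → VType) × MarkedTree n => nodePers p.1 p.2 u) := by
    refine hnode (fun w o => match o with | none => 0 | some (s, _) => (w s).pers) fun o => ?_
    rcases o with _ | ⟨s, d⟩
    · exact measurable_const
    · simp only [VType.pers]; fun_prop
  induction k generalizing u with
  | zero => exact measurable_const
  | succ k ih =>
    simp only [treeRank]
    refine Measurable.add ?_ (hp u)
    -- The number of summands is random; as a separate countable coordinate it can be frozen.
    have h : Measurable fun q : ℕ × ((ℕ → VType) × MarkedTree n) =>
        ∑ j ∈ Finset.range q.1, nodeWeight q.2.1 q.2.2 (j :: u) * treeRank q.2.1 q.2.2 k (j :: u) :=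
      measurable_from_prod_countable_right fun m =>
        Finset.measurable_fun_sum (Finset.range m) fun j _ => (hw (j :: u)).fun_mul (ih (j :: u))
    exact h.comp (((measurable_numOffspring u).comp measurable_snd).prodMk measurable_id)

/-- The law of the offspring and of the mark of a node of type `s`. -/
abbrev treeNodeLaw (θ : ℝ) (n : ℕ) (w : ℕ → VType) (s : Fin n) : Measure (List (Fin n) × ℕ) :=
  (offspringLaw θ n w s).prod (markLaw θ n w s)

/-- The law of the type of the root and of the data of all potential nodes. -/
abbrev rootedLaw (θ : ℝ) (n : ℕ) (w : ℕ → VType) :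
    Measure (Fin n × (List ℕ × Fin n → List (Fin n) × ℕ)) :=
  (uniformOn (Set.univ : Set (Fin n))).prod (nodeLaw (treeNodeLaw θ n w))

/-- The rank of the root of the Poisson branching tree, after applying `a` to all weights and
personalization values. -/
def rootRank (a : ℝ → ℝ) (w : ℕ → VType) (k : ℕ)
    (p : Fin n × (List ℕ × Fin n → List (Fin n) × ℕ)) : ℝ :=
  branchRank (fun _ e => e.1) (fun j e => a ((w j).wt / e.2)) (fun j _ => a (w j).pers) k p.1 p.2

lemma treeRank_growTree_eq_rootRank (w : ℕ → VType) (k : ℕ)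
    (p : Fin n × (List ℕ × Fin n → List (Fin n) × ℕ)) :
    treeRank w (growTree p) k [] = rootRank id w k p := treeRank_growTree w k p.1 p.2

lemma measurable_rootRank {a : ℝ → ℝ} (ha : Measurable a) (w : ℕ → VType) (k : ℕ) :
    Measurable (rootRank (n := n) a w k) := by
  refine measurable_from_prod_countable_right fun s => ?_
  exact measurable_branchRank (fun _ => measurable_fst) (fun j => ha.comp (by fun_prop))
    (fun j => measurable_const) k s

lemma isProbabilityMeasure_uniformOn_univ_fin (hn : 1 ≤ n) :
    IsProbabilityMeasure (uniformOn (Set.univ : Set (Fin n))) :=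
  isProbabilityMeasure_uniformOn Set.finite_univ ⟨⟨0, hn⟩, trivial⟩

lemma isProbabilityMeasure_rootedLaw (θ : ℝ) (w : ℕ → VType) (hn : 1 ≤ n) :
    IsProbabilityMeasure (rootedLaw θ n w) := by
  have := isProbabilityMeasure_uniformOn_univ_fin hn
  infer_instance

lemma pbtLaw_eq_map_rootedLaw (θ : ℝ) (w : ℕ → VType) :
    pbtLaw θ n w = (rootedLaw θ n w).map growTree := rfl

lemma isProbabilityMeasure_pbtLaw (θ : ℝ) (w : ℕ → VType) (hn : 1 ≤ n) :
    IsProbabilityMeasure (pbtLaw θ n w) := by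
  have := isProbabilityMeasure_rootedLaw θ w hn
  exact Measure.isProbabilityMeasure_map measurable_growTree.aemeasurable

lemma lintegral_uniformOn_univ_fin (f : Fin n → ℝ≥0∞) :
    ∫⁻ s, f s ∂(uniformOn (Set.univ : Set (Fin n))) = (n : ℝ≥0∞)⁻¹ * ∑ s, f s := by
  rw [uniformOn, ProbabilityTheory.cond, Measure.restrict_univ, lintegral_smul_measure,
      lintegral_count,
    tsum_fintype]
  simp

lemma integral_uniformOn_univ_fin (f : Fin n → ℂ) :
    ∫ s, f s ∂(uniformOn (Set.univ : Set (Fin n))) = (n : ℝ)⁻¹ • ∑ s, f s := by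
  rw [uniformOn, ProbabilityTheory.cond, Measure.restrict_univ, integral_smul_measure,
      integral_count]
  simp

lemma map_treeRank_pbtLaw (θ : ℝ) (w w' : ℕ → VType) (k : ℕ) :
    (pbtLaw θ n w).map (fun T => treeRank w' T k []) =
      (rootedLaw θ n w).map (rootRank id w' k) := by
  have hm : Measurable fun T : MarkedTree n => treeRank w' T k [] :=
    (measurable_treeRank k []).comp measurable_prodMk_left
  rw [pbtLaw_eq_map_rootedLaw, Measure.map_map hm measurable_growTree]
  exact congrArg₂ _ (funext fun p => treeRank_growTree_eq_rootRank w' k p) rfl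

lemma lintegral_rootedLaw (θ : ℝ) (w : ℕ → VType) (hn : 1 ≤ n)
    {g : Fin n × (List ℕ × Fin n → List (Fin n) × ℕ) → ℝ≥0∞} (hg : Measurable g) :
    ∫⁻ p, g p ∂(rootedLaw θ n w) =
      (n : ℝ≥0∞)⁻¹ * ∑ s, ∫⁻ x, g (s, x) ∂(nodeLaw (treeNodeLaw θ n w)) := by
  have := isProbabilityMeasure_uniformOn_univ_fin hn
  rw [lintegral_prod _ hg.aemeasurable, ← lintegral_uniformOn_univ_fin]

lemma integral_rootedLaw (θ : ℝ) (w : ℕ → VType) (hn : 1 ≤ n)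
    {g : Fin n × (List ℕ × Fin n → List (Fin n) × ℕ) → ℂ} (hg : Integrable g (rootedLaw θ n w)) :
    ∫ p, g p ∂(rootedLaw θ n w) =
      (n : ℝ)⁻¹ • ∑ s, ∫ x, g (s, x) ∂(nodeLaw (treeNodeLaw θ n w)) := by
  have := isProbabilityMeasure_uniformOn_univ_fin hn
  rw [integral_prod _ hg, ← integral_uniformOn_univ_fin]

end Tree

/-! ### Recursions for the Poisson branching tree given the types -/

section NodeFactor

lemma VType.wIn_nonneg (x : VType) : 0 ≤ x.wIn := x.1.2

lemma VType.wOut_nonneg (x : VType) : 0 ≤ x.wOut := x.2.1.2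

/-- The contribution of a node of type `x` with weight argument `τ` to a characteristic function,
when `B` is the log-characteristic function of the ranks brought by its offspring. -/
def nodeFactor (a : ℝ → ℝ) (B : ℝ → ℂ) (x : VType) (τ : ℝ) : ℂ :=
  cis (τ * a x.pers) * Complex.exp (x.wIn * B τ)

/-- The average of `f m` over a Poisson variable `m` with mean `W⁻ ℓ`. -/
def markIntegral (f : ℕ → ℂ) (x : VType) (l : ℝ) : ℂ :=
  ∫ m, f m ∂(poissonMeasure (Real.toNNReal (x.wOut * l)))

/-- The characteristic function of the weighted rank of an offspring of type `x`. -/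
def markAvg (a : ℝ → ℝ) (B : ℝ → ℂ) (x : VType) (l t : ℝ) : ℂ :=
  markIntegral (fun m => nodeFactor a B x (t * a (x.wt / ((m : ℝ) + 1)))) x l

/-- The mean of `1 / (Z + 1)` for `Z` Poisson with mean `W⁻ ℓ`. -/
def invMarkMean (x : VType) (l : ℝ) : ℝ :=
  ∫ m : ℕ, 1 / ((m : ℝ) + 1) ∂(poissonMeasure (Real.toNNReal (x.wOut * l)))

lemma norm_nodeFactor_le {a : ℝ → ℝ} {B : ℝ → ℂ} {x : VType} {τ : ℝ} (h : (B τ).re ≤ 0) :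
    ‖nodeFactor a B x τ‖ ≤ 1 := by
  rw [nodeFactor, norm_mul, norm_cis, one_mul, Complex.norm_exp, Real.exp_le_one_iff]
  rw [Complex.re_ofReal_mul]
  exact mul_nonpos_of_nonneg_of_nonpos x.wIn_nonneg h

/-- On the convex left half-plane the derivative of the exponential has norm at most one. Keeping
real parts of log-characteristic functions nonpositive therefore makes the recursion Lipschitz. -/
lemma norm_exp_sub_exp_le {z w : ℂ} (hz : z.re ≤ 0) (hw : w.re ≤ 0) :
    ‖Complex.exp z - Complex.exp w‖ ≤ ‖z - w‖ := by
  have hconv : Convex ℝ {z : ℂ | z.re ≤ 0} := convex_halfSpace_re_le 0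
  have := hconv.norm_image_sub_le_of_norm_hasDerivWithin_le (f := Complex.exp) (f' := Complex.exp)
    (C := 1) (fun x _ => (Complex.hasDerivAt_exp x).hasDerivWithinAt)
    (fun x hx => by rw [Complex.norm_exp, Real.exp_le_one_iff]; exact hx) hw hz
  simpa using this

lemma norm_nodeFactor_sub_le {a : ℝ → ℝ} {B B' : ℝ → ℂ} {x : VType} {τ : ℝ} (h : (B τ).re ≤ 0)
    (h' : (B' τ).re ≤ 0) :
    ‖nodeFactor a B x τ - nodeFactor a B' x τ‖ ≤ x.wIn * ‖B τ - B' τ‖ := by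
  have hre : ∀ z : ℂ, z.re ≤ 0 → ((x.wIn : ℂ) * z).re ≤ 0 := fun z hz => by
    rw [Complex.re_ofReal_mul]
    exact mul_nonpos_of_nonneg_of_nonpos x.wIn_nonneg hz
  rw [nodeFactor, nodeFactor, ← mul_sub, norm_mul, norm_cis, one_mul]
  refine (norm_exp_sub_exp_le (hre _ h) (hre _ h')).trans_eq ?_
  rw [← mul_sub, norm_mul, Complex.norm_real, Real.norm_of_nonneg x.wIn_nonneg]

lemma norm_markIntegral_le {f : ℕ → ℂ} {C : ℝ} (h : ∀ m, ‖f m‖ ≤ C) (x : VType) (l : ℝ) :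
    ‖markIntegral f x l‖ ≤ C := by
  simpa [markIntegral] using norm_integral_le_of_norm_le_const
      (μ := poissonMeasure (Real.toNNReal (x.wOut * l)))
    (ae_of_all _ h)

lemma norm_markAvg_le {a : ℝ → ℝ} {B : ℝ → ℂ} (h : ∀ τ, (B τ).re ≤ 0) (x : VType) (l t : ℝ) :
    ‖markAvg a B x l t‖ ≤ 1 := norm_markIntegral_le (fun _ => norm_nodeFactor_le (h _)) x l

lemma integrable_poissonMeasure_of_bound {f : ℕ → ℂ} {C : ℝ} (h : ∀ m, ‖f m‖ ≤ C) (r : ℝ≥0) :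
    Integrable f (poissonMeasure r) :=
  Integrable.of_bound Measurable.of_discrete.aestronglyMeasurable C (ae_of_all _ h)

lemma norm_markAvg_sub_le {a : ℝ → ℝ} {B B' : ℝ → ℂ} (h : ∀ τ, (B τ).re ≤ 0)
    (h' : ∀ τ, (B' τ).re ≤ 0) {x : VType} {l t ε : ℝ}
    (hε : ∀ m : ℕ, ‖B (t * a (x.wt / ((m : ℝ) + 1))) - B' (t * a (x.wt / ((m : ℝ) + 1)))‖ ≤ ε) :
    ‖markAvg a B x l t - markAvg a B' x l t‖ ≤ x.wIn * ε := by
  rw [markAvg, markAvg, markIntegral, markIntegral, ← integral_sub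
    (integrable_poissonMeasure_of_bound (fun _ => norm_nodeFactor_le (h _)) _)
    (integrable_poissonMeasure_of_bound (fun _ => norm_nodeFactor_le (h' _)) _)]
  refine norm_markIntegral_le (fun m => ?_) x l
  exact (norm_nodeFactor_sub_le (h _) (h' _)).trans
    (mul_le_mul_of_nonneg_left (hε m) x.wIn_nonneg)

lemma inv_succ_le_one (m : ℕ) : 1 / ((m : ℝ) + 1) ≤ 1 := by
  rw [div_le_one (by positivity)]; linarith [(Nat.cast_nonneg m : (0 : ℝ) ≤ m)]

lemma integrable_inv_succ_poissonMeasure (r : ℝ≥0) :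
    Integrable (fun m : ℕ => 1 / ((m : ℝ) + 1)) (poissonMeasure r) :=
  Integrable.of_bound Measurable.of_discrete.aestronglyMeasurable 1 (ae_of_all _ fun m => by
    rw [Real.norm_of_nonneg (by positivity)]; exact inv_succ_le_one m)

lemma ofReal_invMarkMean (x : VType) (l : ℝ) :
    ENNReal.ofReal (invMarkMean x l) = ∫⁻ m : ℕ, ENNReal.ofReal (1 / ((m : ℝ) + 1))
      ∂(poissonMeasure (Real.toNNReal (x.wOut * l))) :=
  ofReal_integral_eq_lintegral_ofReal (integrable_inv_succ_poissonMeasure _)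
    (ae_of_all _ fun m => by positivity)

lemma invMarkMean_nonneg (x : VType) (l : ℝ) : 0 ≤ invMarkMean x l :=
  integral_nonneg fun m => by positivity

lemma invMarkMean_le_one (x : VType) (l : ℝ) : invMarkMean x l ≤ 1 := by
  have := integral_mono (μ := poissonMeasure (Real.toNNReal (x.wOut * l)))
    (integrable_inv_succ_poissonMeasure _) (integrable_const 1) inv_succ_le_one
  simpa [invMarkMean] using this

/-- The prefactor `W⁻ ℓ` is exactly the mean of the Poisson variable. Both contraction bounds, for
the finite tree and for the limit, rest on this. -/
lemma mul_invMarkMean_le (x : VType) {l : ℝ} (hl : 0 ≤ l) : x.wOut * l * invMarkMean x l ≤ 1 := by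
  have h := mul_lintegral_inv_succ_poissonMeasure_le (Real.toNNReal (x.wOut * l))
  rw [← ofReal_invMarkMean] at h
  have h0 : 0 ≤ x.wOut * l := mul_nonneg x.wOut_nonneg hl
  change ENNReal.ofReal _ * _ ≤ _ at h
  rwa [← ENNReal.ofReal_mul h0, ENNReal.ofReal_le_one] at h

end NodeFactor

/-! ### Characteristic functions and absolute means on the finite tree -/

section TreeRecursion

variable {n : ℕ}

/-- `L_n⁺ / (θ n)`. -/
def inRate (θ : ℝ) (n : ℕ) (w : ℕ → VType) : ℝ := (∑ i : Fin n, (w i).wIn) / (θ * n)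

lemma inRate_nonneg {θ : ℝ} (hθ : 0 < θ) (n : ℕ) (w : ℕ → VType) : 0 ≤ inRate θ n w :=
  div_nonneg (Finset.sum_nonneg fun i _ => (w i).wIn_nonneg) (by positivity)

/-- The characteristic function of the weighted rank of an offspring of type `j`. -/
def childChar (a : ℝ → ℝ) (θ : ℝ) (w : ℕ → VType) (k : ℕ) (j : Fin n) (t : ℝ) : ℂ :=
  ∫ x, cis (t * (a ((w j).wt / (x ([], j)).2) *
    branchRank (fun _ e => e.1) (fun j e => a ((w j).wt / e.2)) (fun j _ => a (w j).pers) k j x))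
    ∂(nodeLaw (treeNodeLaw θ n w))

/-- The log-characteristic function of the total weighted rank brought by the offspring of a node,
per unit of `W⁺`. -/
def treeLogChar (a : ℝ → ℝ) (θ : ℝ) (n : ℕ) (w : ℕ → VType) (k : ℕ) (t : ℝ) : ℂ :=
  ((θ * n : ℝ) : ℂ)⁻¹ * ∑ j : Fin n, ((w j).wOut : ℂ) * (childChar a θ w k j t - 1)

lemma norm_childChar_le (a : ℝ → ℝ) (θ : ℝ) (w : ℕ → VType) (k : ℕ) (j : Fin n) (t : ℝ) :
    ‖childChar a θ w k j t‖ ≤ 1 := by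
  simpa [childChar] using norm_integral_le_of_norm_le_const (μ := nodeLaw (treeNodeLaw θ n w))
    (f := fun x => cis (t * (a ((w j).wt / (x ([], j)).2) * branchRank (fun _ e => e.1)
      (fun j e => a ((w j).wt / e.2)) (fun j _ => a (w j).pers) k j x))) (C := 1)
    (ae_of_all _ fun x => (norm_cis _).le)

lemma re_treeLogChar_nonpos (a : ℝ → ℝ) {θ : ℝ} (hθ : 0 < θ) (w : ℕ → VType) (k : ℕ) (t : ℝ) :
    (treeLogChar a θ n w k t).re ≤ 0 := by
  rw [treeLogChar, ← Complex.ofReal_inv, Complex.re_ofReal_mul, Complex.re_sum]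
  refine mul_nonpos_of_nonneg_of_nonpos (by positivity) (Finset.sum_nonpos fun j _ => ?_)
  rw [Complex.re_ofReal_mul]
  refine mul_nonpos_of_nonneg_of_nonpos (w j).wOut_nonneg ?_
  have := (Complex.re_le_norm _).trans (norm_childChar_le a θ w k j t)
  simpa using this

lemma treeLogChar_zero (a : ℝ → ℝ) (θ : ℝ) (w : ℕ → VType) (t : ℝ) :
    treeLogChar a θ n w 0 t = 0 := by
  simp [treeLogChar, childChar, branchRank, cis_zero]

lemma integral_markLaw (θ : ℝ) (w : ℕ → VType) (s : Fin n) (f : ℕ → ℂ) :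
    ∫ m, f m ∂(markLaw θ n w s) =
      markIntegral (fun m => f (m + 1)) (w s) (inRate θ n w) := by
  rw [markLaw, integral_map Measurable.of_discrete.aemeasurable
    Measurable.of_discrete.aestronglyMeasurable, markIntegral, inRate, mul_div_assoc]

/-- The kernel of offspring means has rank one, so the parent's type enters only through the factor
`W_s⁺`. This reduces an `n`-dimensional recursion to one for a single function. -/
lemma sum_offspringRate_mul {θ : ℝ} (hθ : 0 < θ) (w : ℕ → VType) (s : Fin n) (f : Fin n → ℂ) :
    ∑ j, (offspringRate θ n w j s : ℂ) * f j =
      (w s).wIn * (((θ * n : ℝ) : ℂ)⁻¹ * ∑ j : Fin n, ((w j).wOut : ℂ) * f j) := by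
  rw [Finset.mul_sum, Finset.mul_sum]
  refine Finset.sum_congr rfl fun j _ => ?_
  have h : ((offspringRate θ n w j s : ℝ≥0) : ℝ) = (w s).wIn * (w j).wOut / (θ * n) :=
    Real.coe_toNNReal _ (div_nonneg (mul_nonneg (w s).wIn_nonneg (w j).wOut_nonneg) (by positivity))
  rw [h]
  push_cast
  ring

/-- Given the type, offspring and mark are independent, so the offspring are integrated out with the
mark, hence the frequency, held fixed. The argument `m + 1` reflects that the mark is one plus a
Poisson variable. -/
lemma integral_cis_rank_succ {a : ℝ → ℝ} (ha : Measurable a) {θ : ℝ} (hθ : 0 < θ) (w : ℕ → VType)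
    (k : ℕ) (s : Fin n) (τ : ℕ → ℝ) :
    ∫ x, cis (τ (x ([], s)).2 * branchRank (fun _ e => e.1) (fun j e => a ((w j).wt / e.2))
        (fun j _ => a (w j).pers) (k + 1) s x) ∂(nodeLaw (treeNodeLaw θ n w)) =
      markIntegral (fun m => nodeFactor a (treeLogChar a θ n w k) (w s) (τ (m + 1))) (w s)
        (inRate θ n w) := by
  have hτ : Measurable fun e : List (Fin n) × ℕ => τ e.2 := Measurable.of_discrete
  have h := integral_cis_branchRank_succ (treeNodeLaw θ n w) (ch := fun _ e => e.1)
    (wt := fun j e => a ((w j).wt / e.2)) (pers := fun j _ => a (w j).pers)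
    (fun _ => measurable_fst) (fun j => ha.comp (by fun_prop)) (fun j => measurable_const) hτ k s
  rw [h, integral_prod_symm, ← integral_markLaw (f := fun m =>
    nodeFactor a (treeLogChar a θ n w k) (w s) (τ m))]
  · refine integral_congr_ae (ae_of_all _ fun m => ?_)
    simp only
    rw [integral_const_mul, nodeFactor]
    congr 1
    have := integral_prod_offspringLaw θ w s (fun j => childChar a θ w k j (τ m))
    rw [sum_offspringRate_mul hθ] at this
    exact this
  · refine Integrable.of_bound Measurable.of_discrete.aestronglyMeasurable 1
      (ae_of_all _ fun e => ?_)
    rw [norm_mul, norm_cis, one_mul]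
    have : ∀ l : List (Fin n), ‖(l.map fun j => childChar a θ w k j (τ e.2)).prod‖ ≤ 1 := by
      intro l
      induction l with
      | nil => simp
      | cons j l ih =>
        rw [List.map_cons, List.prod_cons, norm_mul]
        exact mul_le_one₀ (norm_childChar_le a θ w k j _) (norm_nonneg _) ih
    exact this e.1

lemma childChar_succ {a : ℝ → ℝ} (ha : Measurable a) {θ : ℝ} (hθ : 0 < θ) (w : ℕ → VType)
    (k : ℕ) (j : Fin n) (t : ℝ) :
    childChar a θ w (k + 1) j t =
      markAvg a (treeLogChar a θ n w k) (w j) (inRate θ n w) t := by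
  have := integral_cis_rank_succ ha hθ w k j (fun m => t * a ((w j).wt / m))
  simp only [mul_assoc] at this
  rw [childChar, this, markAvg]
  simp

/-- The average of `f` over the first `n` types. -/
def empMean {E : Type*} [AddCommMonoid E] [Module ℝ E] (n : ℕ) (w : ℕ → VType)
    (f : VType → E) : E :=
  (n : ℝ)⁻¹ • ∑ i ∈ Finset.range n, f (w i)

lemma treeLogChar_succ {a : ℝ → ℝ} (ha : Measurable a) {θ : ℝ} (hθ : 0 < θ) (w : ℕ → VType)
    (k : ℕ) (t : ℝ) :
    treeLogChar a θ n w (k + 1) t = (θ : ℂ)⁻¹ * empMean n w (fun x =>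
      (x.wOut : ℂ) * (markAvg a (treeLogChar a θ n w k) x (inRate θ n w) t - 1)) := by
  rw [treeLogChar, empMean, Finset.sum_range]
  simp only [childChar_succ ha hθ]
  rw [Complex.real_smul, ← mul_assoc]
  push_cast
  rw [mul_inv]

lemma integral_cis_rootRank_succ {a : ℝ → ℝ} (ha : Measurable a) {θ : ℝ} (hθ : 0 < θ)
    (hn : 1 ≤ n) (w : ℕ → VType) (k : ℕ) (t : ℝ) :
    ∫ p, cis (t * rootRank a w (k + 1) p) ∂(rootedLaw θ n w) =
      empMean n w (fun x => nodeFactor a (treeLogChar a θ n w k) x t) := by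
  have := isProbabilityMeasure_rootedLaw θ w hn
  have hm := measurable_rootRank (n := n) ha w (k + 1)
  rw [integral_rootedLaw θ w hn, empMean, Finset.sum_range]
  · congr 1
    refine Finset.sum_congr rfl fun s _ => ?_
    have := integral_cis_rank_succ ha hθ w k s (fun _ => t)
    rw [markIntegral] at this
    simpa [rootRank] using this
  · exact Integrable.of_bound (Measurable.aestronglyMeasurable (by fun_prop)) 1
      (ae_of_all _ fun p => (norm_cis _).le)

/-- The mean of the absolute weighted rank of an offspring of type `j`. -/
def childMean (θ : ℝ) (n : ℕ) (w : ℕ → VType) : ℕ → ℕ → ℝ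
  | 0, _ => 0
  | k + 1, j => |(w j).wt| * invMarkMean (w j) (inRate θ n w) * (|(w j).pers| +
      (w j).wIn * ((θ * n)⁻¹ * ∑ i : Fin n, (w i).wOut * childMean θ n w k i))

lemma childMean_nonneg {θ : ℝ} (hθ : 0 < θ) (w : ℕ → VType) (k j : ℕ) :
    0 ≤ childMean θ n w k j := by
  induction k generalizing j with
  | zero => exact le_rfl
  | succ k ih =>
    refine mul_nonneg (mul_nonneg (abs_nonneg _) (invMarkMean_nonneg _ _)) (add_nonneg
      (abs_nonneg _) (mul_nonneg (w j).wIn_nonneg (mul_nonneg (by positivity)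
        (Finset.sum_nonneg fun i _ => mul_nonneg (w i).wOut_nonneg (ih i)))))

lemma sum_offspringRate_mul_ofReal {θ : ℝ} (hθ : 0 < θ) (w : ℕ → VType) (s : Fin n)
    (f : Fin n → ℝ) (hf : ∀ j, 0 ≤ f j) :
    ∑ j, (offspringRate θ n w j s : ℝ≥0∞) * ENNReal.ofReal (f j) =
      ENNReal.ofReal ((w s).wIn * ((θ * n)⁻¹ * ∑ j : Fin n, (w j).wOut * f j)) := by
  rw [Finset.mul_sum, Finset.mul_sum, ENNReal.ofReal_sum_of_nonneg]
  · refine Finset.sum_congr rfl fun j _ => ?_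
    change ENNReal.ofReal _ * _ = _
    rw [← ENNReal.ofReal_mul (div_nonneg (mul_nonneg (w s).wIn_nonneg (w j).wOut_nonneg)
      (by positivity))]
    congr 1
    ring
  · exact fun j _ => mul_nonneg (w s).wIn_nonneg (mul_nonneg (by positivity)
      (mul_nonneg (w j).wOut_nonneg (hf j)))

lemma lintegral_mark_mul (θ : ℝ) (w : ℕ → VType) (s : Fin n) (g : ℕ → ℝ≥0∞)
    (b : ℝ≥0∞) (f : Fin n → ℝ≥0∞) :
    ∫⁻ e, g e.2 * (b + (e.1.map f).sum) ∂(treeNodeLaw θ n w s) =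
      (∫⁻ m, g m ∂(markLaw θ n w s)) * (b + ∑ j, (offspringRate θ n w j s : ℝ≥0∞) * f j) := by
  rw [lintegral_prod_symm _ Measurable.of_discrete.aemeasurable]
  have h : ∀ m, ∫⁻ l, g m * (b + (l.map f).sum) ∂(offspringLaw θ n w s) =
      g m * (b + ∑ j, (offspringRate θ n w j s : ℝ≥0∞) * f j) := fun m => by
    rw [lintegral_const_mul _ Measurable.of_discrete, lintegral_add_left measurable_const,
      lintegral_sum_offspringLaw]
    simp
  simp only [h]
  rw [lintegral_mul_const _ Measurable.of_discrete]

/-- The weight of a node uses only its mark, which is independent of its offspring, so its absolute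
mean factors out at each generation. -/
lemma lintegral_abs_wt_mul_rank {θ : ℝ} (hθ : 0 < θ) (w : ℕ → VType) (k : ℕ) (j : Fin n) :
    ∫⁻ x, ENNReal.ofReal |(w j).wt / (x ([], j)).2| * ENNReal.ofReal
        (branchRank (fun _ e => e.1) (fun j e => |(w j).wt / e.2|) (fun j _ => |(w j).pers|) k j x)
        ∂(nodeLaw (treeNodeLaw θ n w)) = ENNReal.ofReal (childMean θ n w k j) := by
  induction k generalizing j with
  | zero => simp [branchRank, childMean]
  | succ k ih =>
    have hg : Measurable fun e : List (Fin n) × ℕ => ENNReal.ofReal |(w j).wt / e.2| :=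
      Measurable.of_discrete
    have h := lintegral_branchRank_succ (treeNodeLaw θ n w) (ch := fun _ e => e.1)
      (wt := fun j e => (w j).wt / e.2) (pers := fun j _ => (w j).pers)
      (fun _ => measurable_fst) (fun j => by fun_prop) (fun j => measurable_const) hg k j
    rw [h]
    simp only [ih]
    rw [lintegral_mark_mul θ w j (fun m => ENNReal.ofReal |(w j).wt / m|),
      sum_offspringRate_mul_ofReal hθ w j _ fun i => childMean_nonneg hθ w k i, markLaw,
      lintegral_map Measurable.of_discrete Measurable.of_discrete, childMean,
      ENNReal.ofReal_mul (mul_nonneg (abs_nonneg _) (invMarkMean_nonneg _ _)),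
      ENNReal.ofReal_add (abs_nonneg _) (mul_nonneg (w j).wIn_nonneg (mul_nonneg (by positivity)
        (Finset.sum_nonneg fun (i : Fin n) _ =>
          mul_nonneg (w i).wOut_nonneg (childMean_nonneg hθ w k i)))),
      ENNReal.ofReal_mul (abs_nonneg _), ofReal_invMarkMean,
      ← lintegral_const_mul _ Measurable.of_discrete, inRate, mul_div_assoc]
    congr 1
    refine lintegral_congr fun m => ?_
    rw [← ENNReal.ofReal_mul (abs_nonneg _), abs_div]
    congr 1
    push_cast
    rw [abs_of_nonneg (by positivity : (0 : ℝ) ≤ (m : ℝ) + 1)]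
    ring

/-- The mean of the total absolute weighted rank brought by the offspring of a node, per unit of
`W⁺`. -/
def treeMean (θ : ℝ) (n : ℕ) (w : ℕ → VType) (k : ℕ) : ℝ :=
  (θ * n)⁻¹ * ∑ i : Fin n, (w i).wOut * childMean θ n w k i

lemma treeMean_nonneg {θ : ℝ} (hθ : 0 < θ) (w : ℕ → VType) (k : ℕ) : 0 ≤ treeMean θ n w k :=
  mul_nonneg (by positivity)
    (Finset.sum_nonneg fun i _ => mul_nonneg (w i).wOut_nonneg (childMean_nonneg hθ w k i))

lemma lintegral_rootRank_abs_succ {θ : ℝ} (hθ : 0 < θ) (hn : 1 ≤ n) (w : ℕ → VType) (k : ℕ) :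
    ∫⁻ p, ENNReal.ofReal (rootRank abs w (k + 1) p) ∂(rootedLaw θ n w) =
      ENNReal.ofReal (empMean n w (fun x => |x.pers|) +
        empMean n w VType.wIn * treeMean θ n w k) := by
  have hm := measurable_rootRank (n := n) measurable_abs w (k + 1)
  have hT := treeMean_nonneg (n := n) hθ w k
  have key : ∀ s : Fin n, ∫⁻ x, ENNReal.ofReal (rootRank abs w (k + 1) (s, x))
      ∂(nodeLaw (treeNodeLaw θ n w)) =
      ENNReal.ofReal (|(w s).pers| + (w s).wIn * treeMean θ n w k) := by
    intro s
    have h := lintegral_branchRank_succ (treeNodeLaw θ n w) (ch := fun _ e => e.1)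
      (wt := fun j e => (w j).wt / e.2) (pers := fun j _ => (w j).pers)
      (fun _ => measurable_fst) (fun j => by fun_prop) (fun j => measurable_const)
      (g := fun _ => 1) measurable_const k s
    simp only [one_mul, lintegral_abs_wt_mul_rank hθ w k] at h
    have h2 := lintegral_mark_mul θ w s (fun _ => 1) (ENNReal.ofReal |(w s).pers|)
      (fun j => ENNReal.ofReal (childMean θ n w k j))
    simp only [one_mul, lintegral_const, measure_univ] at h2
    rw [sum_offspringRate_mul_ofReal hθ w s _ fun i => childMean_nonneg hθ w k i] at h2
    rw [ENNReal.ofReal_add (abs_nonneg _) (mul_nonneg (w s).wIn_nonneg hT), treeMean, ← h2]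
    exact h
  have hn0 : (0 : ℝ) < n := by exact_mod_cast hn
  rw [lintegral_rootedLaw θ w hn hm.ennreal_ofReal]
  simp only [key]
  rw [← ENNReal.ofReal_sum_of_nonneg fun (s : Fin n) _ => add_nonneg (abs_nonneg _)
    (mul_nonneg (w s).wIn_nonneg hT), Finset.sum_add_distrib, ← Finset.sum_mul,
    ← ENNReal.ofReal_natCast, ← ENNReal.ofReal_inv_of_pos hn0, ← ENNReal.ofReal_mul (by positivity)]
  congr 1
  simp only [empMean, Finset.sum_range, smul_eq_mul]
  ring

/-- The part of `treeMean` brought by the personalization values of the offspring. -/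
def persCoeff (θ : ℝ) (n : ℕ) (w : ℕ → VType) : ℝ :=
  θ⁻¹ * empMean n w (fun x => x.wOut * (|x.wt| * invMarkMean x (inRate θ n w)) * |x.pers|)

/-- The contraction factor of the recursion for `treeMean`. -/
def contractCoeff (θ : ℝ) (n : ℕ) (w : ℕ → VType) : ℝ :=
  θ⁻¹ * empMean n w (fun x => x.wOut * (|x.wt| * invMarkMean x (inRate θ n w)) * x.wIn)

/-- By the rank-one structure the vector of means collapses to a scalar with an affine recursion
whose coefficients do not depend on `k`; iterating gives a geometric sum. -/
lemma treeMean_succ (θ : ℝ) (w : ℕ → VType) (k : ℕ) :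
    treeMean θ n w (k + 1) = persCoeff θ n w + contractCoeff θ n w * treeMean θ n w k := by
  have : ∀ i : Fin n, (w i).wOut * childMean θ n w (k + 1) i =
      (w i).wOut * (|(w i).wt| * invMarkMean (w i) (inRate θ n w)) * |(w i).pers| +
      (w i).wOut * (|(w i).wt| * invMarkMean (w i) (inRate θ n w)) * (w i).wIn *
        treeMean θ n w k := fun i => by
    rw [childMean, ← treeMean]; ring
  rw [treeMean, Finset.sum_congr rfl fun i _ => this i, Finset.sum_add_distrib, ← Finset.sum_mul]
  simp only [persCoeff, contractCoeff, empMean, Finset.sum_range, smul_eq_mul, mul_inv]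
  ring

lemma treeMean_eq (θ : ℝ) (w : ℕ → VType) (k : ℕ) :
    treeMean θ n w k = persCoeff θ n w * ∑ i ∈ Finset.range k, contractCoeff θ n w ^ i := by
  induction k with
  | zero => simp [treeMean, childMean]
  | succ k ih =>
    rw [treeMean_succ, ih, Finset.sum_range_succ', pow_zero]
    simp only [pow_succ, ← Finset.sum_mul]
    ring

lemma empMean_nonneg {f : VType → ℝ} (hf : ∀ x, 0 ≤ f x) (w : ℕ → VType) : 0 ≤ empMean n w f :=
  smul_nonneg (by positivity) (Finset.sum_nonneg fun i _ => hf _)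

lemma contractCoeff_nonneg {θ : ℝ} (hθ : 0 < θ) (w : ℕ → VType) : 0 ≤ contractCoeff θ n w :=
  mul_nonneg (by positivity) (empMean_nonneg (fun x => mul_nonneg (mul_nonneg x.wOut_nonneg
    (mul_nonneg (abs_nonneg _) (invMarkMean_nonneg _ _))) x.wIn_nonneg) w)

/-- The mean of `W⁺` divided by `θ` is exactly the rate `ℓ` governing the marks, so each summand
contains `W⁻ ℓ E[1 / (Z + 1)] ≤ 1` and `|ζ| ≤ c`. The function `f` will be `W⁺` (contraction factor)
or `|Q|` (source term). -/
lemma wIn_mul_contractCoeff_le {θ : ℝ} (hθ : 0 < θ) (w : ℕ → VType) {c : ℝ}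
    (hc : ∀ i, |(w i).wt| ≤ c) {f : VType → ℝ} (hf : ∀ x, 0 ≤ f x) :
    empMean n w VType.wIn * (θ⁻¹ * empMean n w (fun x =>
      x.wOut * (|x.wt| * invMarkMean x (inRate θ n w)) * f x)) ≤ c * empMean n w f := by
  have hrate : θ⁻¹ * empMean n w VType.wIn = inRate θ n w := by
    simp only [inRate, empMean, Finset.sum_range, smul_eq_mul, div_eq_mul_inv, mul_inv]; ring
  have hl := inRate_nonneg hθ n w
  calc _ = (n : ℝ)⁻¹ * ∑ i ∈ Finset.range n, inRate θ n w * ((w i).wOut * (|(w i).wt| *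
        invMarkMean (w i) (inRate θ n w)) * f (w i)) := by
        rw [← Finset.mul_sum, ← hrate]
        simp only [empMean, smul_eq_mul]
        ring
    _ ≤ (n : ℝ)⁻¹ * ∑ i ∈ Finset.range n, c * f (w i) := by
        refine mul_le_mul_of_nonneg_left (Finset.sum_le_sum fun i _ => ?_) (by positivity)
        have h1 := mul_invMarkMean_le (w i) hl
        calc _ = ((w i).wOut * inRate θ n w * invMarkMean (w i) (inRate θ n w)) *
              |(w i).wt| * f (w i) := by ring
          _ ≤ 1 * c * f (w i) := by
              refine mul_le_mul_of_nonneg_right (mul_le_mul h1 (hc i) (abs_nonneg _) zero_le_one)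
                (hf _)
          _ = c * f (w i) := by ring
    _ = _ := by rw [← Finset.mul_sum, empMean, smul_eq_mul]; ring

/-- Take `f = W⁺` in the preceding bound and cancel the mean of `W⁺`; if that mean vanishes, so does
the coefficient. The estimate holds for each `n`, with no limit involved. -/
lemma contractCoeff_le {θ : ℝ} (hθ : 0 < θ) (w : ℕ → VType) {c : ℝ} (hc0 : 0 ≤ c)
    (hc : ∀ i, |(w i).wt| ≤ c) : contractCoeff θ n w ≤ c := by
  by_cases h : empMean n w VType.wIn = 0
  · have hz : ∀ i ∈ Finset.range n, (w i).wIn = 0 := by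
      intro i hi
      have hn : (n : ℝ)⁻¹ ≠ 0 := by
        have : n ≠ 0 := by have := Finset.mem_range.1 hi; omega
        positivity
      rw [empMean, smul_eq_mul, mul_eq_zero, or_iff_right hn] at h
      exact (Finset.sum_eq_zero_iff_of_nonneg fun i _ => (w i).wIn_nonneg).1 h i hi
    rw [contractCoeff, empMean, Finset.sum_eq_zero fun i hi => by rw [hz i hi, mul_zero]]
    simpa using hc0
  · have hpos : 0 < empMean n w VType.wIn :=
      lt_of_le_of_ne (empMean_nonneg VType.wIn_nonneg w) (Ne.symm h)
    have := wIn_mul_contractCoeff_le (n := n) hθ w hc VType.wIn_nonneg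
    rw [mul_comm] at this
    exact le_of_mul_le_mul_right this hpos

end TreeRecursion

/-! ### Consequences of the assumptions on the types -/

/-- The assumptions on the law of the types, in the form in which they are used. -/
structure RegularTypes (F : Measure VType) (c : ℝ) : Prop where
  c_nonneg : 0 ≤ c
  c_lt_one : c < 1
  integrable_wIn : Integrable VType.wIn F
  integrable_wOut : Integrable VType.wOut F
  integrable_pers : Integrable (fun x : VType => |x.pers|) F
  integrable_wOut_mul_wIn : Integrable (fun x : VType => x.wOut * x.wIn) F
  integrable_wOut_mul_pers : Integrable (fun x : VType => x.wOut * |x.pers|) F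
  abs_wt_le : ∀ᵐ x ∂F, |x.wt| ≤ c
  indep : IndepFun (fun x : VType => (x.wIn, x.pers)) (fun x : VType => (x.wOut, x.wt)) F
  meanOut_pos : 0 < meanOut F

@[fun_prop] lemma continuous_wIn : Continuous VType.wIn := by unfold VType.wIn; fun_prop
@[fun_prop] lemma continuous_wOut : Continuous VType.wOut := by unfold VType.wOut; fun_prop
@[fun_prop] lemma continuous_pers : Continuous VType.pers := by unfold VType.pers; fun_prop
@[fun_prop] lemma continuous_wt : Continuous VType.wt := by unfold VType.wt; fun_prop
@[fun_prop] lemma measurable_wIn : Measurable VType.wIn := continuous_wIn.measurable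
@[fun_prop] lemma measurable_wOut : Measurable VType.wOut := continuous_wOut.measurable
@[fun_prop] lemma measurable_pers : Measurable VType.pers := continuous_pers.measurable
@[fun_prop] lemma measurable_wt : Measurable VType.wt := continuous_wt.measurable

/-- First moments come from `x ≤ 1 + x ^ (1 + δ)` and its quadratic analogue. The mixed products are
integrable because their factors are independent. -/
lemma TypeAssumption.exists_regularTypes {F : Measure VType} [IsProbabilityMeasure F]
    (hF : TypeAssumption F) (hpos : 0 < meanOut F) : ∃ c, RegularTypes F c := by
  obtain ⟨δ, c, hδ, -, hc0, hc1, hint, hwt⟩ := hF.exists_bounds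
  have hle : ∀ x : VType, x.wIn ≤ 1 + x.wIn ^ (1 + δ) := fun x => by
    rcases le_total x.wIn 1 with h | h
    · linarith [Real.rpow_nonneg x.wIn_nonneg (1 + δ)]
    · have := Real.rpow_le_rpow_of_exponent_le h (by linarith : (1 : ℝ) ≤ 1 + δ)
      rw [Real.rpow_one] at this
      linarith
  have h0 : ∀ x : VType, 0 ≤ x.wIn ^ (1 + δ) := fun x => Real.rpow_nonneg x.wIn_nonneg _
  have hint1 := (integrable_const (μ := F) (1 : ℝ)).add hint
  have hIn : Integrable VType.wIn F := by
    refine hint1.mono' (by fun_prop) (ae_of_all _ fun x => ?_)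
    rw [Real.norm_of_nonneg x.wIn_nonneg]
    simp only [Pi.add_apply]
    linarith [hle x, sq_nonneg x.wOut, abs_nonneg x.pers]
  have hOut : Integrable VType.wOut F := by
    refine hint1.mono' (by fun_prop) (ae_of_all _ fun x => ?_)
    rw [Real.norm_of_nonneg x.wOut_nonneg]
    simp only [Pi.add_apply]
    nlinarith [h0 x, sq_nonneg (x.wOut - 1), abs_nonneg x.pers]
  have hPers : Integrable (fun x : VType => |x.pers|) F := by
    refine hint1.mono' (by fun_prop) (ae_of_all _ fun x => ?_)
    rw [Real.norm_of_nonneg (abs_nonneg _)]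
    simp only [Pi.add_apply]
    nlinarith [h0 x, sq_nonneg x.wOut]
  refine ⟨c, hc0.le, hc1, hIn, hOut, hPers, ?_, ?_, hwt, hF.indep, hpos⟩
  · exact (hF.indep.symm.comp measurable_fst measurable_fst).integrable_mul hOut hIn
  · exact (hF.indep.symm.comp (φ := Prod.fst) (ψ := fun p : ℝ × ℝ => |p.2|) measurable_fst
      (by fun_prop)).integrable_mul hOut hPers

lemma RegularTypes.theta_eq {F : Measure VType} {c : ℝ} (hF : RegularTypes F c) :
    theta F = meanIn F + meanOut F :=
  integral_add hF.integrable_wIn hF.integrable_wOut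

lemma meanIn_nonneg (F : Measure VType) : 0 ≤ meanIn F := integral_nonneg fun x => x.wIn_nonneg

lemma RegularTypes.theta_pos {F : Measure VType} {c : ℝ} (hF : RegularTypes F c) :
    0 < theta F := by
  rw [hF.theta_eq]; linarith [meanIn_nonneg F, hF.meanOut_pos]

/-! ### Uniform laws of large numbers -/

section LLN

variable {Ω : Type*} [MeasurableSpace Ω] {P : Measure Ω}
  {F : Measure VType} {W : ℕ → Ω → VType}

lemma strong_law_comp (hWmeas : ∀ i, Measurable (W i)) (hWindep : iIndepFun W P)
    (hWlaw : ∀ i, P.map (W i) = F) {E : Type*} [NormedAddCommGroup E] [NormedSpace ℝ E]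
    [CompleteSpace E] [SecondCountableTopology E] [MeasurableSpace E] [BorelSpace E]
    {f : VType → E} (hf : Measurable f) (hint : Integrable f F) :
    ∀ᵐ ω ∂P, Tendsto (fun n => empMean n (fun i => W i ω) f) atTop (𝓝 (∫ x, f x ∂F)) := by
  have h := strong_law_ae (μ := P) (fun i ω => f (W i ω)) ?_ ?_ ?_
  · have h2 : ∫ ω, f (W 0 ω) ∂P = ∫ x, f x ∂F := by
      rw [← hWlaw 0, integral_map (hWmeas 0).aemeasurable hf.aestronglyMeasurable]
    simp only [h2] at h
    exact h
  · rw [← hWlaw 0] at hint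
    exact hint.comp_measurable (hWmeas 0)
  · exact fun i j hij => (hWindep.indepFun hij).comp hf hf
  · refine fun i => ⟨(hf.comp (hWmeas i)).aemeasurable, (hf.comp (hWmeas 0)).aemeasurable, ?_⟩
    have : ∀ i, P.map (fun ω => f (W i ω)) = F.map f := fun i => by
      rw [← hWlaw i, Measure.map_map hf (hWmeas i)]; rfl
    rw [this, this]

/-- The map `x ↦ g x ·` is a random element of the separable Banach space `C(s, ℂ)`, integrable
thanks to the envelope. The strong law there is convergence in sup norm. -/
lemma uniform_strong_law (hWmeas : ∀ i, Measurable (W i)) (hWindep : iIndepFun W P)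
    (hWlaw : ∀ i, P.map (W i) = F) {Y : Type*} [MetricSpace Y] {g : VType → Y → ℂ}
    (hg : Continuous (Function.uncurry g)) {env : VType → ℝ} (henv : Integrable env F)
    (hb : ∀ᵐ x ∂F, ∀ y, ‖g x y‖ ≤ env x) {s : Set Y} (hs : IsCompact s)
    (hs0 : s.Nonempty) :
    ∀ᵐ ω ∂P, TendstoUniformlyOn (fun n y => empMean n (fun i => W i ω) (fun x => g x y))
      (fun y => ∫ x, g x y ∂F) atTop s := by
  have : CompactSpace s := isCompact_iff_compactSpace.1 hs
  let G : C(VType, C(s, ℂ)) := ContinuousMap.curry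
    ⟨fun p : VType × s => g p.1 p.2, hg.comp (continuous_fst.prodMk
        (continuous_subtype_val.comp continuous_snd))⟩
  borelize C(s, ℂ)
  have hGm : Measurable G := G.continuous.measurable
  have hGi : Integrable G F := by
    refine henv.mono' hGm.aestronglyMeasurable ?_
    filter_upwards [hb] with x hx
    rw [ContinuousMap.norm_le]
    · exact fun y => hx y
    · exact (norm_nonneg _).trans (hx hs0.some)
  filter_upwards [strong_law_comp hWmeas hWindep hWlaw hGm hGi] with ω hω
  rw [ContinuousMap.tendsto_iff_tendstoUniformly] at hω
  rw [tendstoUniformlyOn_iff_tendstoUniformly_comp_coe]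
  convert hω using 2 with n
  · ext y
    simp only [empMean, ContinuousMap.smul_apply, ContinuousMap.sum_apply]
    rfl
  · ext y
    exact (ContinuousMap.integral_apply hGi y).symm

/-- The limit of `L_n⁺ / (θ n)`. -/
def limRate (F : Measure VType) : ℝ := meanIn F / theta F

lemma theta_inv_mul_empMean_wIn (θ : ℝ) (n : ℕ) (w : ℕ → VType) :
    θ⁻¹ * empMean n w VType.wIn = inRate θ n w := by
  simp only [inRate, empMean, Finset.sum_range, smul_eq_mul, div_eq_mul_inv, mul_inv]; ring

lemma continuous_integral_param {Y : Type*} [TopologicalSpace Y] [FirstCountableTopology Y]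
    {g : VType → Y → ℂ} (hg : Continuous (Function.uncurry g)) {env : VType → ℝ}
    (henv : Integrable env F) (hb : ∀ᵐ x ∂F, ∀ y, ‖g x y‖ ≤ env x) :
    Continuous fun y => ∫ x, g x y ∂F :=
  continuous_of_dominated (bound := env)
    (fun y => (hg.comp (by fun_prop : Continuous fun x : VType => (x, y))).aestronglyMeasurable)
    (fun y => hb.mono fun x hx => hx y) henv
    (ae_of_all _ fun x => hg.comp (by fun_prop : Continuous fun y => (x, y)))

/-- The rate is itself random and depends on all the types, so the summands are not i.i.d.
Uniformity over rates in a compact interval lets the random rate be substituted, and continuity of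
the limit in the rate concludes. -/
lemma uniform_strong_law_inRate {c : ℝ} (hF : RegularTypes F c) (hWmeas : ∀ i, Measurable (W i))
    (hWindep : iIndepFun W P) (hWlaw : ∀ i, P.map (W i) = F) {g : VType → ℝ × ℝ → ℂ}
    (hg : Continuous (Function.uncurry g)) {env : VType → ℝ} (henv : Integrable env F)
    (hb : ∀ᵐ x ∂F, ∀ y, ‖g x y‖ ≤ env x) :
    ∀ᵐ ω ∂P, ∀ T : ℕ, TendstoUniformlyOn
      (fun n t => empMean n (fun i => W i ω) (fun x => g x
          (inRate (theta F) n (fun i => W i ω), t)))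
      (fun t => ∫ x, g x (limRate F, t) ∂F) atTop (Set.Icc (-(T : ℝ)) T) := by
  have hl0 : 0 ≤ limRate F := div_nonneg (meanIn_nonneg F) hF.theta_pos.le
  have h1 : ∀ᵐ ω ∂P, ∀ T : ℕ, TendstoUniformlyOn
      (fun n y => empMean n (fun i => W i ω) (fun x => g x y)) (fun y => ∫ x, g x y ∂F) atTop
      (Set.Icc 0 (limRate F + 1) ×ˢ Set.Icc (-(T : ℝ)) T) := by
    refine ae_all_iff.2 fun T => uniform_strong_law hWmeas hWindep hWlaw hg henv hb
      (isCompact_Icc.prod isCompact_Icc) ⟨(0, 0), ⟨le_rfl, by linarith⟩, by simp⟩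
  filter_upwards [h1, strong_law_comp hWmeas hWindep hWlaw measurable_wIn hF.integrable_wIn]
    with ω hω hIn T
  have hrate : Tendsto (fun n => inRate (theta F) n (fun i => W i ω)) atTop (𝓝 (limRate F)) := by
    simp only [← theta_inv_mul_empMean_wIn]
    rw [limRate, div_eq_inv_mul]
    exact hIn.const_mul _
  have hcont := continuous_integral_param hg henv hb
  have h2 : TendstoUniformlyOn (fun n t => ∫ x, g x (inRate (theta F) n (fun i => W i ω), t) ∂F)
      (fun t => ∫ x, g x (limRate F, t) ∂F) atTop (Set.Icc (-(T : ℝ)) T) := by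
    -- Joint continuity makes the rate act continuously into the compact-open topology, which is
    -- locally uniform convergence in `t`.
    have h3 := ((ContinuousMap.curry ⟨fun y : ℝ × ℝ => ∫ x, g x y ∂F, hcont⟩).continuous.tendsto
      (limRate F)).comp hrate
    exact ContinuousMap.tendsto_iff_forall_isCompact_tendstoUniformlyOn.1 h3 _ isCompact_Icc
  rw [Metric.tendstoUniformlyOn_iff] at h2 ⊢
  intro ε hε
  have h4 := Metric.tendstoUniformlyOn_iff.1 (hω T) (ε / 2) (half_pos hε)
  filter_upwards [h2 (ε / 2) (half_pos hε), h4, hrate.eventually (eventually_le_nhds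
    (lt_add_one (limRate F)))] with n hn1 hn2 hn3 t ht
  have := hn2 (inRate (theta F) n (fun i => W i ω), t)
    ⟨⟨(inRate_nonneg hF.theta_pos n _ : 0 ≤ inRate (theta F) n fun i => W i ω), hn3⟩, ht⟩
  have h5 := hn1 t ht
  refine (dist_triangle _ (∫ x, g x (inRate (theta F) n (fun i => W i ω), t) ∂F) _).trans_lt ?_
  linarith

end LLN

/-! ### Convergence of the recursions -/

section Convergence

/-- The limit of `treeLogChar`. -/
def limLogChar (a : ℝ → ℝ) (F : Measure VType) : ℕ → ℝ → ℂ
  | 0, _ => 0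
  | k + 1, t => ((theta F : ℝ) : ℂ)⁻¹ *
      ∫ x, (x.wOut : ℂ) * (markAvg a (limLogChar a F k) x (limRate F) t - 1) ∂F

lemma continuous_markIntegral {X : Type*} [TopologicalSpace X] {f : ℕ → X → ℂ} {x : X → VType}
    {l : X → ℝ} (hx : Continuous x) (hl : Continuous l) (hf : ∀ m, Continuous (f m)) {C : ℝ}
    (hC : ∀ m y, ‖f m y‖ ≤ C) : Continuous fun y => markIntegral (fun m => f m y) (x y) (l y) := by
  refine continuous_integral_poissonMeasure ?_ hf hC
  exact continuous_real_toNNReal.comp (by fun_prop)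

lemma continuous_nodeFactor {a : ℝ → ℝ} (ha : Continuous a) {B : ℝ → ℂ} (hB : Continuous B) :
    Continuous fun p : VType × ℝ => nodeFactor a B p.1 p.2 := by
  unfold nodeFactor
  fun_prop

lemma continuous_markAvg {a : ℝ → ℝ} (ha : Continuous a) {B : ℝ → ℂ} (hB : Continuous B)
    (hre : ∀ τ, (B τ).re ≤ 0) :
    Continuous fun p : VType × ℝ × ℝ => markAvg a B p.1 p.2.1 p.2.2 := by
  refine continuous_markIntegral (f := fun m (p : VType × ℝ × ℝ) => nodeFactor a B p.1
    (p.2.2 * a (p.1.wt / ((m : ℝ) + 1)))) (l := fun p => p.2.1) continuous_fst (by fun_prop)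
        (fun m => ?_)
    (fun m p => norm_nodeFactor_le (hre _))
  exact (continuous_nodeFactor ha hB).comp (by fun_prop : Continuous fun p : VType × ℝ × ℝ =>
    (p.1, p.2.2 * a (p.1.wt / ((m : ℝ) + 1))))

variable {F : Measure VType} {c : ℝ}

lemma norm_wOut_mul_sub_one_le {z : ℂ} (hz : ‖z‖ ≤ 1) (x : VType) :
    ‖(x.wOut : ℂ) * (z - 1)‖ ≤ x.wOut * 2 := by
  rw [norm_mul, Complex.norm_real, Real.norm_of_nonneg x.wOut_nonneg]
  refine mul_le_mul_of_nonneg_left ((norm_sub_le _ _).trans ?_) x.wOut_nonneg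
  rw [norm_one]
  linarith

/-- The two properties are proved together: the sign at stage `k` bounds `markAvg` by one, which
supplies the dominating function for continuity and the sign at stage `k + 1`. -/
lemma limLogChar_spec {a : ℝ → ℝ} (ha : Continuous a) (hF : RegularTypes F c) (k : ℕ) :
    Continuous (limLogChar a F k) ∧ ∀ τ, (limLogChar a F k τ).re ≤ 0 := by
  induction k with
  | zero => exact ⟨continuous_const, fun _ => le_rfl⟩
  | succ k ih =>
    have hcont := continuous_markAvg ha ih.1 ih.2
    have henv : Integrable (fun x : VType => x.wOut * 2) F := hF.integrable_wOut.mul_const 2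
    have hb : ∀ x : VType, ∀ t, ‖(x.wOut : ℂ) *
        (markAvg a (limLogChar a F k) x (limRate F) t - 1)‖ ≤ x.wOut * 2 := fun x t =>
      norm_wOut_mul_sub_one_le (norm_markAvg_le ih.2 x _ _) x
    have hc2 : Continuous (Function.uncurry fun (x : VType) t => (x.wOut : ℂ) *
        (markAvg a (limLogChar a F k) x (limRate F) t - 1)) := by
      have := hcont.comp (by fun_prop : Continuous fun p : VType × ℝ => (p.1, limRate F, p.2))
      exact (by fun_prop : Continuous fun p : VType × ℝ => ((p.1.wOut : ℝ) : ℂ)).mul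
        (this.sub continuous_const)
    constructor
    · exact continuous_const.mul (continuous_integral_param hc2 henv (ae_of_all _ hb))
    · intro τ
      rw [limLogChar, ← Complex.ofReal_inv, Complex.re_ofReal_mul]
      refine mul_nonpos_of_nonneg_of_nonpos (inv_nonneg.2 hF.theta_pos.le) ?_
      have hi : Integrable (fun x : VType => (x.wOut : ℂ) *
          (markAvg a (limLogChar a F k) x (limRate F) τ - 1)) F :=
        henv.mono' (hc2.comp (by fun_prop : Continuous fun x : VType =>
            (x, τ))).aestronglyMeasurable
          (ae_of_all _ fun x => hb x τ)
      have h2 := integral_re hi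
      simp only [RCLike.re_to_complex] at h2
      rw [← h2]
      refine integral_nonpos fun x => ?_
      simp only [Complex.re_ofReal_mul, Pi.zero_apply]
      refine mul_nonpos_of_nonneg_of_nonpos x.wOut_nonneg ?_
      have := (Complex.re_le_norm _).trans (norm_markAvg_le ih.2 (a := a) x (limRate F) τ)
      simpa using this

lemma continuous_logCharIntegrand {a : ℝ → ℝ} (ha : Continuous a) (hF : RegularTypes F c) (k : ℕ) :
    Continuous (Function.uncurry fun (x : VType) (p : ℝ × ℝ) => (x.wOut : ℂ) *
      (markAvg a (limLogChar a F k) x p.1 p.2 - 1)) := by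
  obtain ⟨hB, hre⟩ := limLogChar_spec ha hF k
  exact (by fun_prop : Continuous fun p : VType × ℝ × ℝ => ((p.1.wOut : ℝ) : ℂ)).mul
    ((continuous_markAvg ha hB hre).sub continuous_const)

lemma norm_empMean_sub_le {f g : VType → ℂ} {h : VType → ℝ} (n : ℕ) (w : ℕ → VType)
    (hfg : ∀ i, ‖f (w i) - g (w i)‖ ≤ h (w i)) :
    ‖empMean n w f - empMean n w g‖ ≤ empMean n w h := by
  rw [empMean, empMean, empMean, ← smul_sub, ← Finset.sum_sub_distrib, norm_smul, smul_eq_mul,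
    Real.norm_of_nonneg (by positivity)]
  exact mul_le_mul_of_nonneg_left ((norm_sum_le _ _).trans (Finset.sum_le_sum fun i _ => hfg i))
    (by positivity)

lemma empMean_mul_const (n : ℕ) (w : ℕ → VType) (f : VType → ℝ) (b : ℝ) :
    empMean n w (fun x => f x * b) = empMean n w f * b := by
  rw [empMean, empMean, ← Finset.sum_mul, smul_mul_assoc]

variable {Ω : Type*} [MeasurableSpace Ω] {P : Measure Ω} {W : ℕ → Ω → VType}

lemma ae_forall_abs_wt_le (hF : RegularTypes F c) (hWmeas : ∀ i, Measurable (W i))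
    (hWlaw : ∀ i, P.map (W i) = F) : ∀ᵐ ω ∂P, ∀ i, |(W i ω).wt| ≤ c := by
  refine ae_all_iff.2 fun i => ?_
  have := hF.abs_wt_le
  rw [← hWlaw i] at this
  exact ae_of_ae_map (hWmeas i).aemeasurable this

/-- Weights only shrink frequencies, so uniform convergence on `[-T, T]` is passed on by the
recursion on the same interval. -/
lemma abs_mark_arg_le {a : ℝ → ℝ} (habs : ∀ r, |a r| = |r|) {z c t T : ℝ} (hz : |z| ≤ c)
    (hc : c ≤ 1) (ht : |t| ≤ T) (m : ℕ) : |t * a (z / ((m : ℝ) + 1))| ≤ T := by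
  have hm : (1 : ℝ) ≤ (m : ℝ) + 1 := by linarith [(Nat.cast_nonneg m : (0 : ℝ) ≤ m)]
  rw [abs_mul, habs, abs_div, abs_of_pos (by linarith : (0 : ℝ) < (m : ℝ) + 1)]
  have : |z| / ((m : ℝ) + 1) ≤ 1 := (div_le_self (abs_nonneg _) hm).trans (hz.trans hc)
  exact (mul_le_of_le_one_right (abs_nonneg _) this).trans ht

/-- Induction on `k` with two errors. Replacing the random `B_k` by its limit inside the empirical
mean costs at most the mean of `W⁻ W⁺` times the previous error; the mean with the deterministic
`B_k` is handled by the uniform law of large numbers. -/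
lemma tendstoUniformlyOn_treeLogChar {a : ℝ → ℝ} (ha : Continuous a) (habs : ∀ r, |a r| = |r|)
    (hF : RegularTypes F c) (hWmeas : ∀ i, Measurable (W i)) (hWindep : iIndepFun W P)
    (hWlaw : ∀ i, P.map (W i) = F) :
    ∀ᵐ ω ∂P, ∀ (k T : ℕ), TendstoUniformlyOn
      (fun n t => treeLogChar a (theta F) n (fun i => W i ω) k t) (limLogChar a F k) atTop
      (Set.Icc (-(T : ℝ)) T) := by
  have h1 : ∀ᵐ ω ∂P, ∀ k T : ℕ, TendstoUniformlyOn (fun n t => empMean n (fun i => W i ω)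
      (fun x => (x.wOut : ℂ) * (markAvg a (limLogChar a F k) x
        (inRate (theta F) n (fun i => W i ω)) t - 1)))
      (fun t => ∫ x, (x.wOut : ℂ) * (markAvg a (limLogChar a F k) x (limRate F) t - 1) ∂F)
      atTop (Set.Icc (-(T : ℝ)) T) := ae_all_iff.2 fun k =>
    uniform_strong_law_inRate (g := fun x p => (x.wOut : ℂ) *
      (markAvg a (limLogChar a F k) x p.1 p.2 - 1)) (env := fun x => x.wOut * 2) hF hWmeas hWindep
      hWlaw (continuous_logCharIntegrand ha hF k)
      (hF.integrable_wOut.mul_const 2) (ae_of_all _ fun x p =>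
        norm_wOut_mul_sub_one_le (norm_markAvg_le (limLogChar_spec ha hF k).2 x _ _) x)
  filter_upwards [h1, ae_forall_abs_wt_le hF hWmeas hWlaw, strong_law_comp hWmeas hWindep hWlaw
    (by fun_prop) hF.integrable_wOut_mul_wIn] with ω hω hwt hM k T
  set w : ℕ → VType := fun i => W i ω
  have hθ := hF.theta_pos
  induction k with
  | zero =>
    rw [Metric.tendstoUniformlyOn_iff]
    intro ε hε
    refine Eventually.of_forall fun n t _ => ?_
    rw [treeLogChar_zero, limLogChar, dist_self]
    exact hε
  | succ k ih =>
    rw [Metric.tendstoUniformlyOn_iff] at ih ⊢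
    intro ε hε
    have hωk := Metric.tendstoUniformlyOn_iff.1 (hω k T) (theta F * (ε / 2)) (by positivity)
    set M := ∫ x, x.wOut * x.wIn ∂F
    have hM0 : 0 ≤ M := integral_nonneg fun x => mul_nonneg x.wOut_nonneg x.wIn_nonneg
    -- The empirical mean of `W⁻ W⁺` is eventually at most `M + 1`, so an error `η` at stage `k`
    -- contributes at most `θ ε / 2`.
    set η := theta F * (ε / 2) / (M + 1) with hη
    have hηpos : 0 < η := by positivity
    filter_upwards [ih η hηpos, hωk, hM.eventually (eventually_le_nhds (lt_add_one M))]
      with n hn1 hn2 hn3 t ht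
    have hd : ‖empMean n w (fun x => (x.wOut : ℂ) * (markAvg a (treeLogChar a (theta F) n w k) x
          (inRate (theta F) n w) t - 1)) - empMean n w (fun x => (x.wOut : ℂ) *
          (markAvg a (limLogChar a F k) x (inRate (theta F) n w) t - 1))‖ ≤
        theta F * (ε / 2) := by
      refine (norm_empMean_sub_le (h := fun x => x.wOut * x.wIn * η) n w fun i => ?_).trans ?_
      · rw [← mul_sub, norm_mul, Complex.norm_real, Real.norm_of_nonneg (w i).wOut_nonneg,
          sub_sub_sub_cancel_right, mul_assoc]
        refine mul_le_mul_of_nonneg_left ?_ (w i).wOut_nonneg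
        refine norm_markAvg_sub_le (re_treeLogChar_nonpos a hθ w k) (limLogChar_spec ha hF k).2
          fun m => ?_
        rw [← dist_eq_norm, dist_comm]
        refine (hn1 _ (abs_le.1 ?_)).le
        exact abs_mark_arg_le habs (hwt i) hF.c_lt_one.le (abs_le.2 ht) m
      · rw [empMean_mul_const]
        refine (mul_le_mul_of_nonneg_right hn3 hηpos.le).trans_eq ?_
        rw [hη]
        field_simp
    have hd2 := hn2 t ht
    rw [treeLogChar_succ ha.measurable hθ, limLogChar, dist_eq_norm, ← mul_sub, norm_mul,
      norm_inv, Complex.norm_real, Real.norm_of_nonneg hθ.le, inv_mul_lt_iff₀ hθ]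
    rw [dist_eq_norm] at hd2
    calc _ ≤ _ := norm_sub_le_norm_sub_add_norm_sub _ (empMean n w (fun x => (x.wOut : ℂ) *
          (markAvg a (limLogChar a F k) x (inRate (theta F) n w) t - 1))) _
      _ < theta F * (ε / 2) + theta F * (ε / 2) := by
          rw [norm_sub_rev (empMean n w (fun x => (x.wOut : ℂ) *
            (markAvg a (limLogChar a F k) x (inRate (theta F) n w) t - 1)))]
          exact add_lt_add_of_lt_of_le hd2 hd
      _ = theta F * ε := by ring

/-- The limit of the characteristic functions of the ranks of the root. -/
def limRootChar (a : ℝ → ℝ) (F : Measure VType) (k : ℕ) (t : ℝ) : ℂ :=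
  ∫ x, nodeFactor a (limLogChar a F k) x t ∂F

lemma tendsto_integral_cis_rootRank [IsProbabilityMeasure F] {a : ℝ → ℝ} (ha : Continuous a)
    (habs : ∀ r, |a r| = |r|) (hF : RegularTypes F c) (hWmeas : ∀ i, Measurable (W i))
    (hWindep : iIndepFun W P) (hWlaw : ∀ i, P.map (W i) = F) :
    ∀ᵐ ω ∂P, ∀ (k : ℕ) (t : ℝ), Tendsto (fun n => ∫ p, cis
        (t * rootRank a (fun i => W i ω) (k + 1) p)
      ∂(rootedLaw (theta F) n (fun i => W i ω))) atTop (𝓝 (limRootChar a F k t)) := by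
  have h1 : ∀ᵐ ω ∂P, ∀ k T : ℕ, TendstoUniformlyOn (fun n t => empMean n (fun i => W i ω)
      (fun x => nodeFactor a (limLogChar a F k) x t))
      (limRootChar a F k) atTop (Set.Icc (-(T : ℝ)) T) := ae_all_iff.2 fun k =>
    uniform_strong_law_inRate (g := fun x p => nodeFactor a (limLogChar a F k) x p.2) hF hWmeas
      hWindep hWlaw ((continuous_nodeFactor ha (limLogChar_spec ha hF k).1).comp
        (by fun_prop : Continuous fun p : VType × ℝ × ℝ => (p.1, p.2.2)))
      (integrable_const 1) (ae_of_all _ fun x p =>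
        norm_nodeFactor_le ((limLogChar_spec ha hF k).2 _))
  filter_upwards [h1, tendstoUniformlyOn_treeLogChar ha habs hF hWmeas hWindep hWlaw,
    strong_law_comp hWmeas hWindep hWlaw measurable_wIn hF.integrable_wIn] with ω hω hB hIn k t
  set w : ℕ → VType := fun i => W i ω
  obtain ⟨T, hT⟩ := exists_nat_ge |t|
  have ht : t ∈ Set.Icc (-(T : ℝ)) T := abs_le.1 hT
  have h2 := (hω k T).tendsto_at ht
  have h3 := (hB k T).tendsto_at ht
  have h4 : Tendsto (fun n => empMean n w VType.wIn *
      ‖treeLogChar a (theta F) n w k t - limLogChar a F k t‖) atTop (𝓝 0) := by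
    have := hIn.mul (tendsto_iff_norm_sub_tendsto_zero.1 h3)
    simpa using this
  have h5 : Tendsto (fun n => empMean n w (fun x => nodeFactor a
      (treeLogChar a (theta F) n w k) x t) -
      empMean n w (fun x => nodeFactor a (limLogChar a F k) x t)) atTop (𝓝 0) := by
    refine squeeze_zero_norm (fun n => ?_) h4
    rw [← empMean_mul_const]
    exact norm_empMean_sub_le n w fun i => norm_nodeFactor_sub_le
      (re_treeLogChar_nonpos a hF.theta_pos w k t) ((limLogChar_spec ha hF k).2 t)
  have h6 := h5.add h2
  rw [zero_add] at h6
  refine h6.congr' ?_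
  filter_upwards [eventually_ge_atTop 1] with n hn
  rw [integral_cis_rootRank_succ ha.measurable hF.theta_pos hn, sub_add_cancel]

lemma continuous_invMarkMean : Continuous fun p : VType × ℝ => invMarkMean p.1 p.2 := by
  have h : ∀ p : VType × ℝ, invMarkMean p.1 p.2 =
      (markIntegral (fun m => ((1 / ((m : ℝ) + 1) : ℝ) : ℂ)) p.1 p.2).re := fun p => by
    rw [markIntegral, integral_complex_ofReal, Complex.ofReal_re, invMarkMean]
  simp only [h]
  refine Complex.continuous_re.comp (continuous_markIntegral
    (f := fun m _ => ((1 / ((m : ℝ) + 1) : ℝ) : ℂ)) (C := 1) continuous_fst continuous_snd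
    (fun m => continuous_const) fun m _ => ?_)
  rw [Complex.norm_real, Real.norm_of_nonneg (by positivity)]
  exact inv_succ_le_one m

lemma tendsto_coeff (hF : RegularTypes F c) (hWmeas : ∀ i, Measurable (W i))
    (hWindep : iIndepFun W P) (hWlaw : ∀ i, P.map (W i) = F) {f : VType → ℝ} (hf : Continuous f)
    (hf0 : ∀ x, 0 ≤ f x) (hint : Integrable (fun x => x.wOut * f x) F) :
    ∀ᵐ ω ∂P, Tendsto (fun n => (theta F)⁻¹ * empMean n (fun i => W i ω) (fun x =>
        x.wOut * (|x.wt| * invMarkMean x (inRate (theta F) n (fun i => W i ω))) * f x)) atTop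
      (𝓝 ((theta F)⁻¹ * ∫ x, x.wOut * (|x.wt| * invMarkMean x (limRate F)) * f x ∂F)) := by
  have hg : Continuous (Function.uncurry fun (x : VType) (p : ℝ × ℝ) =>
      ((x.wOut * (|x.wt| * invMarkMean x p.1) * f x : ℝ) : ℂ)) := by
    have := continuous_invMarkMean.comp
      (by fun_prop : Continuous fun p : VType × ℝ × ℝ => (p.1, p.2.1))
    refine Complex.continuous_ofReal.comp ?_
    exact ((by fun_prop : Continuous fun p : VType × ℝ × ℝ => p.1.wOut).mul
      ((by fun_prop : Continuous fun p : VType × ℝ × ℝ => |p.1.wt|).mul this)).mul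
      (hf.comp continuous_fst)
  have h := uniform_strong_law_inRate hF hWmeas hWindep hWlaw hg hint ?_
  · filter_upwards [h] with ω hω
    -- The integrand does not involve the frequency, so the degenerate interval `[0, 0]` suffices.
    have h2 := (hω 0).tendsto_at (x := 0) (by simp)
    have h3 := (Complex.continuous_re.tendsto _).comp h2
    refine Tendsto.const_mul _ ?_
    rw [integral_complex_ofReal, Complex.ofReal_re] at h3
    refine h3.congr fun n => ?_
    simp only [Function.comp_apply, empMean, Complex.smul_re, Complex.re_sum, Complex.ofReal_re]
  · filter_upwards [hF.abs_wt_le] with x hx p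
    rw [Complex.norm_real, Real.norm_of_nonneg (mul_nonneg (mul_nonneg x.wOut_nonneg
      (mul_nonneg (abs_nonneg _) (invMarkMean_nonneg _ _))) (hf0 x))]
    have h1 : |x.wt| * invMarkMean x p.1 ≤ 1 :=
      mul_le_one₀ (hx.trans hF.c_lt_one.le) (invMarkMean_nonneg _ _) (invMarkMean_le_one _ _)
    exact mul_le_mul_of_nonneg_right (mul_le_of_le_one_right x.wOut_nonneg h1) (hf0 x)

end Convergence

/-! ### The limiting branching process -/

section Recombine

variable {F : Measure VType} {c : ℝ}

/-- The type vector with `(W⁺, Q)` taken from `y` and `(W⁻, ζ)` taken from `x`. -/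
def recombine (x y : VType) : VType := (y.1, x.2.1, y.2.2.1, x.2.2.2)

lemma measurable_recombine : Measurable fun p : VType × VType => recombine p.1 p.2 := by
  unfold recombine; fun_prop

/-- Independence of the two halves of the type vector, stated as invariance of `F` under exchanging
one half with that of an independent copy. -/
lemma map_recombine [IsProbabilityMeasure F] (hF : RegularTypes F c) :
    (F.prod F).map (fun p => recombine p.1 p.2) = F := by
  let A : VType → ℝ × ℝ := fun x => (x.wIn, x.pers)
  let B : VType → ℝ × ℝ := fun x => (x.wOut, x.wt)
  let glue : (ℝ × ℝ) × (ℝ × ℝ) → VType :=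
    fun p => (p.2.1.toNNReal, p.1.1.toNNReal, p.2.2, p.1.2)
  have hA : Measurable A := by fun_prop
  have hBm : Measurable B := by fun_prop
  have hglue : Measurable glue := by fun_prop
  have h : F.map (fun x => (B x, A x)) = (F.map B).prod (F.map A) :=
    (indepFun_iff_map_prod_eq_prod_map_map hBm.aemeasurable hA.aemeasurable).1 hF.indep.symm
  have hid : glue ∘ (fun x => (B x, A x)) = id := by
    funext x
    simp [glue, A, B, VType.wIn, VType.wOut, VType.pers, VType.wt]
  calc (F.prod F).map (fun p => recombine p.1 p.2)
      = (F.prod F).map (glue ∘ Prod.map B A) := by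
        congr 1
        funext p
        simp [glue, A, B, VType.wIn, VType.wOut, VType.pers, VType.wt, recombine]
    _ = (F.map (fun x => (B x, A x))).map glue := by
        rw [h, Measure.map_prod_map _ _ hBm hA, Measure.map_map hglue (hBm.prodMap hA)]
    _ = F := by
        rw [Measure.map_map hglue (hBm.prodMk hA), hid, Measure.map_id]

lemma integral_recombine [IsProbabilityMeasure F] (hF : RegularTypes F c) {f : VType → ℂ}
    (hf : Measurable f)
    (hint : Integrable f F) : ∫ x, f x ∂F = ∫ x, ∫ y, f (recombine x y) ∂F ∂F := by
  have h2 : Integrable (fun p : VType × VType => f (recombine p.1 p.2)) (F.prod F) := by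
    rw [← map_recombine hF] at hint
    exact hint.comp_measurable measurable_recombine
  conv_lhs => rw [← map_recombine hF]
  rw [integral_map measurable_recombine.aemeasurable hf.aestronglyMeasurable, integral_prod _ h2]

lemma integral_recombine_mul [IsProbabilityMeasure F] (hF : RegularTypes F c) {f g : VType → ℝ}
    (hf : Measurable f)
    (hg : Measurable g) (hfr : ∀ x y, f (recombine x y) = f x)
    (hgr : ∀ x y, g (recombine x y) = g y) :
    ∫ x, f x * g x ∂F = (∫ x, f x ∂F) * ∫ x, g x ∂F := by
  have hm : Measurable fun x => f x * g x := hf.mul hg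
  conv_lhs => rw [← map_recombine hF]
  rw [integral_map measurable_recombine.aemeasurable hm.aestronglyMeasurable]
  simp only [hfr, hgr]
  exact integral_prod_mul f g

lemma continuous_wOut_mul_markAvg {a : ℝ → ℝ} (ha : Continuous a) {B : ℝ → ℂ} (hB : Continuous B)
    (hre : ∀ τ, (B τ).re ≤ 0) (l t : ℝ) :
    Continuous fun x : VType => (x.wOut : ℂ) * markAvg a B x l t := by
  have h0 : Continuous fun x : VType => (x, l, t) := by fun_prop
  have h1 := (continuous_markAvg ha hB hre).comp h0
  have h2 : Continuous fun x : VType => ((x.wOut : ℝ) : ℂ) := by fun_prop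
  exact h2.mul h1

lemma integrable_wOut_mul_markAvg (hF : RegularTypes F c) {a : ℝ → ℝ} (ha : Continuous a)
    {B : ℝ → ℂ} (hB : Continuous B) (hre : ∀ τ, (B τ).re ≤ 0) (l t : ℝ) :
    Integrable (fun x : VType => (x.wOut : ℂ) * markAvg a B x l t) F := by
  refine hF.integrable_wOut.mono' (continuous_wOut_mul_markAvg ha hB hre l t).aestronglyMeasurable
    (ae_of_all _ fun x => ?_)
  rw [norm_mul, Complex.norm_real, Real.norm_of_nonneg x.wOut_nonneg]
  exact mul_le_of_le_one_right x.wOut_nonneg (norm_markAvg_le hre _ _ _)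

lemma markAvg_recombine (a : ℝ → ℝ) (B : ℝ → ℂ) (x y : VType) (l t : ℝ) :
    markAvg a B (recombine x y) l t =
      markIntegral (fun m => nodeFactor a B y (t * a (x.wt / ((m : ℝ) + 1)))) x l := by
  simp only [markAvg, markIntegral, nodeFactor, recombine, VType.wIn, VType.wOut, VType.pers,
    VType.wt]

lemma integral_markIntegral_nodeFactor [IsFiniteMeasure F] {a : ℝ → ℝ} (ha : Continuous a)
    {B : ℝ → ℂ} (hB : Continuous B) (hre : ∀ τ, (B τ).re ≤ 0) (x : VType) (l : ℝ) (τ : ℕ → ℝ) :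
    ∫ y, markIntegral (fun m => nodeFactor a B y (τ m)) x l ∂F =
      markIntegral (fun m => ∫ y, nodeFactor a B y (τ m) ∂F) x l := by
  have hm : Measurable fun p : VType × ℕ => nodeFactor a B p.1 (τ p.2) := by
    refine measurable_from_prod_countable_left fun m => ?_
    have h : Continuous fun y : VType => nodeFactor a B y (τ m) :=
      (continuous_nodeFactor ha hB).comp (by fun_prop : Continuous fun y : VType => (y, τ m))
    exact h.measurable
  have hi : Integrable (fun p : VType × ℕ => nodeFactor a B p.1 (τ p.2))
      (F.prod (poissonMeasure (Real.toNNReal (x.wOut * l)))) :=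
    Integrable.of_bound hm.aestronglyMeasurable 1 (ae_of_all _ fun p => norm_nodeFactor_le (hre _))
  exact integral_integral_swap hi

/-- An offspring is chosen with bias `W⁻`, and its weight depends on `(W⁻, ζ)`, while its own
offspring and value depend on `(W⁺, Q)`. After recombination the latter are averaged under the
unbiased law `F`, separately from the weight. -/
lemma integral_wOut_mul_markAvg [IsProbabilityMeasure F] (hF : RegularTypes F c) {a : ℝ → ℝ}
    (ha : Continuous a)
    {B : ℝ → ℂ} (hB : Continuous B) (hre : ∀ τ, (B τ).re ≤ 0) (l t : ℝ) :
    ∫ x, (x.wOut : ℂ) * markAvg a B x l t ∂F = ∫ x, (x.wOut : ℂ) * markIntegral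
      (fun m => ∫ y, nodeFactor a B y (t * a (x.wt / ((m : ℝ) + 1))) ∂F) x l ∂F := by
  rw [integral_recombine hF (continuous_wOut_mul_markAvg ha hB hre l t).measurable
    (integrable_wOut_mul_markAvg hF ha hB hre l t)]
  refine integral_congr_ae (ae_of_all _ fun x => ?_)
  have h1 : ∀ y, (recombine x y).wOut = x.wOut := fun y => rfl
  simp only [h1, markAvg_recombine]
  rw [integral_const_mul, integral_markIntegral_nodeFactor ha hB hre]

end Recombine

/-! ### Integrals against the laws of `(𝓝, 𝓠)` and `𝓒` -/

section LimitLaws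

variable {F : Measure VType} {c : ℝ}

lemma lintegral_ofReal_wOut_div (hF : RegularTypes F c) :
    ∫⁻ x, ENNReal.ofReal (x.wOut / meanOut F) ∂F = 1 := by
  rw [← ofReal_integral_eq_lintegral_ofReal (hF.integrable_wOut.div_const _)
    (ae_of_all _ fun x => div_nonneg x.wOut_nonneg hF.meanOut_pos.le), integral_div]
  change ENNReal.ofReal (meanOut F / meanOut F) = 1
  rw [div_self hF.meanOut_pos.ne', ENNReal.ofReal_one]

lemma isProbabilityMeasure_sizeBiased (hF : RegularTypes F c) :
    IsProbabilityMeasure (F.withDensity fun x => ENNReal.ofReal (x.wOut / meanOut F)) :=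
  ⟨by rw [withDensity_apply _ MeasurableSet.univ, Measure.restrict_univ,
    lintegral_ofReal_wOut_div hF]⟩

lemma isProbabilityMeasure_branchLaw [IsProbabilityMeasure F] : IsProbabilityMeasure
    (branchLaw F) :=
  isProbabilityMeasure_bind_poissonMeasure_map F (by fun_prop) (fun m => by fun_prop)

lemma isProbabilityMeasure_weightLaw (hF : RegularTypes F c) :
    IsProbabilityMeasure (weightLaw F) := by
  have := isProbabilityMeasure_sizeBiased hF
  exact isProbabilityMeasure_bind_poissonMeasure_map _ (by fun_prop) (fun m => by fun_prop)

/-- The Poisson generating function, given the type, puts the integrand in the form of `nodeFactor`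
with log-characteristic function `θ⁻¹ E[W⁻] (z - 1)`. -/
lemma integral_branchLaw [IsProbabilityMeasure F] (hF : RegularTypes F c) {a : ℝ → ℝ}
    (ha : Measurable a) (τ : ℝ) {z : ℂ}
    (hz : ‖z‖ ≤ 1) :
    ∫ p, cis (τ * a p.2) * z ^ p.1 ∂(branchLaw F) =
      ∫ x, cis (τ * a x.pers) *
        Complex.exp (x.wIn * (((theta F : ℝ) : ℂ)⁻¹ * (meanOut F * (z - 1)))) ∂F := by
  rw [branchLaw, integral_bind_poissonMeasure_map F (by fun_prop) (fun m => by fun_prop) (C := 1)]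
  · refine integral_congr_ae (ae_of_all _ fun x => ?_)
    simp only
    rw [integral_const_mul, integral_pow_poissonMeasure]
    congr 2
    have : ((Real.toNNReal (meanOut F * x.wIn / theta F) : ℝ≥0) : ℝ) =
        meanOut F * x.wIn / theta F := Real.coe_toNNReal _
      (div_nonneg (mul_nonneg hF.meanOut_pos.le x.wIn_nonneg) hF.theta_pos.le)
    rw [this]
    push_cast
    ring
  · refine measurable_from_prod_countable_right fun m => ?_
    fun_prop
  · intro p
    rw [norm_mul, norm_cis, one_mul, norm_pow]
    exact pow_le_one₀ (norm_nonneg _) hz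

lemma integral_weightLaw (hF : RegularTypes F c) {g : ℝ → ℂ} (hg : Measurable g)
    (hb : ∀ r, ‖g r‖ ≤ 1) :
    ∫ r, g r ∂(weightLaw F) = ((meanOut F : ℝ) : ℂ)⁻¹ *
      ∫ x, (x.wOut : ℂ) * markIntegral (fun m => g (x.wt / ((m : ℝ) + 1))) x (limRate F) ∂F := by
  have := isProbabilityMeasure_sizeBiased hF
  rw [weightLaw, integral_bind_poissonMeasure_map _ (by fun_prop) (fun m => by fun_prop) hg hb,
    integral_withDensity_eq_integral_toReal_smul (by fun_prop)
      (ae_of_all _ fun x => ENNReal.ofReal_lt_top), ← integral_const_mul]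
  refine integral_congr_ae (ae_of_all _ fun x => ?_)
  simp only
  rw [ENNReal.toReal_ofReal (div_nonneg x.wOut_nonneg hF.meanOut_pos.le), Complex.real_smul,
    markIntegral, limRate, mul_div_assoc', mul_comm x.wOut (meanIn F)]
  push_cast
  ring

lemma lintegral_branchLaw_mean [IsProbabilityMeasure F] (hF : RegularTypes F c) {b : ℝ}
    (hb : 0 ≤ b) :
    ∫⁻ p, (ENNReal.ofReal |p.2| + p.1 * ENNReal.ofReal b) ∂(branchLaw F) =
      ENNReal.ofReal ((∫ x, |x.pers| ∂F) + meanIn F * ((theta F)⁻¹ * (meanOut F * b))) := by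
  have hθ := hF.theta_pos
  have hm : Measurable fun p : ℕ × ℝ => ENNReal.ofReal |p.2| + p.1 * ENNReal.ofReal b :=
    measurable_from_prod_countable_right fun m => by fun_prop
  rw [branchLaw, lintegral_bind_poissonMeasure_map F (by fun_prop) (fun m => by fun_prop) hm]
  have h0 : ∀ x : VType, 0 ≤ meanOut F * x.wIn / theta F := fun x =>
    div_nonneg (mul_nonneg hF.meanOut_pos.le x.wIn_nonneg) hθ.le
  have h1 : ∀ x : VType, ∫⁻ m : ℕ, (ENNReal.ofReal |x.pers| + m * ENNReal.ofReal b)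
      ∂(poissonMeasure (Real.toNNReal (meanOut F * x.wIn / theta F))) =
      ENNReal.ofReal (|x.pers| + meanOut F * x.wIn / theta F * b) := fun x => by
    rw [lintegral_add_left measurable_const, lintegral_const, measure_univ, mul_one,
      lintegral_mul_const _ Measurable.of_discrete, lintegral_natCast_poissonMeasure,
      ENNReal.ofReal_add (abs_nonneg _) (mul_nonneg (h0 x) hb), ENNReal.ofReal_mul (h0 x)]
    rfl
  simp only [h1]
  have h2 : Integrable (fun x : VType => meanOut F * x.wIn / theta F * b) F :=
    ((hF.integrable_wIn.const_mul _).div_const _).mul_const _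
  have h3 : Integrable (fun x : VType => |x.pers| + meanOut F * x.wIn / theta F * b) F :=
    hF.integrable_pers.add h2
  rw [← ofReal_integral_eq_lintegral_ofReal h3
    (ae_of_all _ fun x => add_nonneg (abs_nonneg _) (mul_nonneg (h0 x) hb)),
    integral_add hF.integrable_pers h2, integral_mul_const, integral_div, integral_const_mul]
  congr 2
  rw [meanIn]
  field_simp

/-- `E|𝓒|`. -/
def weightMean (F : Measure VType) : ℝ :=
  (meanOut F)⁻¹ * ∫ x, x.wOut * (|x.wt| * invMarkMean x (limRate F)) ∂F

lemma weightMean_nonneg (hF : RegularTypes F c) : 0 ≤ weightMean F :=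
  mul_nonneg (inv_nonneg.2 hF.meanOut_pos.le) (integral_nonneg fun x => mul_nonneg x.wOut_nonneg
    (mul_nonneg (abs_nonneg _) (invMarkMean_nonneg _ _)))

lemma continuous_sizeWeight (l : ℝ) :
    Continuous fun x : VType => x.wOut * (|x.wt| * invMarkMean x l) := by
  have := continuous_invMarkMean.comp (by fun_prop : Continuous fun x : VType => (x, l))
  exact continuous_wOut.mul (continuous_wt.abs.mul this)

lemma integrable_sizeWeight (hF : RegularTypes F c) (l : ℝ) :
    Integrable (fun x : VType => x.wOut * (|x.wt| * invMarkMean x l)) F := by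
  refine hF.integrable_wOut.mono' (continuous_sizeWeight l).aestronglyMeasurable ?_
  filter_upwards [hF.abs_wt_le] with x hx
  rw [Real.norm_of_nonneg (mul_nonneg x.wOut_nonneg
    (mul_nonneg (abs_nonneg _) (invMarkMean_nonneg _ _)))]
  exact mul_le_of_le_one_right x.wOut_nonneg
    (mul_le_one₀ (hx.trans hF.c_lt_one.le) (invMarkMean_nonneg _ _) (invMarkMean_le_one _ _))

lemma lintegral_weightLaw_abs (hF : RegularTypes F c) :
    ∫⁻ r, ENNReal.ofReal |r| ∂(weightLaw F) = ENNReal.ofReal (weightMean F) := by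
  have := isProbabilityMeasure_sizeBiased hF
  have hm : Measurable fun r : ℝ => ENNReal.ofReal |r| := by fun_prop
  rw [weightLaw, lintegral_bind_poissonMeasure_map _ (by fun_prop) (fun m => by fun_prop) hm]
  have h1 : ∀ x : VType, ∫⁻ m : ℕ, ENNReal.ofReal |x.wt / ((m : ℝ) + 1)|
      ∂(poissonMeasure (Real.toNNReal (meanIn F * x.wOut / theta F))) =
      ENNReal.ofReal (|x.wt| * invMarkMean x (limRate F)) := fun x => by
    rw [ENNReal.ofReal_mul (abs_nonneg _), ofReal_invMarkMean,
      ← lintegral_const_mul _ Measurable.of_discrete, limRate, mul_div_assoc',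
      mul_comm x.wOut (meanIn F)]
    refine lintegral_congr fun m => ?_
    rw [← ENNReal.ofReal_mul (abs_nonneg _), abs_div,
      abs_of_nonneg (by positivity : (0 : ℝ) ≤ (m : ℝ) + 1)]
    congr 1
    ring
  simp only [h1]
  have hc : Measurable fun x : VType => ENNReal.ofReal (|x.wt| * invMarkMean x (limRate F)) := by
    have := continuous_invMarkMean.comp
      (by fun_prop : Continuous fun x : VType => (x, limRate F))
    exact (continuous_wt.abs.mul this).measurable.ennreal_ofReal
  rw [lintegral_withDensity_eq_lintegral_mul _ (by fun_prop) hc, weightMean, ← integral_const_mul,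
    ofReal_integral_eq_lintegral_ofReal ((integrable_sizeWeight hF _).const_mul _)]
  · refine lintegral_congr fun x => ?_
    rw [Pi.mul_apply, ← ENNReal.ofReal_mul (div_nonneg x.wOut_nonneg hF.meanOut_pos.le)]
    congr 1
    ring
  · exact ae_of_all _ fun x => mul_nonneg (inv_nonneg.2 hF.meanOut_pos.le) (mul_nonneg
      x.wOut_nonneg (mul_nonneg (abs_nonneg _) (invMarkMean_nonneg _ _)))

end LimitLaws

/-! ### Truncations of the limiting branching process -/

section LimitRecursion

variable {F : Measure VType} {c : ℝ}

/-- The law of the node data of the limiting branching process. -/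
abbrev limNodeLaw (F : Measure VType) : Fin 1 → Measure ((ℕ × ℝ) × ℝ) :=
  fun _ => (branchLaw F).prod (weightLaw F)

/-- The truncated solution as a branching recursion, after applying `a` to all weights and
personalization values. -/
def limRank (a : ℝ → ℝ) (k : ℕ) (x : List ℕ × Fin 1 → (ℕ × ℝ) × ℝ) : ℝ :=
  branchRank (fun _ e => List.replicate e.1.1 0) (fun _ e => a e.2) (fun _ e => a e.1.2) k 0 x

lemma measurable_limCh : Measurable fun e : (ℕ × ℝ) × ℝ => List.replicate e.1.1 (0 : Fin 1) :=
  (Measurable.of_discrete (f := fun m : ℕ => List.replicate m (0 : Fin 1))).comp (by fun_prop)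

@[fun_prop]
lemma measurable_limRank {a : ℝ → ℝ} (ha : Measurable a) (k : ℕ) : Measurable (limRank a k) :=
  measurable_branchRank (fun _ => measurable_limCh) (fun _ => by fun_prop) (fun _ => by fun_prop)
    k 0

/-- The characteristic function of the weighted rank of a node of the limiting tree. -/
def limChildChar (a : ℝ → ℝ) (F : Measure VType) (k : ℕ) (t : ℝ) : ℂ :=
  ∫ x, cis (t * (a (x ([], 0)).2 * limRank a k x)) ∂(nodeLaw (limNodeLaw F))

lemma limRootChar_eq (a : ℝ → ℝ) (k : ℕ) (t : ℝ) : limRootChar a F k t =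
    ∫ x, cis (t * a x.pers) * Complex.exp (x.wIn * limLogChar a F k t) ∂F := rfl

lemma norm_limRootChar_le [IsProbabilityMeasure F] {a : ℝ → ℝ} (ha : Continuous a)
    (hF : RegularTypes F c) (k : ℕ) (t : ℝ) :
    ‖limRootChar a F k t‖ ≤ 1 := by
  simpa [limRootChar] using norm_integral_le_of_norm_le_const (μ := F) (ae_of_all _ fun x =>
    norm_nodeFactor_le (a := a) (x := x) ((limLogChar_spec ha hF k).2 t))

lemma continuous_limRootChar [IsProbabilityMeasure F] {a : ℝ → ℝ} (ha : Continuous a)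
    (hF : RegularTypes F c) (k : ℕ) :
    Continuous (limRootChar a F k) :=
  continuous_integral_param (continuous_nodeFactor ha (limLogChar_spec ha hF k).1)
    (integrable_const 1) (ae_of_all _ fun _ t => norm_nodeFactor_le ((limLogChar_spec ha hF k).2 t))

/-- The hypothesis `hk` is the induction hypothesis of the identification below. The frequency `τ`
is `t * a r` for a weighted child and constant for the root. -/
lemma integral_cis_limRank_succ_aux [IsProbabilityMeasure F] (hF : RegularTypes F c) {a : ℝ → ℝ}
    (ha : Continuous a)
    {k : ℕ} (hk : ∀ t, ((theta F : ℝ) : ℂ)⁻¹ * (meanOut F * (limChildChar a F k t - 1)) =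
      limLogChar a F k t) {τ : ℝ → ℝ} (hτ : Measurable τ) :
    ∫ x, cis (τ (x ([], 0)).2 * limRank a (k + 1) x) ∂(nodeLaw (limNodeLaw F)) =
      ∫ r, limRootChar a F k (τ r) ∂(weightLaw F) := by
  have := isProbabilityMeasure_branchLaw (F := F)
  have := isProbabilityMeasure_weightLaw hF
  have ham := ha.measurable
  have hnorm : ∀ t, ‖limChildChar a F k t‖ ≤ 1 := fun t => by
    simpa [limChildChar] using norm_integral_le_of_norm_le_const (μ := nodeLaw (limNodeLaw F))
      (f := fun x => cis (t * (a (x ([], 0)).2 * limRank a k x))) (C := 1)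
      (ae_of_all _ fun x => (norm_cis _).le)
  have hmeas : Measurable (limChildChar a F k) := by
    have h : Measurable fun p : ℝ × (List ℕ × Fin 1 → (ℕ × ℝ) × ℝ) =>
        cis (p.1 * (a (p.2 ([], 0)).2 * limRank a k p.2)) := by
      have := measurable_limRank ham k
      fun_prop
    exact h.stronglyMeasurable.integral_prod_right.measurable
  have h := integral_cis_branchRank_succ (limNodeLaw F)
    (ch := fun _ e => List.replicate e.1.1 0) (wt := fun _ e => a e.2)
    (pers := fun _ e => a e.1.2) (τ := fun e => τ e.2) (fun _ => measurable_limCh)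
    (fun _ => by fun_prop) (fun _ => by fun_prop) (by fun_prop) k 0
  simp only [List.map_replicate, List.prod_replicate] at h
  refine h.trans ?_
  have hint : Integrable (fun e : (ℕ × ℝ) × ℝ => cis (τ e.2 * a e.1.2) *
      limChildChar a F k (τ e.2) ^ e.1.1) ((branchLaw F).prod (weightLaw F)) := by
    refine Integrable.of_bound (Measurable.aestronglyMeasurable ?_) 1 (ae_of_all _ fun e => ?_)
    · fun_prop
    · rw [norm_mul, norm_cis, one_mul, norm_pow]
      exact pow_le_one₀ (norm_nonneg _) (hnorm _)
  refine (integral_prod_symm _ hint).trans ?_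
  refine integral_congr_ae (ae_of_all _ fun r => ?_)
  simp only
  rw [integral_branchLaw hF ham (τ r) (hnorm _), hk, limRootChar_eq]

/-- Identifies the analytic limit of the finite-tree recursion with the branching process. A child
contributes the average of `limRootChar` over the law of `𝓒`; undoing the recombination turns it
into the size-biased integral defining `limLogChar`. -/
lemma mul_limChildChar_sub_one [IsProbabilityMeasure F] (hF : RegularTypes F c) {a : ℝ → ℝ}
    (ha : Continuous a) (k : ℕ)
    (t : ℝ) : ((theta F : ℝ) : ℂ)⁻¹ * (meanOut F * (limChildChar a F k t - 1)) =
      limLogChar a F k t := by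
  have := isProbabilityMeasure_branchLaw (F := F)
  have := isProbabilityMeasure_weightLaw hF
  induction k generalizing t with
  | zero => simp [limChildChar, limRank, branchRank, cis_zero, limLogChar]
  | succ k ih =>
    obtain ⟨hB, hre⟩ := limLogChar_spec ha hF k
    have ham := ha.measurable
    have h1 := integral_cis_limRank_succ_aux hF ha ih (τ := fun r => t * a r) (by fun_prop)
    simp only [mul_assoc] at h1
    have hg : Continuous fun r : ℝ => limRootChar a F k (t * a r) :=
      (continuous_limRootChar ha hF k).comp (by fun_prop : Continuous fun r : ℝ => t * a r)
    have h2 := integral_weightLaw hF hg.measurable (fun r => norm_limRootChar_le ha hF k _)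
    have h3 := integral_wOut_mul_markAvg hF ha hB hre (limRate F) t
    have h4 : limChildChar a F (k + 1) t = ((meanOut F : ℝ) : ℂ)⁻¹ *
        ∫ x, (x.wOut : ℂ) * markAvg a (limLogChar a F k) x (limRate F) t ∂F :=
      h1.trans (h2.trans (congrArg _ h3.symm))
    have hmo : ((meanOut F : ℝ) : ℂ) ≠ 0 := by exact_mod_cast hF.meanOut_pos.ne'
    have h5 : ∫ x, (x.wOut : ℂ) * (markAvg a (limLogChar a F k) x (limRate F) t - 1) ∂F =
        (∫ x, (x.wOut : ℂ) * markAvg a (limLogChar a F k) x (limRate F) t ∂F) - meanOut F := by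
      simp only [mul_sub, mul_one]
      have hw : Integrable (fun x : VType => (x.wOut : ℂ)) F := hF.integrable_wOut.ofReal
      rw [integral_sub (integrable_wOut_mul_markAvg hF ha hB hre (limRate F) t) hw,
        integral_complex_ofReal, meanOut]
    rw [h4, limLogChar, h5, mul_sub, mul_inv_cancel_left₀ hmo, mul_one]

lemma integral_cis_limRank_succ [IsProbabilityMeasure F] (hF : RegularTypes F c) {a : ℝ → ℝ}
    (ha : Continuous a) (k : ℕ)
    (t : ℝ) : ∫ x, cis (t * limRank a (k + 1) x) ∂(nodeLaw (limNodeLaw F)) =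
      limRootChar a F k t := by
  have := isProbabilityMeasure_weightLaw hF
  have := integral_cis_limRank_succ_aux hF ha (mul_limChildChar_sub_one hF ha k)
    (τ := fun _ => t) measurable_const
  simpa using this

/-- `E|𝓒| E[𝓝]`. -/
def limContract (F : Measure VType) : ℝ := meanIn F * ((theta F)⁻¹ * (meanOut F * weightMean F))

lemma limContract_nonneg (hF : RegularTypes F c) : 0 ≤ limContract F :=
  mul_nonneg (meanIn_nonneg F) (mul_nonneg (inv_nonneg.2 hF.theta_pos.le)
    (mul_nonneg hF.meanOut_pos.le (weightMean_nonneg hF)))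

/-- The factor `E[W⁻]` cancels the normalization of the size bias, leaving `W⁻ ℓ E[1 / (Z + 1)] |ζ|`
at the limiting rate `ℓ`, which is at most `c`. -/
lemma limContract_le [IsProbabilityMeasure F] (hF : RegularTypes F c) : limContract F ≤ c := by
  have hl : 0 ≤ limRate F := div_nonneg (meanIn_nonneg F) hF.theta_pos.le
  have h : limContract F =
      ∫ x, limRate F * (x.wOut * (|x.wt| * invMarkMean x (limRate F))) ∂F := by
    rw [integral_const_mul, limContract, weightMean, mul_inv_cancel_left₀ hF.meanOut_pos.ne',
      limRate]
    ring
  rw [h]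
  calc _ ≤ ∫ x, c ∂F := by
        refine integral_mono_ae ((integrable_sizeWeight hF _).const_mul _) (integrable_const _) ?_
        filter_upwards [hF.abs_wt_le] with x hx
        calc _ = (x.wOut * limRate F * invMarkMean x (limRate F)) * |x.wt| := by ring
          _ ≤ 1 * c := mul_le_mul (mul_invMarkMean_le x hl) hx (abs_nonneg _) zero_le_one
          _ = c := one_mul c
    _ = c := by simp

/-- The mean of the absolute rank of the root of the limiting tree truncated at generation `k`. -/
def limAbsMean (F : Measure VType) (k : ℕ) : ℝ :=
  (∫ x, |x.pers| ∂F) * ∑ i ∈ Finset.range k, limContract F ^ i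

lemma limAbsMean_nonneg (hF : RegularTypes F c) (k : ℕ) : 0 ≤ limAbsMean F k :=
  mul_nonneg (integral_nonneg fun _ => abs_nonneg _)
    (Finset.sum_nonneg fun i _ => pow_nonneg (limContract_nonneg hF) i)

lemma limAbsMean_succ (k : ℕ) :
    limAbsMean F (k + 1) = (∫ x, |x.pers| ∂F) + limContract F * limAbsMean F k := by
  rw [limAbsMean, limAbsMean, Finset.sum_range_succ', pow_zero]
  simp only [pow_succ, ← Finset.sum_mul]
  ring

lemma lintegral_limNodeLaw [IsProbabilityMeasure F] (hF : RegularTypes F c) {g : ℝ → ℝ≥0∞}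
    (hg : Measurable g) {b : ℝ}
    (hb : 0 ≤ b) :
    ∫⁻ e, g e.2 * (ENNReal.ofReal |e.1.2| +
      ((List.replicate e.1.1 (0 : Fin 1)).map fun _ => ENNReal.ofReal b).sum)
      ∂((branchLaw F).prod (weightLaw F)) = (∫⁻ r, g r ∂(weightLaw F)) *
      ENNReal.ofReal ((∫ x, |x.pers| ∂F) + meanIn F * ((theta F)⁻¹ * (meanOut F * b))) := by
  have := isProbabilityMeasure_branchLaw (F := F)
  have := isProbabilityMeasure_weightLaw hF
  simp only [List.map_replicate, List.sum_replicate, nsmul_eq_mul]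
  have hm : Measurable fun p : ℕ × ℝ => ENNReal.ofReal |p.2| + p.1 * ENNReal.ofReal b :=
    measurable_from_prod_countable_right fun m => by fun_prop
  rw [← lintegral_branchLaw_mean hF hb, mul_comm, ← lintegral_prod_mul hm.aemeasurable
    hg.aemeasurable]
  exact lintegral_congr fun e => mul_comm _ _

lemma lintegral_abs_wt_mul_limRank [IsProbabilityMeasure F] (hF : RegularTypes F c) (k : ℕ) :
    ∫⁻ x, ENNReal.ofReal |(x ([], 0)).2| * ENNReal.ofReal (limRank abs k x)
      ∂(nodeLaw (limNodeLaw F)) = ENNReal.ofReal (weightMean F * limAbsMean F k) := by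
  have := isProbabilityMeasure_branchLaw (F := F)
  have := isProbabilityMeasure_weightLaw hF
  induction k with
  | zero => simp [limRank, branchRank, limAbsMean]
  | succ k ih =>
    have h := lintegral_branchRank_succ (limNodeLaw F)
      (ch := fun _ e => List.replicate e.1.1 0) (wt := fun _ e => e.2) (pers := fun _ e => e.1.2)
      (g := fun e => ENNReal.ofReal |e.2|) (fun _ => measurable_limCh)
      (fun _ => by fun_prop) (fun _ => by fun_prop) (by fun_prop) k 0
    have h2 : ∀ j : Fin 1, ∫⁻ x, ENNReal.ofReal |(x ([], j)).2| * ENNReal.ofReal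
        (branchRank (fun _ e => List.replicate e.1.1 0) (fun _ e => |e.2|)
            (fun _ e => |e.1.2|) k j x)
        ∂(nodeLaw (limNodeLaw F)) = ENNReal.ofReal (weightMean F * limAbsMean F k) := fun j => by
      rw [Subsingleton.elim j 0]; exact ih
    simp only [h2] at h
    refine h.trans ((lintegral_limNodeLaw hF (g := fun r => ENNReal.ofReal |r|) (by fun_prop)
      (mul_nonneg (weightMean_nonneg hF) (limAbsMean_nonneg hF k))).trans ?_)
    rw [lintegral_weightLaw_abs hF, ← ENNReal.ofReal_mul (weightMean_nonneg hF), limAbsMean_succ,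
      limContract]
    congr 1
    ring

lemma lintegral_limRank_abs [IsProbabilityMeasure F] (hF : RegularTypes F c) (k : ℕ) :
    ∫⁻ x, ENNReal.ofReal (limRank abs k x) ∂(nodeLaw (limNodeLaw F)) =
      ENNReal.ofReal (limAbsMean F k) := by
  have := isProbabilityMeasure_branchLaw (F := F)
  have := isProbabilityMeasure_weightLaw hF
  cases k with
  | zero => simp [limRank, branchRank, limAbsMean]
  | succ k =>
    have h := lintegral_branchRank_succ (limNodeLaw F)
      (ch := fun _ e => List.replicate e.1.1 0) (wt := fun _ e => e.2) (pers := fun _ e => e.1.2)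
      (g := fun e => 1) (fun _ => measurable_limCh)
      (fun _ => by fun_prop) (fun _ => by fun_prop) (by fun_prop) k 0
    have h2 : ∀ j : Fin 1, ∫⁻ x, ENNReal.ofReal |(x ([], j)).2| * ENNReal.ofReal
        (branchRank (fun _ e => List.replicate e.1.1 0) (fun _ e => |e.2|)
            (fun _ e => |e.1.2|) k j x)
        ∂(nodeLaw (limNodeLaw F)) = ENNReal.ofReal (weightMean F * limAbsMean F k) := fun j => by
      rw [Subsingleton.elim j 0]; exact lintegral_abs_wt_mul_limRank hF k
    have h3 := lintegral_limNodeLaw hF (g := fun r => 1) measurable_const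
      (mul_nonneg (weightMean_nonneg hF) (limAbsMean_nonneg hF k))
    simp only [h2, one_mul] at h h3
    refine h.trans (h3.trans ?_)
    rw [lintegral_const, measure_univ, one_mul, one_mul, limAbsMean_succ, limContract]
    congr 1
    ring

end LimitRecursion

/-! ### The endogenous solution as a limit of truncated solutions -/

/-- Path weights are built from the far end; this splits off the edge at the root, matching the
recursion over subtrees. -/
lemma pathWeight_append_singleton (N : List ℕ → ℕ) (C : List ℕ → ℝ) (i : ℕ) (v : List ℕ) :
    pathWeight N C (v ++ [i]) = (if i < N [] then C [i] else 0) *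
      pathWeight (fun u => N (u ++ [i])) (fun u => C (u ++ [i])) v := by
  induction v with
  | nil => simp [pathWeight]
  | cons j v ih =>
    simp only [List.cons_append, pathWeight, ih]
    split_ifs <;> ring

lemma abs_pathWeight (N : List ℕ → ℕ) (C : List ℕ → ℝ) (u : List ℕ) :
    |pathWeight N C u| = pathWeight N (fun v => |C v|) u := by
  induction u with
  | nil => simp [pathWeight]
  | cons j u ih =>
    simp only [pathWeight, ← ih]
    split_ifs <;> simp [abs_mul]

/-- The summands of the series defining the endogenous solution, in terms of the node data. -/
def pathTerm (a : ℝ → ℝ) (x : List ℕ × Fin 1 → (ℕ × ℝ) × ℝ) (u : List ℕ) : ℝ :=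
  pathWeight (fun v => (x (v, 0)).1.1) (fun v => a (x (v, 0)).2) u * a (x (u, 0)).1.2

lemma pathTerm_append_singleton (a : ℝ → ℝ) (x : List ℕ × Fin 1 → (ℕ × ℝ) × ℝ) (i : ℕ)
    (v : List ℕ) : pathTerm a x (v ++ [i]) =
      (if i < (x ([], 0)).1.1 then a (x ([i], 0)).2 else 0) * pathTerm a (subtree i x) v := by
  rw [pathTerm, pathWeight_append_singleton, mul_assoc]
  rfl

lemma limRank_succ (a : ℝ → ℝ) (k : ℕ) (x : List ℕ × Fin 1 → (ℕ × ℝ) × ℝ) :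
    limRank a (k + 1) x = a (x ([], 0)).1.2 + ∑ i ∈ Finset.range (x ([], 0)).1.1,
      a (x ([i], 0)).2 * limRank a k (subtree i x) := by
  have h : ∀ (l : List (Fin 1)), ∑ i : Fin l.length, a (subtree i x ([], l[i])).2 *
      branchRank (fun _ e => List.replicate e.1.1 0) (fun _ e => a e.2) (fun _ e => a e.1.2) k l[i]
        (subtree i x) = ∑ i ∈ Finset.range l.length, a (x ([i], 0)).2 *
          limRank a k (subtree i x) := fun l => by
    rw [← Fin.sum_univ_eq_sum_range (fun i => a (x ([i], 0)).2 * limRank a k (subtree i x))]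
    refine Finset.sum_congr rfl fun i _ => ?_
    rw [Subsingleton.elim l[i] 0]
    rfl
  have h2 := (h (List.replicate (x ([], 0)).1.1 0)).trans (by rw [List.length_replicate])
  exact congrArg (a (x ([], 0)).1.2 + ·) h2

/-- Unrolling the recursion gives the sum over nodes of the first `k` generations. Each nonempty
word is uniquely `v ++ [i]`, so the sum splits according to the child `i` of the root. -/
lemma hasSum_limRank (a : ℝ → ℝ) (k : ℕ) (x : List ℕ × Fin 1 → (ℕ × ℝ) × ℝ) :
    HasSum (fun u : List ℕ => if u.length < k then pathTerm a x u else 0) (limRank a k x) := by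
  induction k generalizing x with
  | zero => simp [limRank, branchRank, hasSum_zero]
  | succ k ih =>
    rw [limRank_succ]
    have hinj : ∀ i : ℕ, Function.Injective fun v : List ℕ => v ++ [i] := fun i =>
      List.append_left_injective [i]
    have h0 : HasSum (fun u : List ℕ => if u = [] then a (x ([], 0)).1.2 else 0)
        (a (x ([], 0)).1.2) := hasSum_ite_eq [] _
    have h1 := h0.add (hasSum_sum (s := Finset.range (x ([], 0)).1.1) fun i _ =>
      ((hasSum_extend_zero (hinj i)).2 (ih (subtree i x))).mul_left (a (x ([i], 0)).2))
    convert h1 using 1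
    funext u
    rcases List.eq_nil_or_concat' u with rfl | ⟨v, i, rfl⟩
    · simp [pathTerm, pathWeight]
    · have h2 : ∀ (j : ℕ) (f : List ℕ → ℝ), Function.extend (fun v : List ℕ => v ++ [j]) f 0
          (v ++ [i]) = if j = i then f v else 0 := fun j f => by
        split_ifs with hij
        · subst hij
          exact (hinj j).extend_apply _ _ _
        · exact Function.extend_apply' _ _ _ (by simp [hij])
      simp only [h2, pathTerm_append_singleton, List.length_append, List.length_singleton,
        Nat.add_lt_add_iff_right]
      simp [mul_ite, Finset.sum_ite_eq']
      split_ifs <;> rfl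

/-- The series of absolute values of the terms of the endogenous solution converges as soon as its
truncations are bounded. -/
lemma summable_pathTerm {x : List ℕ × Fin 1 → (ℕ × ℝ) × ℝ} {B : ℝ} (h : ∀ k, limRank abs k x ≤ B) :
    Summable (pathTerm abs x) := by
  have h0 : ∀ u, 0 ≤ pathTerm abs x u := fun u => by
    rw [pathTerm, ← abs_pathWeight _ (fun v => (x (v, 0)).2)]
    positivity
  refine summable_of_sum_le h0 (c := B) fun s => ?_
  obtain ⟨k, hk⟩ : ∃ k, ∀ u ∈ s, u.length < k :=
    ⟨s.sup List.length + 1, fun u hu => Nat.lt_succ_of_le (Finset.le_sup (f := List.length) hu)⟩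
  calc ∑ u ∈ s, pathTerm abs x u
      = ∑ u ∈ s, if u.length < k then pathTerm abs x u else 0 :=
        Finset.sum_congr rfl fun u hu => (if_pos (hk u hu)).symm
    _ ≤ limRank abs k x := sum_le_hasSum s (fun u _ => by split_ifs; exacts [h0 u, le_rfl])
        (hasSum_limRank abs k x)
    _ ≤ B := h k

lemma abs_pathTerm (x : List ℕ × Fin 1 → (ℕ × ℝ) × ℝ) (u : List ℕ) :
    |pathTerm id x u| = pathTerm abs x u := by
  rw [pathTerm, abs_mul, abs_pathWeight]
  rfl

lemma abs_pathTerm_abs_le (x : List ℕ × Fin 1 → (ℕ × ℝ) × ℝ) (u : List ℕ) :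
    |pathTerm abs x u| ≤ pathTerm abs x u := by
  rw [← abs_pathTerm, abs_abs]

/-- Dominated convergence for series: each term is eventually included, and the absolute series
dominates. -/
lemma tendsto_limRank {a : ℝ → ℝ} (habs : ∀ x u, |pathTerm a x u| ≤ pathTerm abs x u)
    {x : List ℕ × Fin 1 → (ℕ × ℝ) × ℝ} (h : Summable (pathTerm abs x)) :
    Tendsto (fun k => limRank a k x) atTop (𝓝 (∑' u, pathTerm a x u)) := by
  simp only [← (hasSum_limRank a _ x).tsum_eq]
  refine tendsto_tsum_of_dominated_convergence h (fun u => ?_)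
    (Eventually.of_forall fun k u => ?_)
  · refine tendsto_const_nhds.congr' ?_
    filter_upwards [eventually_gt_atTop u.length] with k hk
    rw [if_pos hk]
  · rw [Real.norm_eq_abs]
    split_ifs
    · exact habs x u
    · rw [abs_zero]
      exact (abs_nonneg _).trans (habs x u)

/-! ### Convergence and integrability of the endogenous solution -/

section Limit

variable {F : Measure VType} {c : ℝ}

/-- The limit of the mean absolute truncated ranks. -/
def limAbsMeanTop (F : Measure VType) : ℝ := (∫ x, |x.pers| ∂F) * (1 - limContract F)⁻¹

lemma tendsto_limAbsMean (hF : RegularTypes F c) [IsProbabilityMeasure F] :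
    Tendsto (limAbsMean F) atTop (𝓝 (limAbsMeanTop F)) :=
  (hasSum_geometric_of_lt_one (limContract_nonneg hF)
    ((limContract_le hF).trans_lt hF.c_lt_one)).tendsto_sum_nat.const_mul _

lemma limRank_abs_mono (x : List ℕ × Fin 1 → (ℕ × ℝ) × ℝ) : Monotone fun k => limRank abs k x :=
  fun _ _ hkm => branchRank_abs_mono
    (fun _ (e : (ℕ × ℝ) × ℝ) => List.replicate e.1.1 (0 : Fin 1)) (fun _ e => e.2)
    (fun _ e => e.1.2) hkm 0 x

lemma lintegral_iSup_limRank [IsProbabilityMeasure F] (hF : RegularTypes F c) :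
    ∫⁻ x, ⨆ k, ENNReal.ofReal (limRank abs k x) ∂(nodeLaw (limNodeLaw F)) =
      ENNReal.ofReal (limAbsMeanTop F) := by
  have := isProbabilityMeasure_branchLaw (F := F)
  have := isProbabilityMeasure_weightLaw hF
  have hm : ∀ k, Measurable (limRank abs k) := fun k => by fun_prop
  have hmono : Monotone fun k x => ENNReal.ofReal (limRank abs k x) := fun k m hkm x =>
    ENNReal.ofReal_le_ofReal (limRank_abs_mono x hkm)
  rw [lintegral_iSup (fun k => (hm k).ennreal_ofReal) hmono]
  simp only [lintegral_limRank_abs hF]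
  refine tendsto_nhds_unique (tendsto_atTop_iSup fun k m hkm => ?_)
    ((ENNReal.continuous_ofReal.tendsto _).comp (tendsto_limAbsMean hF))
  simp only [← lintegral_limRank_abs hF]
  exact lintegral_mono fun x => hmono hkm x

/-- The absolute truncations increase and have bounded means, so by monotone convergence their
supremum is integrable, hence almost surely finite. -/
lemma ae_summable_pathTerm [IsProbabilityMeasure F] (hF : RegularTypes F c) :
    ∀ᵐ x ∂(nodeLaw (limNodeLaw F)), Summable (pathTerm abs x) := by
  have := isProbabilityMeasure_branchLaw (F := F)
  have := isProbabilityMeasure_weightLaw hF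
  have hm : ∀ k, Measurable (limRank abs k) := fun k => by fun_prop
  have h := ae_lt_top (μ := nodeLaw (limNodeLaw F))
    (Measurable.iSup fun k => (hm k).ennreal_ofReal)
    (by rw [lintegral_iSup_limRank hF]; exact ENNReal.ofReal_ne_top)
  filter_upwards [h] with x hx
  refine summable_pathTerm (B := (⨆ k, ENNReal.ofReal (limRank abs k x)).toReal) fun k => ?_
  rw [← ENNReal.ofReal_le_iff_le_toReal hx.ne]
  exact le_iSup (fun k => ENNReal.ofReal (limRank abs k x)) k

/-- The endogenous solution (with `a` applied to all weights and personalization values) on the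
canonical probability space. -/
def limSol (a : ℝ → ℝ) (x : List ℕ × Fin 1 → (ℕ × ℝ) × ℝ) : ℝ := ∑' u, pathTerm a x u

lemma aestronglyMeasurable_limSol [IsProbabilityMeasure F] (hF : RegularTypes F c) {a : ℝ → ℝ}
    (ha : Measurable a) (habs : ∀ x u, |pathTerm a x u| ≤ pathTerm abs x u) :
    AEStronglyMeasurable (limSol a) (nodeLaw (limNodeLaw F)) := by
  refine aestronglyMeasurable_of_tendsto_ae atTop (f := fun k => limRank a k)
    (fun k => (measurable_limRank ha k).aestronglyMeasurable) ?_
  filter_upwards [ae_summable_pathTerm hF] with x hx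
  exact tendsto_limRank habs hx

lemma limSol_abs_nonneg (x : List ℕ × Fin 1 → (ℕ × ℝ) × ℝ) : 0 ≤ limSol abs x :=
  tsum_nonneg fun u => (abs_nonneg _).trans (abs_pathTerm x u).le

lemma lintegral_limSol_abs [IsProbabilityMeasure F] (hF : RegularTypes F c) :
    ∫⁻ x, ENNReal.ofReal (limSol abs x) ∂(nodeLaw (limNodeLaw F)) =
      ENNReal.ofReal (limAbsMeanTop F) := by
  rw [← lintegral_iSup_limRank hF]
  refine lintegral_congr_ae ?_
  filter_upwards [ae_summable_pathTerm hF] with x hx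
  refine tendsto_nhds_unique ((ENNReal.continuous_ofReal.tendsto _).comp
    (tendsto_limRank abs_pathTerm_abs_le hx)) (tendsto_atTop_iSup ?_)
  exact fun k m hkm => ENNReal.ofReal_le_ofReal (limRank_abs_mono x hkm)

lemma abs_limSol_le {x : List ℕ × Fin 1 → (ℕ × ℝ) × ℝ} (hx : Summable (pathTerm abs x)) :
    ‖limSol id x‖ ≤ limSol abs x :=
  tsum_of_norm_bounded hx.hasSum fun u => (abs_pathTerm x u).le

lemma integrable_limSol_abs [IsProbabilityMeasure F] (hF : RegularTypes F c) :
    Integrable (limSol abs) (nodeLaw (limNodeLaw F)) := by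
  refine ⟨aestronglyMeasurable_limSol hF measurable_norm abs_pathTerm_abs_le, ?_⟩
  rw [hasFiniteIntegral_iff_ofReal (ae_of_all _ limSol_abs_nonneg), lintegral_limSol_abs hF]
  exact ENNReal.ofReal_lt_top

lemma integral_limSol_abs [IsProbabilityMeasure F] (hF : RegularTypes F c) :
    ∫ x, limSol abs x ∂(nodeLaw (limNodeLaw F)) = limAbsMeanTop F := by
  rw [integral_eq_lintegral_of_nonneg_ae (ae_of_all _ limSol_abs_nonneg)
    (integrable_limSol_abs hF).aestronglyMeasurable, lintegral_limSol_abs hF,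
    ENNReal.toReal_ofReal]
  exact ge_of_tendsto' (tendsto_limAbsMean hF) (limAbsMean_nonneg hF)

lemma integrable_limSol [IsProbabilityMeasure F] (hF : RegularTypes F c) :
    Integrable (limSol id) (nodeLaw (limNodeLaw F)) := by
  refine (integrable_limSol_abs hF).mono' (aestronglyMeasurable_limSol hF measurable_id
    fun x u => (abs_pathTerm x u).le) ?_
  filter_upwards [ae_summable_pathTerm hF] with x hx
  exact abs_limSol_le hx

/-- `limRootChar` at `k` is the characteristic function of the truncation at `k + 1`, and the
truncations converge almost surely to the full series. -/
lemma tendsto_limRootChar [IsProbabilityMeasure F] (hF : RegularTypes F c) {a : ℝ → ℝ}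
    (ha : Continuous a) (habs : ∀ x u, |pathTerm a x u| ≤ pathTerm abs x u) (t : ℝ) :
    Tendsto (fun k => limRootChar a F k t) atTop
      (𝓝 (∫ x, cis (t * limSol a x) ∂(nodeLaw (limNodeLaw F)))) := by
  have := isProbabilityMeasure_branchLaw (F := F)
  have := isProbabilityMeasure_weightLaw hF
  simp only [← integral_cis_limRank_succ hF ha]
  have hm : ∀ k, Measurable (limRank a k) := fun k => measurable_limRank ha.measurable k
  refine tendsto_integral_of_dominated_convergence (fun _ => 1)
    (fun k => Measurable.aestronglyMeasurable ?_) (integrable_const 1)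
    (fun k => ae_of_all _ fun x => (norm_cis _).le) ?_
  · have := hm (k + 1)
    fun_prop
  · filter_upwards [ae_summable_pathTerm hF] with x hx
    exact (continuous_cis.tendsto _).comp
      (((tendsto_add_atTop_iff_nat 1).2 (tendsto_limRank habs hx)).const_mul t)

variable {Ω : Type*} [MeasurableSpace Ω] {P : Measure Ω} {N : List ℕ → Ω → ℕ}
  {Q C : List ℕ → Ω → ℝ}

/-- The family of node data of a branching process. -/
def nodeFamily (N : List ℕ → Ω → ℕ) (Q C : List ℕ → Ω → ℝ) (ω : Ω) :
    List ℕ × Fin 1 → (ℕ × ℝ) × ℝ := fun p => ((N p.1 ω, Q p.1 ω), C p.1 ω)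

lemma measurable_nodeFamily (hB : IsBranchingFamily F P N Q C) : Measurable (nodeFamily N Q C) :=
  measurable_pi_lambda _ fun p =>
    ((hB.measurable_N p.1).prodMk (hB.measurable_Q p.1)).prodMk (hB.measurable_C p.1)

lemma map_nodeFamily (hB : IsBranchingFamily F P N Q C) :
    P.map (nodeFamily N Q C) = nodeLaw (limNodeLaw F) := by
  have hinj : Function.Injective (Prod.fst : List ℕ × Fin 1 → List ℕ) := fun p q h =>
    Prod.ext h (Subsingleton.elim _ _)
  have hi := hB.indep.precomp hinj
  have h := hi.map_fun_eq_infinitePi_map fun (p : List ℕ × Fin 1) =>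
    ((hB.measurable_N p.1).prodMk (hB.measurable_Q p.1)).prodMk (hB.measurable_C p.1)
  refine h.trans ?_
  have h2 : ∀ p : List ℕ × Fin 1, P.map (fun ω => ((N p.1 ω, Q p.1 ω), C p.1 ω)) =
      limNodeLaw F p.2 := fun p => hB.law p.1
  exact congrArg Measure.infinitePi (funext h2)

end Limit

/-! ### Quenched convergence of the rank of the root -/

/-- Interchange of limits by a three-term estimate: the truncation error `ε k` is uniform in `n`, so
a fixed level can stand in for `κ n`. -/
lemma tendsto_of_uniform_truncation {E : Type*} [PseudoMetricSpace E] {f : ℕ → ℕ → E} {g : ℕ → E}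
    {h : E} {ε : ℕ → ℝ} (hg : ∀ k, Tendsto (fun n => f n k) atTop (𝓝 (g k)))
    (hh : Tendsto g atTop (𝓝 h)) (hε : Tendsto ε atTop (𝓝 0))
    (hf : ∀ᶠ n in atTop, ∀ k j, k ≤ j → dist (f n j) (f n k) ≤ ε k) {κ : ℕ → ℕ}
    (hκ : Tendsto κ atTop atTop) : Tendsto (fun n => f n (κ n)) atTop (𝓝 h) := by
  rw [Metric.tendsto_nhds]
  intro δ hδ
  have hδ3 : 0 < δ / 3 := by positivity
  obtain ⟨K, hK1, hK2⟩ := ((hε.eventually_lt_const hδ3).and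
    (Metric.tendsto_nhds.1 hh _ hδ3)).exists
  filter_upwards [Metric.tendsto_nhds.1 (hg K) _ hδ3, hf, hκ.eventually_ge_atTop K] with n h1 h2 h3
  have h4 := h2 K (κ n) h3
  have h5 := dist_triangle4 (f n (κ n)) (f n K) (g K) h
  linarith

lemma tendsto_of_uniform_truncation_succ {E : Type*} [PseudoMetricSpace E] {f : ℕ → ℕ → E}
    {g : ℕ → E} {h : E} {ε : ℕ → ℝ} (hg : ∀ k, Tendsto (fun n => f n (k + 1)) atTop (𝓝 (g k)))
    (hh : Tendsto g atTop (𝓝 h)) (hε : Tendsto ε atTop (𝓝 0))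
    (hf : ∀ᶠ n in atTop, ∀ k j, k ≤ j → dist (f n (j + 1)) (f n (k + 1)) ≤ ε k) {κ : ℕ → ℕ}
    (hκ : Tendsto κ atTop atTop) : Tendsto (fun n => f n (κ n)) atTop (𝓝 h) := by
  have h1 : Tendsto (fun n => κ n - 1) atTop atTop := (tendsto_sub_atTop_nat 1).comp hκ
  refine (tendsto_of_uniform_truncation hg hh hε hf h1).congr' ?_
  filter_upwards [hκ.eventually_ge_atTop 1] with n hn
  rw [Nat.sub_add_cancel hn]

/-! ### Uniform truncation bounds for the rank of the root -/

section RootMean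

variable {n : ℕ} {θ c : ℝ} {w : ℕ → VType}

lemma rootRank_abs_nonneg (w : ℕ → VType) (k : ℕ)
    (p : Fin n × (List ℕ × Fin n → List (Fin n) × ℕ)) : 0 ≤ rootRank abs w k p :=
  branchRank_abs_nonneg (fun _ (e : List (Fin n) × ℕ) => e.1) (fun j e => (w j).wt / e.2)
    (fun j _ => (w j).pers) k p.1 p.2

lemma abs_rootRank_le (w : ℕ → VType) (k : ℕ)
    (p : Fin n × (List ℕ × Fin n → List (Fin n) × ℕ)) : |rootRank id w k p| ≤ rootRank abs w k p :=
  abs_branchRank_le (fun _ (e : List (Fin n) × ℕ) => e.1) (fun j e => (w j).wt / e.2)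
    (fun j _ => (w j).pers) k p.1 p.2

lemma abs_rootRank_sub_le (w : ℕ → VType) {k m : ℕ} (hkm : k ≤ m)
    (p : Fin n × (List ℕ × Fin n → List (Fin n) × ℕ)) :
    |rootRank id w m p - rootRank id w k p| ≤ rootRank abs w m p - rootRank abs w k p :=
  abs_branchRank_sub_le (fun _ (e : List (Fin n) × ℕ) => e.1) (fun j e => (w j).wt / e.2)
    (fun j _ => (w j).pers) hkm p.1 p.2

/-- The mean of `rootRank abs w (k + 1)`. -/
def rootMean (θ : ℝ) (n : ℕ) (w : ℕ → VType) (k : ℕ) : ℝ :=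
  empMean n w (fun x => |x.pers|) + empMean n w VType.wIn * treeMean θ n w k

lemma rootMean_nonneg (hθ : 0 < θ) (k : ℕ) : 0 ≤ rootMean θ n w k :=
  add_nonneg (empMean_nonneg (fun _ => abs_nonneg _) w)
    (mul_nonneg (empMean_nonneg VType.wIn_nonneg w) (treeMean_nonneg hθ w k))

/-- The increment is a tail of a geometric series with ratio at most `c`, and its source term is at
most `c` times the mean of `|Q|`. Only that empirical mean still depends on `n`. -/
lemma rootMean_sub_le (hθ : 0 < θ) (hc0 : 0 ≤ c) (hc1 : c < 1) (hc : ∀ i, |(w i).wt| ≤ c)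
    {k j : ℕ} (hkj : k ≤ j) : rootMean θ n w j - rootMean θ n w k ≤
      c * empMean n w (fun x => |x.pers|) * (c ^ k / (1 - c)) := by
  have h1 : rootMean θ n w j - rootMean θ n w k = empMean n w VType.wIn * persCoeff θ n w *
      ∑ i ∈ Finset.Ico k j, contractCoeff θ n w ^ i := by
    rw [Finset.sum_Ico_eq_sub _ hkj, rootMean, rootMean, treeMean_eq, treeMean_eq]
    ring
  have h2 : ∑ i ∈ Finset.Ico k j, contractCoeff θ n w ^ i ≤ c ^ k / (1 - c) :=
    (Finset.sum_le_sum fun i _ => pow_le_pow_left₀ (contractCoeff_nonneg hθ w)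
      (contractCoeff_le hθ w hc0 hc) i).trans (geom_sum_Ico_le_of_lt_one hc0 hc1)
  rw [h1]
  refine mul_le_mul (wIn_mul_contractCoeff_le hθ w hc fun x => abs_nonneg _) h2
    (Finset.sum_nonneg fun i _ => pow_nonneg (contractCoeff_nonneg hθ w) i) ?_
  exact mul_nonneg hc0 (empMean_nonneg (fun _ => abs_nonneg _) w)

lemma rootMean_le (hθ : 0 < θ) (hc0 : 0 ≤ c) (hc1 : c < 1) (hc : ∀ i, |(w i).wt| ≤ c) (k : ℕ) :
    rootMean θ n w k ≤ empMean n w (fun x => |x.pers|) * (1 - c)⁻¹ := by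
  have h := rootMean_sub_le (n := n) hθ hc0 hc1 hc k.zero_le
  have h0 : rootMean θ n w 0 = empMean n w (fun x => |x.pers|) := by
    simp [rootMean, treeMean_eq]
  have h1 : (1 - c) ≠ 0 := by linarith
  rw [h0] at h
  calc rootMean θ n w k ≤ empMean n w (fun x => |x.pers|) +
        c * empMean n w (fun x => |x.pers|) * (c ^ 0 / (1 - c)) := by linarith
    _ = _ := by field_simp; ring

lemma lintegral_rootRank_abs_le (hθ : 0 < θ) (hn : 1 ≤ n) (hc0 : 0 ≤ c) (hc1 : c < 1)
    (hc : ∀ i, |(w i).wt| ≤ c) (k : ℕ) :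
    ∫⁻ p, ENNReal.ofReal (rootRank abs w k p) ∂(rootedLaw θ n w) ≤
      ENNReal.ofReal (empMean n w (fun x => |x.pers|) * (1 - c)⁻¹) := by
  cases k with
  | zero => simp [rootRank, branchRank]
  | succ k =>
    rw [lintegral_rootRank_abs_succ hθ hn]
    exact ENNReal.ofReal_le_ofReal (rootMean_le hθ hc0 hc1 hc k)

lemma integrable_rootRank_abs (hθ : 0 < θ) (hn : 1 ≤ n) (hc0 : 0 ≤ c) (hc1 : c < 1)
    (hc : ∀ i, |(w i).wt| ≤ c) (k : ℕ) :
    Integrable (rootRank abs w k) (rootedLaw θ n w) := by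
  refine ⟨(measurable_rootRank measurable_abs w k).aestronglyMeasurable, ?_⟩
  rw [hasFiniteIntegral_iff_ofReal (ae_of_all _ (rootRank_abs_nonneg w k))]
  exact (lintegral_rootRank_abs_le hθ hn hc0 hc1 hc k).trans_lt ENNReal.ofReal_lt_top

lemma integral_rootRank_abs_succ (hθ : 0 < θ) (hn : 1 ≤ n) (k : ℕ) :
    ∫ p, rootRank abs w (k + 1) p ∂(rootedLaw θ n w) = rootMean θ n w k := by
  rw [integral_eq_lintegral_of_nonneg_ae (ae_of_all _ (rootRank_abs_nonneg w _))
    (measurable_rootRank measurable_abs w _).aestronglyMeasurable,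
    lintegral_rootRank_abs_succ hθ hn, ← rootMean, ENNReal.toReal_ofReal (rootMean_nonneg hθ k)]

lemma norm_cis_sub_cis_le (r s : ℝ) : ‖cis r - cis s‖ ≤ |r - s| := by
  have h : cis r - cis s = cis s * (Complex.exp (((r - s : ℝ) : ℂ) * Complex.I) - 1) := by
    rw [mul_sub, mul_one, cis, cis, ← Complex.exp_add]
    congr 2
    push_cast; ring
  rw [h, norm_mul, norm_cis, one_mul, mul_comm]
  exact Real.norm_exp_I_mul_ofReal_sub_one_le

lemma integrable_cis {α : Type*} [MeasurableSpace α] {μ : Measure α} [IsFiniteMeasure μ]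
    {f : α → ℝ} (hf : Measurable f) : Integrable (fun x => cis (f x)) μ :=
  Integrable.of_bound (by fun_prop) 1 (ae_of_all _ fun x => (norm_cis _).le)

/-- The exponential is 1-Lipschitz, and a pathwise truncation error is dominated by the increment of
the absolute rank, whose mean is explicit. -/
lemma dist_integral_cis_rootRank_le (hθ : 0 < θ) (hn : 1 ≤ n) (hc0 : 0 ≤ c) (hc1 : c < 1)
    (hc : ∀ i, |(w i).wt| ≤ c) {a : ℝ → ℝ} (ha : Measurable a)
    (hsub : ∀ {k m : ℕ}, k ≤ m → ∀ p : Fin n × (List ℕ × Fin n → List (Fin n) × ℕ),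
      |rootRank a w m p - rootRank a w k p| ≤ rootRank abs w m p - rootRank abs w k p)
    (t : ℝ) {k j : ℕ} (hkj : k ≤ j) :
    dist (∫ p, cis (t * rootRank a w (j + 1) p) ∂(rootedLaw θ n w))
      (∫ p, cis (t * rootRank a w (k + 1) p) ∂(rootedLaw θ n w)) ≤
      |t| * (c * empMean n w (fun x => |x.pers|) * (c ^ k / (1 - c))) := by
  have := isProbabilityMeasure_rootedLaw θ w hn
  have hm := fun k => measurable_rootRank (n := n) ha w k
  have hi := fun k => integrable_rootRank_abs hθ hn hc0 hc1 hc k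
  rw [dist_eq_norm, ← integral_sub (integrable_cis ((hm _).const_mul t))
    (integrable_cis ((hm _).const_mul t))]
  calc _ ≤ ∫ p, |t| * (rootRank abs w (j + 1) p - rootRank abs w (k + 1) p)
        ∂(rootedLaw θ n w) := by
        refine norm_integral_le_of_norm_le (((hi _).sub (hi _)).const_mul _)
          (ae_of_all _ fun p => (norm_cis_sub_cis_le _ _).trans ?_)
        rw [← mul_sub, abs_mul]
        exact mul_le_mul_of_nonneg_left (hsub (Nat.succ_le_succ hkj) p) (abs_nonneg t)
    _ = |t| * (rootMean θ n w j - rootMean θ n w k) := by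
        rw [integral_const_mul, integral_sub (hi _) (hi _), integral_rootRank_abs_succ hθ hn,
          integral_rootRank_abs_succ hθ hn]
    _ ≤ _ := mul_le_mul_of_nonneg_left (rootMean_sub_le hθ hc0 hc1 hc hkj) (abs_nonneg t)

end RootMean

/-! ### From characteristic functions to absolute first moments -/

section AbstractLimit

variable {α : ℕ → Type*} [∀ n, MeasurableSpace (α n)] {μ : ∀ n, Measure (α n)}
  [∀ n, IsProbabilityMeasure (μ n)] {β : Type*} [MeasurableSpace β] {ν : Measure β}
  [IsProbabilityMeasure ν]

lemma tendsto_integral_of_tendsto_integral_cis {R : ∀ n, α n → ℝ} (hR : ∀ n, Measurable (R n))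
    {R' : β → ℝ} (hR' : AEMeasurable R' ν)
    (hchar : ∀ t, Tendsto (fun n => ∫ x, cis (t * R n x) ∂(μ n)) atTop
      (𝓝 (∫ x, cis (t * R' x) ∂ν))) (g : BoundedContinuousFunction ℝ ℝ) :
    Tendsto (fun n => ∫ x, g (R n x) ∂(μ n)) atTop (𝓝 (∫ x, g (R' x) ∂ν)) := by
  let p : ℕ → ProbabilityMeasure ℝ := fun n =>
    ⟨(μ n).map (R n), Measure.isProbabilityMeasure_map (hR n).aemeasurable⟩
  let q : ProbabilityMeasure ℝ := ⟨ν.map R', Measure.isProbabilityMeasure_map hR'⟩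
  have hpq : Tendsto p atTop (𝓝 q) := by
    refine ProbabilityMeasure.tendsto_iff_tendsto_charFun.2 fun t => ?_
    have h1 : ∀ n, charFun (p n : Measure ℝ) t = ∫ x, cis (t * R n x) ∂(μ n) := fun n =>
      charFun_map_eq_integral_cis (hR n).aemeasurable t
    have h2 : charFun (q : Measure ℝ) t = ∫ x, cis (t * R' x) ∂ν :=
      charFun_map_eq_integral_cis hR' t
    simp only [h1, h2]
    exact hchar t
  have h := ProbabilityMeasure.tendsto_iff_forall_integral_tendsto.1 hpq g
  have h1 : ∀ n, ∫ r, g r ∂(p n : Measure ℝ) = ∫ x, g (R n x) ∂(μ n) := fun n =>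
    integral_map (hR n).aemeasurable g.continuous.aestronglyMeasurable
  have h2 : ∫ r, g r ∂(q : Measure ℝ) = ∫ x, g (R' x) ∂ν :=
    integral_map hR' g.continuous.aestronglyMeasurable
  simpa only [h1, h2] using h

/-- The bounded continuous function `r ↦ min |r| M`. -/
def truncAbs (M : ℕ) : BoundedContinuousFunction ℝ ℝ :=
  BoundedContinuousFunction.ofNormedAddCommGroup (fun r => min |r| (M : ℝ)) (by fun_prop) M
    fun r => by
      rw [Real.norm_of_nonneg (le_min (abs_nonneg r) M.cast_nonneg)]
      exact min_le_right _ _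

lemma truncAbs_apply (M : ℕ) (r : ℝ) : truncAbs M r = min |r| (M : ℝ) := rfl

/-- The difference is the positive part of `|r| - M`, which increases with `|r|`; so the tail of a
dominated variable is at most that of the dominating one. -/
lemma abs_sub_truncAbs_mono (M : ℕ) {r s : ℝ} (h : |r| ≤ s) :
    ‖|r| - truncAbs M r‖ ≤ s - truncAbs M s := by
  have hs : |s| = s := abs_of_nonneg ((abs_nonneg r).trans h)
  rw [truncAbs_apply, truncAbs_apply, hs, Real.norm_of_nonneg (sub_nonneg.2 (min_le_left _ _))]
  rcases le_total |r| (M : ℝ) with h1 | h1 <;> rcases le_total s (M : ℝ) with h2 | h2 <;>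
    simp only [h1, h2, min_eq_left, min_eq_right] <;> linarith

lemma abs_integral_abs_sub_le {γ : Type*} [MeasurableSpace γ] {ρ : Measure γ}
    [IsProbabilityMeasure ρ] {R S : γ → ℝ} (hR : AEMeasurable R ρ) (hS : Integrable S ρ)
    (hRS : ∀ᵐ x ∂ρ, |R x| ≤ S x) (M : ℕ) :
    |∫ x, |R x| ∂ρ - ∫ x, truncAbs M (R x) ∂ρ| ≤ ∫ x, S x ∂ρ - ∫ x, truncAbs M (S x) ∂ρ := by
  have hi : ∀ {X : γ → ℝ}, AEMeasurable X ρ → Integrable (fun x => truncAbs M (X x)) ρ :=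
    fun hX => Integrable.of_bound
      ((truncAbs M).continuous.measurable.comp_aemeasurable hX).aestronglyMeasurable
      ‖truncAbs M‖ (ae_of_all _ fun x => (truncAbs M).norm_coe_le_norm _)
  have hRi : Integrable (fun x => |R x|) ρ :=
    hS.mono' (by fun_prop) (hRS.mono fun x hx => by rwa [Real.norm_eq_abs, abs_abs])
  rw [← integral_sub hRi (hi hR), ← integral_sub hS (hi hS.aemeasurable)]
  exact norm_integral_le_of_norm_le (hS.sub (hi hS.aemeasurable))
    (hRS.mono fun x hx => abs_sub_truncAbs_mono M hx)

lemma tendsto_integral_truncAbs {γ : Type*} [MeasurableSpace γ] {ρ : Measure γ} {S : γ → ℝ}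
    (hS : Integrable S ρ) (h0 : ∀ x, 0 ≤ S x) :
    Tendsto (fun M => ∫ x, truncAbs M (S x) ∂ρ) atTop (𝓝 (∫ x, S x ∂ρ)) := by
  refine tendsto_integral_of_dominated_convergence S (fun M =>
    ((truncAbs M).continuous.measurable.comp_aemeasurable hS.aemeasurable).aestronglyMeasurable)
    hS (fun M => ae_of_all _ fun x => ?_) (ae_of_all _ fun x => ?_)
  · rw [truncAbs_apply, Real.norm_of_nonneg (le_min (abs_nonneg _) M.cast_nonneg),
      abs_of_nonneg (h0 x)]
    exact min_le_left _ _
  · refine tendsto_const_nhds.congr' ?_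
    filter_upwards [eventually_ge_atTop ⌈S x⌉₊] with M hM
    rw [truncAbs_apply, abs_of_nonneg (h0 x), min_eq_left (Nat.ceil_le.1 hM)]

/-- If `|R n| ≤ S n`, `R n` and `S n` converge in distribution, and the means of `S n` converge,
then the means of `|R n|` converge. -/
lemma tendsto_integral_abs {R S : ∀ n, α n → ℝ} (hR : ∀ n, Measurable (R n))
    (hS : ∀ n, Integrable (S n) (μ n)) (hSm : ∀ n, Measurable (S n)) (hRS : ∀ n x, |R n x| ≤ S n x)
    {R' S' : β → ℝ} (hR' : AEMeasurable R' ν) (hS' : Integrable S' ν)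
    (hRS' : ∀ᵐ x ∂ν, |R' x| ≤ S' x) (hS0 : ∀ x, 0 ≤ S' x)
    (hRchar : ∀ t, Tendsto (fun n => ∫ x, cis (t * R n x) ∂(μ n)) atTop
      (𝓝 (∫ x, cis (t * R' x) ∂ν)))
    (hSchar : ∀ t, Tendsto (fun n => ∫ x, cis (t * S n x) ∂(μ n)) atTop
      (𝓝 (∫ x, cis (t * S' x) ∂ν)))
    (hmean : Tendsto (fun n => ∫ x, S n x ∂(μ n)) atTop (𝓝 (∫ x, S' x ∂ν))) :
    Tendsto (fun n => ∫ x, |R n x| ∂(μ n)) atTop (𝓝 (∫ x, |R' x| ∂ν)) := by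
  rw [Metric.tendsto_nhds]
  intro ε hε
  have hε3 : 0 < ε / 3 := by positivity
  -- Fix `M` making the tail mean of `S'` less than `ε / 3`. The means of `S n` and of its
  -- truncations both converge, so the tail mean of `S n` is eventually that small too, and both
  -- tails control those of `|R n|` and `|R'|`.
  obtain ⟨M, hM⟩ := (Metric.tendsto_nhds.1 (tendsto_integral_truncAbs hS' hS0) _ hε3).exists
  rw [Real.dist_eq, abs_sub_comm] at hM
  have hM' := (le_abs_self _).trans_lt hM
  have h1 := (hmean.sub (tendsto_integral_of_tendsto_integral_cis hSm hS'.aemeasurable hSchar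
    (truncAbs M))).eventually_lt_const hM'
  have h2 := Metric.tendsto_nhds.1 (tendsto_integral_of_tendsto_integral_cis hR hR' hRchar
    (truncAbs M)) _ hε3
  filter_upwards [h1, h2] with n hn1 hn2
  have h3 := abs_integral_abs_sub_le (hR n).aemeasurable (hS n) (ae_of_all _ (hRS n)) M
  have h4 := abs_integral_abs_sub_le hR' hS' hRS' M
  rw [Real.dist_eq] at hn2 ⊢
  rw [abs_le] at h3 h4
  rw [abs_lt] at hn2 ⊢
  constructor <;> linarith [h3.1, h3.2, h4.1, h4.2, hn2.1, hn2.2]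

end AbstractLimit

/-! ### Deterministic convergence along typical type sequences -/

section Quenched

variable {F : Measure VType} {c : ℝ}

/-- The properties of a sequence of types that entail convergence of the rank of the root of the
branching trees grown from it. -/
structure TypicalTypes (F : Measure VType) (c : ℝ) (w : ℕ → VType) : Prop where
  abs_wt_le : ∀ i, |(w i).wt| ≤ c
  tendsto_pers : Tendsto (fun n => empMean n w fun x => |x.pers|) atTop (𝓝 (∫ x, |x.pers| ∂F))
  tendsto_wIn : Tendsto (fun n => empMean n w VType.wIn) atTop (𝓝 (meanIn F))
  tendsto_persCoeff : Tendsto (fun n => persCoeff (theta F) n w) atTop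
    (𝓝 ((theta F)⁻¹ * (meanOut F * weightMean F * ∫ x, |x.pers| ∂F)))
  tendsto_contractCoeff : Tendsto (fun n => contractCoeff (theta F) n w) atTop (𝓝 (limContract F))
  tendsto_char : ∀ k t, Tendsto (fun n => ∫ p, cis (t * rootRank id w (k + 1) p)
    ∂(rootedLaw (theta F) n w)) atTop (𝓝 (limRootChar id F k t))
  tendsto_char_abs : ∀ k t, Tendsto (fun n => ∫ p, cis (t * rootRank abs w (k + 1) p)
    ∂(rootedLaw (theta F) n w)) atTop (𝓝 (limRootChar abs F k t))

lemma integral_sizeWeight_mul [IsProbabilityMeasure F] (hF : RegularTypes F c) {f : VType → ℝ}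
    (hf : Measurable f) (hfr : ∀ x y, f (recombine x y) = f y) :
    ∫ x, x.wOut * (|x.wt| * invMarkMean x (limRate F)) * f x ∂F =
      meanOut F * weightMean F * ∫ x, f x ∂F := by
  rw [integral_recombine_mul hF (f := fun x => x.wOut * (|x.wt| * invMarkMean x (limRate F)))
    (continuous_sizeWeight _).measurable hf (fun x y => rfl) hfr, weightMean,
    mul_inv_cancel_left₀ hF.meanOut_pos.ne']

/-- Collects all exceptional null sets at once, so that the remaining limit argument is
deterministic in the types. -/
lemma ae_typicalTypes [IsProbabilityMeasure F] (hF : RegularTypes F c) {Ω : Type*}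
    [MeasurableSpace Ω] {P : Measure Ω} [IsProbabilityMeasure P] {W : ℕ → Ω → VType}
    (hWmeas : ∀ i, Measurable (W i)) (hWindep : iIndepFun W P) (hWlaw : ∀ i, P.map (W i) = F) :
    ∀ᵐ ω ∂P, TypicalTypes F c fun i => W i ω := by
  filter_upwards [ae_forall_abs_wt_le hF hWmeas hWlaw,
    strong_law_comp hWmeas hWindep hWlaw (f := fun x => |x.pers|) (by fun_prop) hF.integrable_pers,
    strong_law_comp hWmeas hWindep hWlaw (f := VType.wIn) (by fun_prop) hF.integrable_wIn,
    tendsto_coeff hF hWmeas hWindep hWlaw (f := fun x => |x.pers|) (by fun_prop)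
      (fun _ => abs_nonneg _) hF.integrable_wOut_mul_pers,
    tendsto_coeff hF hWmeas hWindep hWlaw (f := VType.wIn) (by fun_prop)
      VType.wIn_nonneg hF.integrable_wOut_mul_wIn,
    tendsto_integral_cis_rootRank continuous_id (fun _ => rfl) hF hWmeas hWindep hWlaw,
    tendsto_integral_cis_rootRank continuous_abs abs_abs hF hWmeas hWindep hWlaw]
    with ω h1 h2 h3 h4 h5 h6 h7
  refine ⟨h1, h2, h3, ?_, ?_, h6, h7⟩
  · rw [integral_sizeWeight_mul hF (f := fun x => |x.pers|) (by fun_prop) fun x y => rfl] at h4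
    exact h4
  · rw [integral_sizeWeight_mul hF (f := VType.wIn) (by fun_prop) fun x y => rfl] at h5
    have : limContract F = (theta F)⁻¹ * (meanOut F * weightMean F * ∫ x, x.wIn ∂F) := by
      rw [limContract, ← meanIn]; ring
    rw [this]
    exact h5

variable {w : ℕ → VType}

lemma TypicalTypes.tendsto_rootMean (hw : TypicalTypes F c w) (k : ℕ) :
    Tendsto (fun n => rootMean (theta F) n w k) atTop (𝓝 (limAbsMean F (k + 1))) := by
  have h : limAbsMean F (k + 1) = (∫ x, |x.pers| ∂F) + meanIn F * ((theta F)⁻¹ *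
      (meanOut F * weightMean F * ∫ x, |x.pers| ∂F) *
      ∑ i ∈ Finset.range k, limContract F ^ i) := by
    rw [limAbsMean_succ, limAbsMean, limContract]; ring
  rw [h]
  simp only [rootMean, treeMean_eq]
  exact hw.tendsto_pers.add (hw.tendsto_wIn.mul (hw.tendsto_persCoeff.mul
    (tendsto_finsetSum _ fun i _ => hw.tendsto_contractCoeff.pow i)))

lemma TypicalTypes.tendsto_integral_cis [IsProbabilityMeasure F] (hF : RegularTypes F c)
    (hw : TypicalTypes F c w) {a : ℝ → ℝ} (ha : Continuous a)
    (habs : ∀ x u, |pathTerm a x u| ≤ pathTerm abs x u)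
    (hsub : ∀ {n k m : ℕ}, k ≤ m → ∀ p : Fin n × (List ℕ × Fin n → List (Fin n) × ℕ),
      |rootRank a w m p - rootRank a w k p| ≤ rootRank abs w m p - rootRank abs w k p)
    (hchar : ∀ k t, Tendsto (fun n => ∫ p, cis (t * rootRank a w (k + 1) p)
      ∂(rootedLaw (theta F) n w)) atTop (𝓝 (limRootChar a F k t)))
    {κ : ℕ → ℕ} (hκ : Tendsto κ atTop atTop) (t : ℝ) :
    Tendsto (fun n => ∫ p, cis (t * rootRank a w (κ n) p) ∂(rootedLaw (theta F) n w)) atTop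
      (𝓝 (∫ x, cis (t * limSol a x) ∂(nodeLaw (limNodeLaw F)))) := by
  have hc0 := hF.c_nonneg
  have hc1 := hF.c_lt_one
  have hc1' : 0 < 1 - c := by linarith
  -- The empirical mean of `|Q|` is eventually at most `B`, which makes the truncation bound
  -- independent of `n`.
  set B := (∫ x, |x.pers| ∂F) + 1
  refine tendsto_of_uniform_truncation_succ (ε := fun k => |t| * (c * B * (c ^ k / (1 - c))))
    (f := fun n k => ∫ p, cis (t * rootRank a w k p) ∂(rootedLaw (theta F) n w))
    (fun k => hchar k t) (tendsto_limRootChar hF ha habs t) ?_ ?_ hκ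
  · simpa using (((tendsto_pow_atTop_nhds_zero_of_lt_one hc0 hc1).div_const (1 - c)).const_mul
      (c * B)).const_mul |t|
  · filter_upwards [hw.tendsto_pers.eventually_le_const (lt_add_one _), eventually_ge_atTop 1]
      with n hB hn k j hkj
    refine (dist_integral_cis_rootRank_le hF.theta_pos hn hc0 hc1 hw.abs_wt_le ha.measurable hsub
      t hkj).trans ?_
    gcongr

lemma TypicalTypes.tendsto_integral_rootRank_abs [IsProbabilityMeasure F] (hF : RegularTypes F c)
    (hw : TypicalTypes F c w) {κ : ℕ → ℕ} (hκ : Tendsto κ atTop atTop) :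
    Tendsto (fun n => ∫ p, rootRank abs w (κ n) p ∂(rootedLaw (theta F) n w)) atTop
      (𝓝 (∫ x, limSol abs x ∂(nodeLaw (limNodeLaw F)))) := by
  have hc0 := hF.c_nonneg
  have hc1 := hF.c_lt_one
  have hc1' : 0 < 1 - c := by linarith
  set B := (∫ x, |x.pers| ∂F) + 1
  rw [integral_limSol_abs hF]
  refine tendsto_of_uniform_truncation_succ (ε := fun k => c * B * (c ^ k / (1 - c)))
    (f := fun n k => ∫ p, rootRank abs w k p ∂(rootedLaw (theta F) n w))
    (g := fun k => limAbsMean F (k + 1)) (fun k => ?_)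
    ((tendsto_add_atTop_iff_nat 1).2 (tendsto_limAbsMean hF)) ?_ ?_ hκ
  · refine (hw.tendsto_rootMean k).congr' ?_
    filter_upwards [eventually_ge_atTop 1] with n hn
    rw [integral_rootRank_abs_succ hF.theta_pos hn]
  · simpa using ((tendsto_pow_atTop_nhds_zero_of_lt_one hc0 hc1).div_const (1 - c)).const_mul
      (c * B)
  · filter_upwards [hw.tendsto_pers.eventually_le_const (lt_add_one _), eventually_ge_atTop 1]
      with n hB hn k j hkj
    have hi := integrable_rootRank_abs hF.theta_pos hn hc0 hc1 hw.abs_wt_le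
    have h0 : rootMean (theta F) n w k ≤ rootMean (theta F) n w j := by
      rw [← integral_rootRank_abs_succ hF.theta_pos hn, ← integral_rootRank_abs_succ hF.theta_pos
          hn]
      exact integral_mono (hi _) (hi _) fun p => sub_nonneg.1
        ((abs_nonneg _).trans (abs_rootRank_sub_le w (Nat.succ_le_succ hkj) p))
    rw [integral_rootRank_abs_succ hF.theta_pos hn, integral_rootRank_abs_succ hF.theta_pos hn,
      Real.dist_eq, abs_of_nonneg (sub_nonneg.2 h0)]
    refine (rootMean_sub_le hF.theta_pos hc0 hc1 hw.abs_wt_le hkj).trans ?_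
    gcongr

lemma rootRank_abs_sub_le (w : ℕ → VType) {n k m : ℕ} (hkm : k ≤ m)
    (p : Fin n × (List ℕ × Fin n → List (Fin n) × ℕ)) :
    |rootRank abs w m p - rootRank abs w k p| ≤ rootRank abs w m p - rootRank abs w k p :=
  (abs_of_nonneg ((abs_nonneg _).trans (abs_rootRank_sub_le w hkm p))).le

lemma TypicalTypes.tendsto_integral_cis_id [IsProbabilityMeasure F] (hF : RegularTypes F c)
    (hw : TypicalTypes F c w) {κ : ℕ → ℕ} (hκ : Tendsto κ atTop atTop) (t : ℝ) :
    Tendsto (fun n => ∫ p, cis (t * rootRank id w (κ n) p) ∂(rootedLaw (theta F) n w)) atTop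
      (𝓝 (∫ x, cis (t * limSol id x) ∂(nodeLaw (limNodeLaw F)))) :=
  hw.tendsto_integral_cis hF continuous_id (fun x u => (abs_pathTerm x u).le)
    (abs_rootRank_sub_le w) hw.tendsto_char hκ t

lemma TypicalTypes.tendsto_integral_abs_rootRank [IsProbabilityMeasure F] (hF : RegularTypes F c)
    (hw : TypicalTypes F c w) {κ : ℕ → ℕ} (hκ : Tendsto κ atTop atTop) :
    Tendsto (fun n => ∫ p, |rootRank id w (κ n) p| ∂(rootedLaw (theta F) n w)) atTop
      (𝓝 (∫ x, |limSol id x| ∂(nodeLaw (limNodeLaw F)))) := by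
  have := isProbabilityMeasure_branchLaw (F := F)
  have := isProbabilityMeasure_weightLaw hF
  have hpr : ∀ n, IsProbabilityMeasure (rootedLaw (theta F) (n + 1) w) := fun n =>
    isProbabilityMeasure_rootedLaw _ w n.succ_pos
  -- With no vertices there is no uniform root type, so the sequence is shifted to make every law a
  -- probability measure.
  rw [← tendsto_add_atTop_iff_nat 1]
  refine tendsto_integral_abs (μ := fun n => rootedLaw (theta F) (n + 1) w)
    (R := fun n => rootRank id w (κ (n + 1))) (S := fun n => rootRank abs w (κ (n + 1)))
    (S' := limSol abs) (fun n => measurable_rootRank measurable_id w _)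
    (fun n => integrable_rootRank_abs hF.theta_pos n.succ_pos hF.c_nonneg hF.c_lt_one
      hw.abs_wt_le _)
    (fun n => measurable_rootRank measurable_abs w _) (fun n p => abs_rootRank_le w _ p)
    (integrable_limSol hF).aemeasurable (integrable_limSol_abs hF) ?_ limSol_abs_nonneg
    (fun t => (tendsto_add_atTop_iff_nat 1).2 (hw.tendsto_integral_cis_id hF hκ t))
    (fun t => (tendsto_add_atTop_iff_nat 1).2 (hw.tendsto_integral_cis hF continuous_abs
      abs_pathTerm_abs_le (rootRank_abs_sub_le w) hw.tendsto_char_abs hκ t))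
    ((tendsto_add_atTop_iff_nat 1).2 (hw.tendsto_integral_rootRank_abs hF hκ))
  filter_upwards [ae_summable_pathTerm hF] with x hx
  exact abs_limSol_le hx

end Quenched

/-! ### Conditioning on the types -/

instance (n : ℕ) : DiscreteMeasurableSpace (Option (Fin n × ℕ)) := ⟨fun _ => trivial⟩

/-- After embedding into the real line, half-lines with rational endpoints form a countable
generating π-system. Countability permits exchanging "for every event, almost surely" and "almost
surely, for every event". -/
lemma measure_eq_of_forall_rat {α : Type*} [MeasurableSpace α] [StandardBorelSpace α]
    {μ ν : Measure α} [IsProbabilityMeasure μ] [IsProbabilityMeasure ν]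
    (h : ∀ q : ℚ, μ.real (embeddingReal α ⁻¹' Set.Iic (q : ℝ)) =
      ν.real (embeddingReal α ⁻¹' Set.Iic (q : ℝ))) : μ = ν := by
  have hf := measurableEmbedding_embeddingReal α
  have hμ := Measure.isProbabilityMeasure_map (μ := μ) hf.measurable.aemeasurable
  have hν := Measure.isProbabilityMeasure_map (μ := ν) hf.measurable.aemeasurable
  have hmap : μ.map (embeddingReal α) = ν.map (embeddingReal α) := by
    refine ext_of_generate_finite _ Real.borel_eq_generateFrom_Iic_rat Real.isPiSystem_Iic_rat ?_
      (by simp)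
    intro s hs
    obtain ⟨q, rfl⟩ : ∃ q : ℚ, s = Set.Iic (q : ℝ) := by simpa [eq_comm] using hs
    rw [Measure.map_apply hf.measurable measurableSet_Iic,
      Measure.map_apply hf.measurable measurableSet_Iic]
    exact (measureReal_eq_measureReal_iff).1 (h q)
  rw [← hf.comap_map μ, hmap, hf.comap_map]

lemma ae_eq_of_forall_ae_real_eq {Ω α : Type*} [MeasurableSpace Ω] {P : Measure Ω}
    [MeasurableSpace α] [StandardBorelSpace α] {μ ν : Ω → Measure α}
    (hμ : ∀ ω, IsProbabilityMeasure (μ ω)) (hν : ∀ ω, IsProbabilityMeasure (ν ω))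
    (h : ∀ A, MeasurableSet A → ∀ᵐ ω ∂P, (μ ω).real A = (ν ω).real A) : ∀ᵐ ω ∂P, μ ω = ν ω := by
  have h2 : ∀ᵐ ω ∂P, ∀ q : ℚ, (μ ω).real (embeddingReal α ⁻¹' Set.Iic (q : ℝ)) =
      (ν ω).real (embeddingReal α ⁻¹' Set.Iic (q : ℝ)) := ae_all_iff.2 fun q =>
    h _ ((measurableEmbedding_embeddingReal α).measurable measurableSet_Iic)
  filter_upwards [h2] with ω hω
  have := hμ ω
  have := hν ω
  exact measure_eq_of_forall_rat hω

section Conditional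

variable {Ω : Type*}

lemma typeSigma_eq_comap (W : ℕ → Ω → VType) :
    typeSigma W = MeasurableSpace.comap (fun ω i => W i ω) inferInstance := by
  rw [typeSigma, MeasurableSpace.pi, MeasurableSpace.comap_iSup]
  simp only [MeasurableSpace.comap_comp]
  rfl

variable [MeasurableSpace Ω] {P : Measure Ω} [IsProbabilityMeasure P] {W : ℕ → Ω → VType} {n : ℕ}
    {T : Ω → MarkedTree n} {θ : ℝ}

lemma measurable_types (hWmeas : ∀ i, Measurable (W i)) : Measurable fun ω i => W i ω :=
  measurable_pi_lambda _ hWmeas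

/-- The hypothesis gives agreement event by event, off a null set depending on the event; the
countable π-system yields one null set. Since `condDistrib` is already a kernel, measurability of
`pbtLaw` in the types need not be checked. -/
lemma condDistrib_eq_pbtLaw (hWmeas : ∀ i, Measurable (W i)) (hT : Measurable T) (hn : 1 ≤ n)
    (hlaw : ∀ A : Set (MarkedTree n), MeasurableSet A →
      P⟦T ⁻¹' A | typeSigma W⟧ =ᵐ[P] fun ω => (pbtLaw θ n (fun i => W i ω)).real A) :
    ∀ᵐ ω ∂P, condDistrib T (fun ω i => W i ω) P (fun i => W i ω) =
      pbtLaw θ n (fun i => W i ω) := by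
  refine ae_eq_of_forall_ae_real_eq (fun ω => inferInstance)
    (fun ω => isProbabilityMeasure_pbtLaw θ _ hn) fun A hA => ?_
  have h := condDistrib_ae_eq_condExp (μ := P) (measurable_types hWmeas) hT hA
  rw [← typeSigma_eq_comap] at h
  exact h.trans (hlaw A hA)

lemma measurable_rank_comp (hWmeas : ∀ i, Measurable (W i)) (hT : Measurable T) (k : ℕ) :
    Measurable fun ω => treeRank (fun i => W i ω) (T ω) k [] :=
  (measurable_treeRank k []).comp ((measurable_types hWmeas).prodMk hT)

lemma integral_treeRank_pbtLaw {E : Type*} [NormedAddCommGroup E] [NormedSpace ℝ E] {g : ℝ → E}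
    (hg : StronglyMeasurable g) (w w' : ℕ → VType) (k : ℕ) :
    ∫ S, g (treeRank w' S k []) ∂(pbtLaw θ n w) =
      ∫ p, g (rootRank id w' k p) ∂(rootedLaw θ n w) := by
  have hm : Measurable fun S : MarkedTree n => treeRank w' S k [] :=
    (measurable_treeRank k []).comp measurable_prodMk_left
  rw [← integral_map hm.aemeasurable hg.aestronglyMeasurable, map_treeRank_pbtLaw,
    integral_map (measurable_rootRank measurable_id w' k).aemeasurable hg.aestronglyMeasurable]

lemma lintegral_treeRank_pbtLaw {g : ℝ → ℝ≥0∞}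
    (hg : Measurable g) (w w' : ℕ → VType) (k : ℕ) :
    ∫⁻ S, g (treeRank w' S k []) ∂(pbtLaw θ n w) =
      ∫⁻ p, g (rootRank id w' k p) ∂(rootedLaw θ n w) := by
  have hm : Measurable fun S : MarkedTree n => treeRank w' S k [] :=
    (measurable_treeRank k []).comp measurable_prodMk_left
  rw [← lintegral_map hg hm, map_treeRank_pbtLaw,
    lintegral_map hg (measurable_rootRank measurable_id w' k)]

/-- The rank depends on the types both directly and through the tree. Disintegration freezes the
direct dependence and integrates only over the tree. -/
lemma condExp_rank (hWmeas : ∀ i, Measurable (W i)) (hT : Measurable T) (hn : 1 ≤ n)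
    (hlaw : ∀ A : Set (MarkedTree n), MeasurableSet A →
      P⟦T ⁻¹' A | typeSigma W⟧ =ᵐ[P] fun ω => (pbtLaw θ n (fun i => W i ω)).real A)
    {E : Type*} [NormedAddCommGroup E] [NormedSpace ℝ E] [CompleteSpace E] {g : ℝ → E}
    (hg : StronglyMeasurable g) (k : ℕ)
    (hint : Integrable (fun ω => g (treeRank (fun i => W i ω) (T ω) k [])) P) :
    P[fun ω => g (treeRank (fun i => W i ω) (T ω) k []) | typeSigma W] =ᵐ[P]
      fun ω => ∫ p, g (rootRank id (fun i => W i ω) k p) ∂(rootedLaw θ n fun i => W i ω) := by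
  have h := condExp_prod_ae_eq_integral_condDistrib (μ := P) (measurable_types hWmeas)
    hT.aemeasurable (hg.comp_measurable (measurable_treeRank k [])) hint
  rw [← typeSigma_eq_comap] at h
  refine h.trans ?_
  filter_upwards [condDistrib_eq_pbtLaw hWmeas hT hn hlaw] with ω hω
  rw [hω]
  exact integral_treeRank_pbtLaw hg _ _ k

lemma lintegral_rank (hWmeas : ∀ i, Measurable (W i)) (hT : Measurable T) (hn : 1 ≤ n)
    (hlaw : ∀ A : Set (MarkedTree n), MeasurableSet A →
      P⟦T ⁻¹' A | typeSigma W⟧ =ᵐ[P] fun ω => (pbtLaw θ n (fun i => W i ω)).real A)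
    {g : ℝ → ℝ≥0∞} (hg : Measurable g) (k : ℕ) :
    ∫⁻ ω, g (treeRank (fun i => W i ω) (T ω) k []) ∂P =
      ∫⁻ ω, ∫⁻ p, g (rootRank id (fun i => W i ω) k p) ∂(rootedLaw θ n fun i => W i ω) ∂P := by
  have hX := measurable_types hWmeas
  have hgm : Measurable fun p : (ℕ → VType) × MarkedTree n => g (treeRank p.1 p.2 k []) :=
    hg.comp (measurable_treeRank k [])
  rw [← lintegral_map (f := fun p : (ℕ → VType) × MarkedTree n => g (treeRank p.1 p.2 k []))
    hgm (hX.prodMk hT), ← compProd_map_condDistrib hT.aemeasurable,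
    Measure.lintegral_compProd hgm, lintegral_map hgm.lintegral_kernel_prod_right' hX]
  refine lintegral_congr_ae ?_
  filter_upwards [condDistrib_eq_pbtLaw hWmeas hT hn hlaw] with ω hω
  rw [hω]
  exact lintegral_treeRank_pbtLaw hg _ _ k

/-- Given the types, the mean of the absolute rank is at most the empirical mean of `|Q|` divided by
`1 - c`, uniformly in `k`, and this bound is integrable. -/
lemma integrable_rank {F : Measure VType} {c : ℝ} (hF : RegularTypes F c)
    (hWmeas : ∀ i, Measurable (W i)) (hWlaw : ∀ i, P.map (W i) = F) (hT : Measurable T)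
    (hn : 1 ≤ n) (hlaw : ∀ A : Set (MarkedTree n), MeasurableSet A →
      P⟦T ⁻¹' A | typeSigma W⟧ =ᵐ[P] fun ω => (pbtLaw (theta F) n (fun i => W i ω)).real A)
    (k : ℕ) : Integrable (fun ω => treeRank (fun i => W i ω) (T ω) k []) P := by
  refine ⟨(measurable_rank_comp hWmeas hT k).aestronglyMeasurable, ?_⟩
  have hint : Integrable (fun ω => empMean n (fun i => W i ω) (fun x => |x.pers|) * (1 - c)⁻¹)
      P := by
    simp only [empMean, smul_eq_mul]
    refine ((integrable_finsetSum _ fun i _ => ?_).const_mul _).mul_const _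
    have := hF.integrable_pers
    rw [← hWlaw i] at this
    exact this.comp_measurable (hWmeas i)
  rw [hasFiniteIntegral_iff_norm]
  calc _ = ∫⁻ ω, ∫⁻ p, ENNReal.ofReal ‖rootRank id (fun i => W i ω) k p‖
        ∂(rootedLaw (theta F) n fun i => W i ω) ∂P :=
        lintegral_rank hWmeas hT hn hlaw (g := fun r => ENNReal.ofReal ‖r‖) (by fun_prop) k
    _ ≤ ∫⁻ ω, ENNReal.ofReal (empMean n (fun i => W i ω) (fun x => |x.pers|) * (1 - c)⁻¹) ∂P := by
        refine lintegral_mono_ae ?_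
        filter_upwards [ae_forall_abs_wt_le hF hWmeas hWlaw] with ω hω
        exact (lintegral_mono fun p => ENNReal.ofReal_le_ofReal (abs_rootRank_le _ k p)).trans
          (lintegral_rootRank_abs_le hF.theta_pos hn hF.c_nonneg hF.c_lt_one hω k)
    _ < ∞ := hint.lintegral_lt_top

end Conditional

/-- The characteristic function of the rank of the root converges. -/
lemma tendsto_integral_cis_rank {F : Measure VType} [IsProbabilityMeasure F] {c : ℝ}
    (hF : RegularTypes F c) {Ω : Type*} [MeasurableSpace Ω] {P : Measure Ω}
    [IsProbabilityMeasure P] {W : ℕ → Ω → VType} (hWmeas : ∀ i, Measurable (W i))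
    (hWindep : iIndepFun W P) (hWlaw : ∀ i, P.map (W i) = F) {T : (n : ℕ) → Ω → MarkedTree n}
    (hTmeas : ∀ n, Measurable (T n))
    (hTlaw : ∀ n, 1 ≤ n → ∀ A : Set (MarkedTree n), MeasurableSet A →
      P⟦T n ⁻¹' A | typeSigma W⟧ =ᵐ[P] fun ω => (pbtLaw (theta F) n (fun i => W i ω)).real A)
    {k : ℕ → ℕ} (hk : Tendsto k atTop atTop) (t : ℝ) :
    Tendsto (fun n => ∫ ω, cis (t * treeRank (fun i => W i ω) (T n ω) (k n) []) ∂P) atTop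
      (𝓝 (∫ x, cis (t * limSol id x) ∂(nodeLaw (limNodeLaw F)))) := by
  have hXm : ∀ n, Measurable fun ω => treeRank (fun i => W i ω) (T n ω) (k n) [] := fun n =>
    measurable_rank_comp hWmeas (hTmeas n) (k n)
  have hle : typeSigma W ≤ ‹MeasurableSpace Ω› := by
    rw [typeSigma_eq_comap]
    exact (measurable_types hWmeas).comap_le
  let Φ : ℕ → Ω → ℂ := fun n =>
    P[fun ω => cis (t * treeRank (fun i => W i ω) (T n ω) (k n) []) | typeSigma W]
  have hΦ : ∀ n, 1 ≤ n → Φ n =ᵐ[P] fun ω => ∫ p, cis (t * rootRank id (fun i => W i ω) (k n) p)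
      ∂(rootedLaw (theta F) n fun i => W i ω) := fun n hn =>
    condExp_rank hWmeas (hTmeas n) hn (hTlaw n hn) (g := fun r => cis (t * r))
      (by fun_prop : Continuous fun r : ℝ => cis (t * r)).stronglyMeasurable (k n)
      (integrable_cis ((hXm n).const_mul t))
  have hint : ∀ n, ∫ ω, Φ n ω ∂P =
      ∫ ω, cis (t * treeRank (fun i => W i ω) (T n ω) (k n) []) ∂P := fun n => integral_condExp hle
  simp only [← hint]
  have hconst : ∫ x, cis (t * limSol id x) ∂(nodeLaw (limNodeLaw F)) =
      ∫ _, (∫ x, cis (t * limSol id x) ∂(nodeLaw (limNodeLaw F))) ∂P := by simp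
  rw [hconst]
  -- Conditional characteristic functions converge almost surely and are bounded by one, so their
  -- expectations converge.
  refine tendsto_integral_filter_of_dominated_convergence (fun _ => 1)
    (Eventually.of_forall fun n => integrable_condExp.aestronglyMeasurable) ?_
    (integrable_const 1) ?_
  · filter_upwards [eventually_ge_atTop 1] with n hn
    filter_upwards [hΦ n hn] with ω hω
    have := isProbabilityMeasure_rootedLaw (theta F) (fun i => W i ω) hn
    rw [hω]
    simpa using norm_integral_le_of_norm_le_const (C := 1)
      (μ := rootedLaw (theta F) n fun i => W i ω)
      (f := fun p => cis (t * rootRank id (fun i => W i ω) (k n) p))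
      (ae_of_all _ fun p => (norm_cis _).le)
  · have hall : ∀ᵐ ω ∂P, ∀ n, 1 ≤ n → Φ n ω = ∫ p, cis (t * rootRank id (fun i => W i ω) (k n) p)
        ∂(rootedLaw (theta F) n fun i => W i ω) := by
      refine ae_all_iff.2 fun n => ?_
      by_cases hn : 1 ≤ n
      · exact (hΦ n hn).mono fun ω h _ => h
      · exact ae_of_all _ fun ω h => absurd h hn
    filter_upwards [hall, ae_typicalTypes hF hWmeas hWindep hWlaw] with ω h1 h2
    refine (h2.tendsto_integral_cis_id hF hk t).congr' ?_
    filter_upwards [eventually_ge_atTop 1] with n hn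
    exact (h1 n hn).symm

end

theorem theoremT
    -- the i.i.d. type sequence, with common law `F`
    {Ω : Type*} [MeasurableSpace Ω] (P : Measure Ω) [IsProbabilityMeasure P]
    (F : Measure VType) (hF : TypeAssumption F) (hpos : 0 < meanOut F)
    (W : ℕ → Ω → VType) (hWmeas : ∀ i, Measurable (W i)) (hWindep : iIndepFun W P)
    (hWlaw : ∀ i, P.map (W i) = F)
    -- for each `n ≥ 1`, a Poisson branching tree given the types
    (T : (n : ℕ) → Ω → MarkedTree n) (hTmeas : ∀ n, Measurable (T n))
    (hTlaw : ∀ n, 1 ≤ n → ∀ A : Set (MarkedTree n), MeasurableSet A →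
      P⟦T n ⁻¹' A | typeSigma W⟧ =ᵐ[P]
        fun ω => (pbtLaw (theta F) n (fun i => W i ω)).real A)
    -- the weighted branching process that defines the limit
    {Ω' : Type*} [MeasurableSpace Ω'] (P' : Measure Ω') [IsProbabilityMeasure P']
    (N : List ℕ → Ω' → ℕ) (Q C : List ℕ → Ω' → ℝ) (hB : IsBranchingFamily F P' N Q C)
    (k : ℕ → ℕ) (hk : Tendsto k atTop atTop) :
    -- the limit is well defined and integrable
    (∀ᵐ ω ∂P', Summable (fun u => pathWeight (fun v => N v ω) (fun v => C v ω) u * Q u ω)) ∧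
    Integrable (fun ω => endogenousSolution (fun v => N v ω) (fun v => Q v ω) (fun v => C v ω)) P' ∧
    -- weak convergence
    TendstoInDistribution (fun n ω => treeRank (fun i => W i ω) (T n ω) (k n) []) atTop
      (fun ω => endogenousSolution (fun v => N v ω) (fun v => Q v ω) (fun v => C v ω))
      (fun _ => P) P' ∧
    -- convergence of the conditional first absolute moments
    (∀ n, 1 ≤ n → Integrable (fun ω => treeRank (fun i => W i ω) (T n ω) (k n) []) P) ∧
    ∀ᵐ ω ∂P, Tendsto
      (fun n => (P[fun ω' => |treeRank (fun i => W i ω') (T n ω') (k n) []| | typeSigma W]) ω) atTop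
      (𝓝 (∫ ω', |endogenousSolution (fun v => N v ω') (fun v => Q v ω') (fun v => C v ω')| ∂P')) := by
  have : IsProbabilityMeasure F := by
    rw [← hWlaw 0]
    exact Measure.isProbabilityMeasure_map (hWmeas 0).aemeasurable
  obtain ⟨c, hF⟩ := hF.exists_regularTypes hpos
  -- Summability and integrability depend only on the law of the node data, so they pass from the
  -- canonical space to `P'`.
  have hsum := ae_summable_pathTerm hF
  have hsol := integrable_limSol hF
  rw [← map_nodeFamily hB] at hsum hsol
  have hNm := measurable_nodeFamily hB
  have hsolP : Integrable (fun ω => endogenousSolution (fun v => N v ω) (fun v => Q v ω)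
    (fun v => C v ω)) P' := hsol.comp_measurable hNm
  have htyp := ae_typicalTypes hF hWmeas hWindep hWlaw
  have hXm : ∀ n, Measurable fun ω => treeRank (fun i => W i ω) (T n ω) (k n) [] := fun n =>
    measurable_rank_comp hWmeas (hTmeas n) (k n)
  have hXint : ∀ n, 1 ≤ n →
      Integrable (fun ω => treeRank (fun i => W i ω) (T n ω) (k n) []) P := fun n hn =>
    integrable_rank hF hWmeas hWlaw (hTmeas n) hn (hTlaw n hn) (k n)
  refine ⟨?_, hsolP, ⟨fun n => (hXm n).aemeasurable, hsolP.aemeasurable, ?_⟩, hXint, ?_⟩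
  · filter_upwards [ae_of_ae_map hNm.aemeasurable hsum] with ω hω
    exact Summable.of_norm_bounded hω fun u => (abs_pathTerm (nodeFamily N Q C ω) u).le
  · refine ProbabilityMeasure.tendsto_iff_tendsto_charFun.2 fun t => ?_
    have hlim : charFun (P'.map fun ω => endogenousSolution (fun v => N v ω) (fun v => Q v ω)
        (fun v => C v ω)) t = ∫ x, cis (t * limSol id x) ∂(nodeLaw (limNodeLaw F)) := by
      rw [charFun_map_eq_integral_cis hsolP.aemeasurable, ← map_nodeFamily hB,
        integral_map hNm.aemeasurable
          (by have := hsol.aestronglyMeasurable; fun_prop)]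
      rfl
    have hchar : ∀ n, charFun (P.map fun ω => treeRank (fun i => W i ω) (T n ω) (k n) []) t =
        ∫ ω, cis (t * treeRank (fun i => W i ω) (T n ω) (k n) []) ∂P := fun n =>
      charFun_map_eq_integral_cis (hXm n).aemeasurable t
    exact (tendsto_integral_cis_rank hF hWmeas hWindep hWlaw hTmeas hTlaw hk t).congr
      (fun n => (hchar n).symm) |>.trans (by rw [← hlim]; rfl)
  -- Each conditional expectation is determined up to a null set; countably many `n` leave one
  -- common null set outside which all formulas hold.
  · have hcond : ∀ᵐ ω ∂P, ∀ n, 1 ≤ n →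
        (P[fun ω' => |treeRank (fun i => W i ω') (T n ω') (k n) []| | typeSigma W]) ω =
          ∫ p, |rootRank id (fun i => W i ω) (k n) p| ∂(rootedLaw (theta F) n fun i => W i ω) := by
      refine ae_all_iff.2 fun n => ?_
      by_cases hn : 1 ≤ n
      · filter_upwards [condExp_rank hWmeas (hTmeas n) hn (hTlaw n hn)
          continuous_abs.stronglyMeasurable (k n) (hXint n hn).abs] with ω hω _
        exact hω
      · exact ae_of_all _ fun ω h => absurd h hn
    have hlim : ∫ ω', |endogenousSolution (fun v => N v ω') (fun v => Q v ω')
        (fun v => C v ω')| ∂P' = ∫ x, |limSol id x| ∂(nodeLaw (limNodeLaw F)) := by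
      rw [← map_nodeFamily hB, integral_map hNm.aemeasurable hsol.abs.aestronglyMeasurable]
      rfl
    rw [hlim]
    filter_upwards [hcond, htyp] with ω h1 h2
    refine (h2.tendsto_integral_abs_rootRank hF hk).congr' ?_
    filter_upwards [eventually_ge_atTop 1] with n hn
    exact (h1 n hn).symm
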